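/- **Setting.** Let $(Y_t)_{t\in\mathbb Z}$ be a strictly stationary process with values in $\mathbb R^d$, and let $(\varepsilon_t)_{t\in\mathbb Z}$ be i.i.d. real random variables, independent of $(Y_t)_{t\in\mathbb Z}$, with $\mathbb E\,\varepsilon_0=0$ and $\mathbb E\,\varepsilon_0^2=1$. Consider the location-scale autoregression $$X_t=r(Y_{t-1},X_{t-1})+\varepsilon_t\,\sigma(Y_{t-1},X_{t-1}),$$ where $r:\mathbb R^d\times\mathbb R\to\mathbb R$ and $\sigma:\mathbb R^d\times\mathbb R\to\mathbb R_+$ are measurable and satisfy, for all $(y,x)\in\mathbb R^d\times\mathbb R$, $$|r(y,x)|\le a_r(y)|x|+b_r(y),\qquad |\sigma(y,x)|\le c_\sigma(y)|x|+d_\sigma(y),$$ with measurable functions $a_r,b_r,c_\sigma,d_\sigma:\mathbb R^d\to\mathbb R_+$. Put $\gamma=a_r+c_\sigma$ and $K=b_r+d_\sigma$. "Solution" means either of the following: * (started) $(X_t)_{t\ge 0}$ with $X_0=x$ for a deterministic, arbitrary $x\in\mathbb R$, satisfying the recursion for all $t\ge1$; * (stationary) $(X_t)_{t\in\mathbb Z}$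 satisfying the recursion almost surely for every $t\in\mathbb Z$, such that $((X_t,Y_t))_{t\in\mathbb Z}$ is strictly stationary and, for every $t$, $\varepsilon_{t+1}$ is independent of $\sigma(X_k,k\le t;\,Y_k,k\in\mathbb Z)$. For a process $W$ indexed by $I=\mathbb N$ or $I=\mathbb Z$, let $$\alpha_W(n)=\sup_{j\in I}\ \sup\bigl\{|\mathbb P(G\cap H)-\mathbb P(G)\mathbb P(H)|:\ G\in\sigma(W_k,k\le j),\ H\in\sigma(W_k,k\ge j+n)\bigr\};$$ $W$ is $\alpha$-mixing if $\alpha_W(n)\to0$. Write $\alpha_{X,Y}$ for the coefficients of $((X_t,Y_t))_{t\in I}$, with $I=\mathbb N$ for a started solution and $I=\mathbb Z$ for a stationary one. **Proposition.** Suppose that $\alpha_Y(m)=O(m^{-a})$ for some $a>0$, that the law of $\varepsilon_0$ has a density $f$ with respect to Lebesgue measure which is bounded below by a positive constant on every compact interval, and that $\inf_{|x|\le R}\sigma(y,x)>0$ for every $R>0$ and every $y\in\mathbb R^d$. 1. Suppose there is $\gamma_+\in(0,1)$ with $\gamma(Y_0)\le\gamma_+$ almost surely and $\mathbb E\,K(Y_0)<\infty$.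 Then, for every solution $X$ (started or stationary), the process $((X_t,Y_t))_t$ is $\alpha$-mixing and $$\alpha_{X,Y}(m)=O\bigl((\log m)^a\,m^{-a}\bigr)\qquad(m\to\infty).$$ 2. Suppose that $\gamma(Y_0)\in[0,1]$ almost surely, $\mathbb P(\gamma(Y_0)<1)>0$, $\mathbb E\,K(Y_0)^k<\infty$ for some real $k>1$, and $b:=a(k-1)/k>1$. Then, for every solution $X$ (started or stationary), the process $((X_t,Y_t))_t$ is $\alpha$-mixing and $$\alpha_{X,Y}(m)=O\bigl((\log m)^{2b-1}\,m^{-b+1}\bigr)\qquad(m\to\infty).$$ -/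

import Mathlib

open MeasureTheory ProbabilityTheory Filter Topology Asymptotics

noncomputable section

/-- The strong mixing (`α`) measure of dependence between two `σ`-algebras:
the supremum of `|P(G ∩ H) - P(G) P(H)|` over `G ∈ m₁` and `H ∈ m₂`. -/
def alphaDep {Ω : Type*} [MeasurableSpace Ω] (P : Measure Ω)
    (m₁ m₂ : MeasurableSpace Ω) : ℝ :=
  sSup {v : ℝ | ∃ G H : Set Ω, MeasurableSet[m₁] G ∧ MeasurableSet[m₂] H ∧
    v = |P.real (G ∩ H) - P.real G * P.real H|}

/-- The `σ`-algebra generated by `W k`, `k ≤ j`. -/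
abbrev pastSigma {Ω I S : Type*} [Preorder I] [MeasurableSpace S] (W : I → Ω → S) (j : I) :
    MeasurableSpace Ω :=
  ⨆ k : I, ⨆ _ : k ≤ j, MeasurableSpace.comap (W k) inferInstance

/-- The `σ`-algebra generated by `W k`, `k ≥ j`. -/
abbrev futureSigma {Ω I S : Type*} [Preorder I] [MeasurableSpace S] (W : I → Ω → S) (j : I) :
    MeasurableSpace Ω :=
  ⨆ k : I, ⨆ _ : j ≤ k, MeasurableSpace.comap (W k) inferInstance

/-- The strong mixing coefficients of a process indexed by `I = ℕ` or `I = ℤ`: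
`α_W(n) = sup_j α(σ(W_k, k ≤ j), σ(W_k, k ≥ j + n))`. -/
def alphaMix {Ω I S : Type*} [MeasurableSpace Ω] [Preorder I] [AddMonoidWithOne I]
    [MeasurableSpace S] (P : Measure Ω) (W : I → Ω → S) (n : ℕ) : ℝ :=
  ⨆ j : I, alphaDep P (pastSigma W j) (futureSigma W (j + (n : I)))

/-- A process is `α`-mixing if its strong mixing coefficients tend to `0`. -/
def IsAlphaMixing {Ω I S : Type*} [MeasurableSpace Ω] [Preorder I] [AddMonoidWithOne I]
    [MeasurableSpace S] (P : Measure Ω) (W : I → Ω → S) : Prop :=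
  Tendsto (alphaMix P W) atTop (𝓝 0)

/-- Strict stationarity of a two-sided process: the law of the whole path is invariant
under time shifts. -/
def IsStrictlyStationary {Ω S : Type*} [MeasurableSpace Ω] [MeasurableSpace S]
    (P : Measure Ω) (W : ℤ → Ω → S) : Prop :=
  ∀ h : ℤ, IdentDistrib (fun ω (t : ℤ) => W (t + h) ω) (fun ω (t : ℤ) => W t ω) P P

/-- The location-scale autoregression started at time `0` from the deterministic point `x`:
`X_0 = x` and `X_t = r(Y_{t-1}, X_{t-1}) + ε_t σ(Y_{t-1}, X_{t-1})` for `t ≥ 1`. -/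
structure IsStartedSolution {Ω E : Type*} (r σ : E → ℝ → ℝ)
    (Y : ℤ → Ω → E) (ε : ℤ → Ω → ℝ) (x : ℝ) (X : ℕ → Ω → ℝ) : Prop where
  init : ∀ ω, X 0 ω = x
  step : ∀ (t : ℕ) (ω : Ω),
    X (t + 1) ω = r (Y t ω) (X t ω) + ε ((t : ℤ) + 1) ω * σ (Y t ω) (X t ω)

/-- A two-sided stationary solution `(X_t)_{t ∈ ℤ}` of the location-scale autoregression:
the recursion holds almost surely at every time, the pair `(X_t, Y_t)` is jointly strictly
stationary, and the innovation `ε_{t+1}` is independent of `(X_k)_{k ≤ t}` and of the whole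
environment, so that `X` is a Markov chain in the random environment `Y`. -/
structure IsStationarySolution {Ω E : Type*} [MeasurableSpace Ω] [MeasurableSpace E]
    (P : Measure Ω) (r σ : E → ℝ → ℝ) (Y : ℤ → Ω → E) (ε : ℤ → Ω → ℝ)
    (X : ℤ → Ω → ℝ) : Prop where
  measurable : ∀ t, Measurable (X t)
  step : ∀ t : ℤ, ∀ᵐ ω ∂P,
    X (t + 1) ω = r (Y t ω) (X t ω) + ε (t + 1) ω * σ (Y t ω) (X t ω)
  stationary : IsStrictlyStationary P (fun t ω => (X t ω, Y t ω))
  indep : ∀ t : ℤ,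
    Indep (MeasurableSpace.comap (ε (t + 1)) inferInstance)
      (pastSigma X t ⊔ ⨆ k : ℤ, MeasurableSpace.comap (Y k) inferInstance) P

end

/-! Conditionally on the environment, `X` is a time-inhomogeneous Markov chain. The proof bounds how
fast this quenched chain forgets its starting point, averages the bound over the environment, and
then transfers the mixing of `Y` to the pair.

Quenched step. Linear growth and a first absolute moment of the noise at most one give the drift
bound `integral_abs_chain_le`. The density bound gives a Doeblin minorization on `[-R, R]` for most
environment states (`exists_minorized`). In a block of length `2 * L`, the first `L` steps bring the
chain back to moderate values, step `L + 1` is minorized, and the other `L - 1` steps are idle.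
Since `x` is unbounded, a good block contracts oscillations only up to a cone `c * (|x| + |x'|)`
(`abs_semi_sub_le_of_minorized`). Clipping a function to a bounded range (`exists_clip`) makes this
iterable, and `abs_semi_sub_le_coupErr` records the resulting recursion.

Averaging. The idle steps leave a gap of length `L` between the environment read by the past error
and the next block, so mixing of `Y` nearly decouples that error from the event that the block is
good. With `D i` the mean error after `i` blocks, `D (i + 1) ≤ ρ * D i + C * (α L + ζ L)`, where `ζ`
controls the contracted drift (`integral_coupErr_succ_le`). Hence `D q` is of order `ρ ^ q + α L + ζ
L`.

Covariances. To compare the past up to `j` with the future from `j + m`, wait `L` steps and restart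
the chain at `0`. The future mean becomes a functional of the environment alone, to which the mixing
of `Y` applies (`abs_cov_jointPath_le`).

Rates. Taking `q` of order `log m` and `L` of order `m / log m` turns an error `(log L) ^ δ * L ^
(-β)` into `(log m) ^ (β + δ) * m ^ (-β)` (`exists_blocks_rate`). In the first part `ζ` is
geometric, so `β = a` and `δ = 0`. In the second, the same blocking bounds the mean product of the
`γ (y i)` by order `(log l / l) ^ a`; Hölder turns `a` into `b`, and summation over ages costs one
power, so `β = b - 1` and `δ = b`.

A stationary solution is, after a long time and up to an arbitrarily small error in law, the
solution started at `0`. It inherits the covariance bounds because these are uniform in `j`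
(`IsStationarySolution.alphaMix_le`). -/

/-- The path `y` seen from time `k` on. -/
def shift {S : Type*} (k : ℕ) (y : ℕ → S) : ℕ → S := fun n => y (k + n)

/-- The path `y` frozen after time `j`. -/
def freeze {S : Type*} (j : ℕ) (y : ℕ → S) : ℕ → S := fun n => y (min n j)

/-- The path that follows `e` before time `n` and restarts as `e'` at time `n`. -/
def splice {S : Type*} (n : ℕ) (e e' : ℕ → S) : ℕ → S :=
  fun i => if i < n then e i else e' (i - n)

/-- The autoregression started at `x`, driven by the environment `y` and the noise `e`. -/
def chain {E : Type*} (r σ : E → ℝ → ℝ) (y : ℕ → E) (e : ℕ → ℝ) (x : ℝ) : ℕ → ℝ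
  | 0 => x
  | n + 1 => r (y n) (chain r σ y e x n) + e n * σ (y n) (chain r σ y e x n)

/-- The product of the first `n` contraction coefficients along the environment. -/
def prodCoef {E : Type*} (γ : E → ℝ) (y : ℕ → E) (n : ℕ) : ℝ := ∏ i ∈ Finset.range n, γ (y i)

/-- The accumulated drift constant along the environment. -/
def accum {E : Type*} (γ K : E → ℝ) (y : ℕ → E) : ℕ → ℝ
  | 0 => 0
  | n + 1 => γ (y n) * accum γ K y n + K (y n)

/-! ### Shifting, freezing and splicing of paths -/

section Paths

variable {S : Type*}

lemma shift_apply (k n : ℕ) (y : ℕ → S) : shift k y n = y (k + n) := rfl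

@[simp] lemma shift_zero (y : ℕ → S) : shift 0 y = y := by
  funext n; simp [shift]

lemma shift_shift (k l : ℕ) (y : ℕ → S) : shift l (shift k y) = shift (k + l) y := by
  funext n; simp [shift, add_assoc]

lemma splice_of_lt {n i : ℕ} (h : i < n) (e e' : ℕ → S) : splice n e e' i = e i := by
  simp [splice, h]

lemma splice_add (n k : ℕ) (e e' : ℕ → S) : splice n e e' (n + k) = e' k := by
  simp [splice]

@[fun_prop]
lemma measurable_shift [MeasurableSpace S] (k : ℕ) : Measurable (shift k : (ℕ → S) → ℕ → S) :=
  measurable_pi_lambda _ fun n => measurable_pi_apply (k + n)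

@[fun_prop]
lemma measurable_freeze [MeasurableSpace S] (k : ℕ) : Measurable (freeze k : (ℕ → S) → ℕ → S) :=
  measurable_pi_lambda _ fun n => measurable_pi_apply (min n k)

lemma measurable_splice [MeasurableSpace S] (n : ℕ) :
    Measurable fun p : (ℕ → S) × (ℕ → S) => splice n p.1 p.2 := by
  refine measurable_pi_lambda _ fun i => ?_
  by_cases h : i < n
  · simp only [splice, h, if_true]; fun_prop
  · simp only [splice, h, if_false]; fun_prop

/-- Splicing two independent i.i.d. sequences gives an i.i.d. sequence. -/
lemma map_splice_infinitePi [MeasurableSpace S] (η : Measure S) [IsProbabilityMeasure η] (n : ℕ) :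
    ((Measure.infinitePi fun _ : ℕ => η).prod (Measure.infinitePi fun _ : ℕ => η)).map
      (fun p => splice n p.1 p.2) = Measure.infinitePi fun _ : ℕ => η := by
  refine Measure.eq_infinitePi _ fun s t ht => ?_
  rw [Measure.map_apply (measurable_splice n) (.pi s.countable_toSet fun i _ => ht i)]
  -- A cylinder splits into constraints on the first `n` coordinates and re-indexed constraints on
  -- the others, so its mass factorizes.
  have hpre : (fun p : (ℕ → S) × (ℕ → S) => splice n p.1 p.2) ⁻¹' (Set.pi s t) =
      (Set.pi ((s.filter (· < n) : Finset ℕ) : Set ℕ) t) ×ˢ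
      (Set.pi (((s.filter (¬ · < n)).image (· - n) : Finset ℕ) : Set ℕ) fun i => t (i + n)) := by
    ext p
    simp only [Set.mem_preimage, Set.mem_pi, Finset.mem_coe, Set.mem_prod, Finset.mem_filter,
      Finset.mem_image, splice]
    constructor
    · intro h
      refine ⟨fun i hi => by simpa [hi.2] using h i hi.1, ?_⟩
      rintro _ ⟨i, hi, rfl⟩
      have := h i hi.1
      rw [if_neg hi.2] at this
      rwa [Nat.sub_add_cancel (not_lt.1 hi.2)]
    · rintro ⟨h1, h2⟩ i hi
      split_ifs with hin
      · exact h1 i ⟨hi, hin⟩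
      · have := h2 (i - n) ⟨i, ⟨hi, hin⟩, rfl⟩
        rwa [Nat.sub_add_cancel (not_lt.1 hin)] at this
  rw [hpre, Measure.prod_prod, Measure.infinitePi_pi _ fun i _ => ht i,
    Measure.infinitePi_pi _ fun i _ => ht _, Finset.prod_image,
    ← Finset.prod_filter_mul_prod_filter_not s (· < n)]
  · congr 1
    refine Finset.prod_congr rfl fun i hi => ?_
    rw [Nat.sub_add_cancel (not_lt.1 (Finset.mem_filter.1 hi).2)]
  · intro i hi j hj hij
    have h1 := not_lt.1 (Finset.mem_filter.1 hi).2
    have h2 := not_lt.1 (Finset.mem_filter.1 hj).2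
    simp only at hij
    omega

end Paths

/-! ### The recursion along a fixed environment and noise -/

section Chain

variable {E : Type*} (r σ : E → ℝ → ℝ) (γ K : E → ℝ)

/-- Causality of the recursion. It makes past functionals of the chain functionals of a frozen
environment, to which mixing applies. -/
lemma chain_congr {y y' : ℕ → E} {e e' : ℕ → ℝ} (x : ℝ) {n : ℕ} (hy : ∀ i < n, y i = y' i)
    (he : ∀ i < n, e i = e' i) : chain r σ y e x n = chain r σ y' e' x n := by
  induction n with
  | zero => rfl
  | succ n ih =>
    simp only [chain]
    rw [ih (fun i hi => hy i (by omega)) (fun i hi => he i (by omega)), hy n (by omega),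
      he n (by omega)]

/-- The recursion restarts at time `n` from its current position, in the shifted environment and
with fresh noise. Together with `map_splice_infinitePi` this is the Markov property. -/
lemma chain_splice (y : ℕ → E) (e e' : ℕ → ℝ) (x : ℝ) (n k : ℕ) :
    chain r σ y (splice n e e') x (n + k) =
      chain r σ (shift n y) e' (chain r σ y e x n) k := by
  induction k with
  | zero =>
    exact chain_congr r σ x (fun _ _ => rfl) fun i hi => splice_of_lt hi e e'
  | succ k ih => rw [← add_assoc]; simp only [chain]; rw [ih, splice_add]; rfl

lemma prodCoef_succ (y : ℕ → E) (n : ℕ) :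
    prodCoef γ y (n + 1) = prodCoef γ y n * γ (y n) := Finset.prod_range_succ _ _

@[simp] lemma prodCoef_zero (y : ℕ → E) : prodCoef γ y 0 = 1 := rfl

lemma prodCoef_add (y : ℕ → E) (n m : ℕ) :
    prodCoef γ y (n + m) = prodCoef γ y n * prodCoef γ (shift n y) m :=
  Finset.prod_range_add _ _ _

lemma prodCoef_congr {y y' : ℕ → E} {n : ℕ} (hy : ∀ i < n, y i = y' i) :
    prodCoef γ y n = prodCoef γ y' n :=
  Finset.prod_congr rfl fun i hi => by rw [hy i (Finset.mem_range.1 hi)]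

lemma accum_congr {y y' : ℕ → E} {n : ℕ} (hy : ∀ i < n, y i = y' i) :
    accum γ K y n = accum γ K y' n := by
  induction n with
  | zero => rfl
  | succ n ih =>
    simp only [accum]
    rw [ih (fun i hi => hy i (by omega)), hy n (by omega)]

/-- Cocycle identity: drift accumulated before time `n` survives only after contraction by the next
`m` coefficients. -/
lemma accum_add (y : ℕ → E) (n m : ℕ) :
    accum γ K y (n + m) =
      accum γ K (shift n y) m + prodCoef γ (shift n y) m * accum γ K y n := by
  induction m with
  | zero => simp [accum]
  | succ m ih =>
    rw [← add_assoc]; simp only [accum, prodCoef_succ]; rw [ih, shift_apply]; ring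

variable {γ K} in
lemma prodCoef_nonneg (hγ : ∀ y, 0 ≤ γ y) (y : ℕ → E) (n : ℕ) : 0 ≤ prodCoef γ y n :=
  Finset.prod_nonneg fun _ _ => hγ _

variable {γ K} in
lemma accum_nonneg (hγ : ∀ y, 0 ≤ γ y) (hK : ∀ y, 0 ≤ K y) (y : ℕ → E) (n : ℕ) :
    0 ≤ accum γ K y n := by
  induction n with
  | zero => exact le_rfl
  | succ n ih => exact add_nonneg (mul_nonneg (hγ _) ih) (hK _)

variable [MeasurableSpace E]

variable {γ K} in
lemma measurable_prodCoef (hγ : Measurable γ) (n : ℕ) :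
    Measurable fun y : ℕ → E => prodCoef γ y n :=
  Finset.measurable_prod _ fun i _ => hγ.comp (measurable_pi_apply i)

variable {γ K} in
lemma measurable_accum (hγ : Measurable γ) (hK : Measurable K) (n : ℕ) :
    Measurable fun y : ℕ → E => accum γ K y n := by
  induction n with
  | zero => exact measurable_const
  | succ n ih =>
    exact ((hγ.comp (measurable_pi_apply n)).mul ih).add (hK.comp (measurable_pi_apply n))

variable {r σ} in
lemma measurable_chain (hr : Measurable (Function.uncurry r)) (hσ : Measurable (Function.uncurry σ))
    (n : ℕ) :
    Measurable fun p : (ℕ → E) × (ℕ → ℝ) × ℝ => chain r σ p.1 p.2.1 p.2.2 n := by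
  induction n with
  | zero => exact measurable_snd.snd
  | succ n ih =>
    have h1 : Measurable fun p : (ℕ → E) × (ℕ → ℝ) × ℝ =>
        (p.1 n, chain r σ p.1 p.2.1 p.2.2 n) := by fun_prop
    exact (hr.comp h1).add (((measurable_pi_apply n).comp measurable_snd.fst).mul (hσ.comp h1))

variable {r σ} in
lemma Measurable.chain {α : Type*} [MeasurableSpace α] (hr : Measurable (Function.uncurry r))
    (hσ : Measurable (Function.uncurry σ)) {y : α → ℕ → E} {e : α → ℕ → ℝ} {x : α → ℝ}
    (hy : Measurable y) (he : Measurable e) (hx : Measurable x) (n : ℕ) :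
    Measurable fun a => chain r σ (y a) (e a) (x a) n :=
  (measurable_chain hr hσ n).comp (hy.prodMk (he.prodMk hx))

end Chain

/-! ### Quenched transition operators and moment bounds -/

/-- The law of an i.i.d. sequence with marginal `η`. -/
noncomputable abbrev noise (η : Measure ℝ) : Measure (ℕ → ℝ) := Measure.infinitePi fun _ : ℕ => η

/-- The `n`-step transition operator of the autoregression in the environment `y`. -/
noncomputable def semi {E : Type*} (η : Measure ℝ) (r σ : E → ℝ → ℝ) (y : ℕ → E) (n : ℕ)
    (h : ℝ → ℝ) (x : ℝ) : ℝ :=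
  ∫ e, h (chain r σ y e x n) ∂noise η

/-- Measurable functions with values in `[0, 1]`. -/
structure IsUnitFun {α : Type*} [MeasurableSpace α] (h : α → ℝ) : Prop where
  measurable : Measurable h
  nonneg : ∀ x, 0 ≤ h x
  le_one : ∀ x, h x ≤ 1

namespace IsUnitFun

variable {α β : Type*} [MeasurableSpace α] [MeasurableSpace β] {h g : α → ℝ}

lemma integrable (hh : IsUnitFun h) (μ : Measure α) [IsFiniteMeasure μ] : Integrable h μ :=
  Integrable.of_bound hh.measurable.aestronglyMeasurable 1
    (ae_of_all _ fun x => by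
      rw [Real.norm_eq_abs, abs_of_nonneg (hh.nonneg x)]; exact hh.le_one x)

lemma comp {h : β → ℝ} (hh : IsUnitFun h) {φ : α → β} (hφ : Measurable φ) :
    IsUnitFun fun x => h (φ x) :=
  ⟨hh.measurable.comp hφ, fun _ => hh.nonneg _, fun _ => hh.le_one _⟩

lemma mul (hh : IsUnitFun h) (hg : IsUnitFun g) : IsUnitFun fun x => h x * g x :=
  ⟨hh.measurable.mul hg.measurable, fun x => mul_nonneg (hh.nonneg x) (hg.nonneg x),
    fun x => mul_le_one₀ (hh.le_one x) (hg.nonneg x) (hg.le_one x)⟩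

lemma one_sub (hh : IsUnitFun h) : IsUnitFun fun x => 1 - h x :=
  ⟨measurable_const.sub hh.measurable, fun x => sub_nonneg.2 (hh.le_one x),
    fun x => sub_le_self _ (hh.nonneg x)⟩

lemma integral_nonneg (hh : IsUnitFun h) (μ : Measure α) : 0 ≤ ∫ x, h x ∂μ :=
  MeasureTheory.integral_nonneg hh.nonneg

lemma integral_le_one (hh : IsUnitFun h) (μ : Measure α) [IsProbabilityMeasure μ] :
    ∫ x, h x ∂μ ≤ 1 :=
  (integral_mono (hh.integrable μ) (integrable_const 1) hh.le_one).trans (by simp)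

lemma integral_prod {h : α × β → ℝ} (hh : IsUnitFun h) (μ : Measure β) [IsProbabilityMeasure μ] :
    IsUnitFun fun x => ∫ y, h (x, y) ∂μ :=
  ⟨(hh.measurable.stronglyMeasurable.integral_prod_right' (ν := μ)).measurable,
    fun _ => (hh.comp measurable_prodMk_left).integral_nonneg μ,
    fun _ => (hh.comp measurable_prodMk_left).integral_le_one μ⟩

lemma abs_sub_le_one (hh : IsUnitFun h) (x x' : α) : |h x - h x'| ≤ 1 :=
  abs_sub_le_iff.2 ⟨by linarith [hh.nonneg x', hh.le_one x], by linarith [hh.nonneg x, hh.le_one x']⟩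

lemma indicator_one {s : Set α} (hs : MeasurableSet s) : IsUnitFun (s.indicator fun _ => (1 : ℝ)) :=
  ⟨measurable_const.indicator hs, fun x => Set.indicator_nonneg (fun _ _ => zero_le_one) x,
    fun x => Set.indicator_le_self' (fun _ _ => zero_le_one) x⟩

end IsUnitFun

section Semi

variable {E : Type*} [MeasurableSpace E] {r σ : E → ℝ → ℝ} {γ K : E → ℝ}
  {η : Measure ℝ} [IsProbabilityMeasure η]

lemma lintegral_splice (n : ℕ) {Φ : (ℕ → ℝ) → ENNReal} (hΦ : Measurable Φ) :
    ∫⁻ e, Φ e ∂noise η = ∫⁻ e, ∫⁻ e', Φ (splice n e e') ∂noise η ∂noise η := by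
  conv_lhs => rw [noise, ← map_splice_infinitePi η n]
  rw [lintegral_map hΦ (measurable_splice n), lintegral_prod]
  exact (hΦ.comp (measurable_splice n)).aemeasurable

/-- The noise from time `n` on can be replaced by an independent copy and integrated first, which
amounts to conditioning on the first `n` innovations. -/
lemma integral_splice (n : ℕ) {Φ : (ℕ → ℝ) → ℝ} (hΦ : IsUnitFun Φ) :
    ∫ e, Φ e ∂noise η = ∫ e, ∫ e', Φ (splice n e e') ∂noise η ∂noise η := by
  conv_lhs => rw [noise, ← map_splice_infinitePi η n]
  rw [integral_map (measurable_splice n).aemeasurable hΦ.measurable.aestronglyMeasurable,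
    MeasureTheory.integral_prod]
  exact (hΦ.comp (measurable_splice n)).integrable _

lemma map_eval_noise (n : ℕ) : (noise η).map (fun e => e n) = η :=
  Measure.infinitePi_map_eval (fun _ : ℕ => η) n

lemma lintegral_eval_noise (n : ℕ) {f : ℝ → ENNReal} (hf : Measurable f) :
    ∫⁻ e : ℕ → ℝ, f (e n) ∂noise η = ∫⁻ z, f z ∂η := by
  conv_rhs => rw [← map_eval_noise (η := η) n]
  exact (lintegral_map hf (measurable_pi_apply n)).symm

lemma integral_eval_noise (n : ℕ) {f : ℝ → ℝ} (hf : Measurable f) :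
    ∫ e : ℕ → ℝ, f (e n) ∂noise η = ∫ z, f z ∂η := by
  conv_rhs => rw [← map_eval_noise (η := η) n]
  exact (integral_map (measurable_pi_apply n).aemeasurable hf.aestronglyMeasurable).symm

omit [MeasurableSpace E] in
lemma semi_one {h : ℝ → ℝ} (hh : IsUnitFun h) (y : ℕ → E) (x : ℝ) :
    semi η r σ y 1 h x = ∫ z, h (r (y 0) x + z * σ (y 0) x) ∂η := by
  rw [← integral_eval_noise (η := η) 0 (f := fun z => h (r (y 0) x + z * σ (y 0) x))
    (hh.measurable.comp (by fun_prop))]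
  rfl

variable (hr : Measurable (Function.uncurry r)) (hσ : Measurable (Function.uncurry σ))
include hr hσ

lemma IsUnitFun.chain {h : ℝ → ℝ} (hh : IsUnitFun h) (y : ℕ → E) (x : ℝ) (n : ℕ) :
    IsUnitFun fun e => h (chain r σ y e x n) :=
  hh.comp (Measurable.chain hr hσ measurable_const measurable_id measurable_const n)

lemma IsUnitFun.semi {h : ℝ → ℝ} (hh : IsUnitFun h) (y : ℕ → E) (n : ℕ) :
    IsUnitFun (semi η r σ y n h) :=
  (hh.comp (Measurable.chain hr hσ measurable_const measurable_snd measurable_fst n)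
    : IsUnitFun fun p : ℝ × (ℕ → ℝ) => h (_root_.chain r σ y p.2 p.1 n)).integral_prod (noise η)

/-- Chapman–Kolmogorov in a fixed environment: the noise is spliced at time `n` and its fresh part
is integrated first. -/
lemma semi_add {h : ℝ → ℝ} (hh : IsUnitFun h) (y : ℕ → E) (n k : ℕ) (x : ℝ) :
    semi η r σ y (n + k) h x = semi η r σ y n (semi η r σ (shift n y) k h) x := by
  unfold semi
  rw [integral_splice n (hh.chain hr hσ y x (n + k))]
  simp only [chain_splice]

/-- Moment bound for the quenched chain. -/
lemma lintegral_abs_chain_le (hγ : ∀ y, 0 ≤ γ y) (hK : ∀ y, 0 ≤ K y)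
    (hgrow : ∀ y x, |r y x| + |σ y x| ≤ γ y * |x| + K y)
    (hη : ∫⁻ z, ENNReal.ofReal |z| ∂η ≤ 1) (y : ℕ → E) (x : ℝ) (n : ℕ) :
    ∫⁻ e, ENNReal.ofReal |chain r σ y e x n| ∂noise η ≤
      ENNReal.ofReal (accum γ K y n + prodCoef γ y n * |x|) := by
  have hch : ∀ n, Measurable fun e => chain r σ y e x n := fun n =>
    Measurable.chain hr hσ measurable_const measurable_id measurable_const n
  induction n with
  | zero => simp [chain, accum]
  | succ n ih =>
    rw [lintegral_splice n (hch (n + 1)).abs.ennreal_ofReal]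
    -- Given the first `n` innovations, only one fresh innovation enters. Its absolute moment is at
    -- most one, so the bounds on `r` and `σ` add up to the linear drift.
    have hstep : ∀ e : ℕ → ℝ,
        ∫⁻ e', ENNReal.ofReal |chain r σ y (splice n e e') x (n + 1)| ∂noise η ≤
          ENNReal.ofReal (γ (y n)) * ENNReal.ofReal |chain r σ y e x n| +
            ENNReal.ofReal (K (y n)) := by
      intro e
      set c := chain r σ y e x n with hc
      have h1 : ∀ e' : ℕ → ℝ, ENNReal.ofReal |chain r σ y (splice n e e') x (n + 1)| ≤
          ENNReal.ofReal |r (y n) c| + ENNReal.ofReal |σ (y n) c| * ENNReal.ofReal |e' 0| := by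
        intro e'
        rw [chain_splice, ← hc, ← ENNReal.ofReal_mul (abs_nonneg _),
          ← ENNReal.ofReal_add (abs_nonneg _) (by positivity)]
        refine ENNReal.ofReal_le_ofReal ((abs_add_le _ _).trans (le_of_eq ?_))
        simp only [chain, abs_mul, shift_apply, add_zero]; ring
      calc _ ≤ ∫⁻ e' : ℕ → ℝ, ENNReal.ofReal |r (y n) c| +
              ENNReal.ofReal |σ (y n) c| * ENNReal.ofReal |e' 0| ∂noise η := lintegral_mono h1
        _ = ENNReal.ofReal |r (y n) c| +
              ENNReal.ofReal |σ (y n) c| * ∫⁻ z, ENNReal.ofReal |z| ∂η := by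
            rw [lintegral_add_left measurable_const, lintegral_const_mul _ (by fun_prop)]
            rw [lintegral_eval_noise 0 (f := fun z => ENNReal.ofReal |z|) (by fun_prop)]
            simp
        _ ≤ ENNReal.ofReal |r (y n) c| + ENNReal.ofReal |σ (y n) c| * 1 := by gcongr
        _ ≤ _ := by
            rw [mul_one, ← ENNReal.ofReal_mul (hγ _), ← ENNReal.ofReal_add (abs_nonneg _)
              (abs_nonneg _), ← ENNReal.ofReal_add (mul_nonneg (hγ _) (abs_nonneg _)) (hK _)]
            exact ENNReal.ofReal_le_ofReal (hgrow _ _)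
    calc _ ≤ ∫⁻ e, (ENNReal.ofReal (γ (y n)) * ENNReal.ofReal |chain r σ y e x n| +
            ENNReal.ofReal (K (y n))) ∂noise η := lintegral_mono hstep
      _ = ENNReal.ofReal (γ (y n)) * (∫⁻ e, ENNReal.ofReal |chain r σ y e x n| ∂noise η) +
            ENNReal.ofReal (K (y n)) := by
          rw [lintegral_add_right _ measurable_const,
            lintegral_const_mul _ (hch n).abs.ennreal_ofReal]
          simp
      _ ≤ ENNReal.ofReal (γ (y n)) * ENNReal.ofReal (accum γ K y n + prodCoef γ y n * |x|) +
            ENNReal.ofReal (K (y n)) := by gcongr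
      _ = _ := by
          have h0 := accum_nonneg hγ hK y n
          have h1 := prodCoef_nonneg hγ y n
          rw [← ENNReal.ofReal_mul (hγ _), ← ENNReal.ofReal_add
            (mul_nonneg (hγ _) (by positivity)) (hK _)]
          simp only [accum, prodCoef_succ]
          congr 1; ring

lemma integrable_abs_chain (hγ : ∀ y, 0 ≤ γ y) (hK : ∀ y, 0 ≤ K y)
    (hgrow : ∀ y x, |r y x| + |σ y x| ≤ γ y * |x| + K y)
    (hη : ∫⁻ z, ENNReal.ofReal |z| ∂η ≤ 1) (y : ℕ → E) (x : ℝ) (n : ℕ) :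
    Integrable (fun e => |chain r σ y e x n|) (noise η) := by
  refine ⟨(Measurable.chain hr hσ measurable_const measurable_id
    measurable_const n).abs.aestronglyMeasurable, ?_⟩
  rw [hasFiniteIntegral_iff_ofReal (ae_of_all _ fun _ => abs_nonneg _)]
  exact (lintegral_abs_chain_le hr hσ hγ hK hgrow hη y x n).trans_lt ENNReal.ofReal_lt_top

lemma integral_abs_chain_le (hγ : ∀ y, 0 ≤ γ y) (hK : ∀ y, 0 ≤ K y)
    (hgrow : ∀ y x, |r y x| + |σ y x| ≤ γ y * |x| + K y)
    (hη : ∫⁻ z, ENNReal.ofReal |z| ∂η ≤ 1) (y : ℕ → E) (x : ℝ) (n : ℕ) :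
    ∫ e, |chain r σ y e x n| ∂noise η ≤ accum γ K y n + prodCoef γ y n * |x| := by
  rw [integral_eq_lintegral_of_nonneg_ae (ae_of_all _ fun _ => abs_nonneg _)
    (integrable_abs_chain hr hσ hγ hK hgrow hη y x n).1]
  refine ENNReal.toReal_le_of_le_ofReal ?_ (lintegral_abs_chain_le hr hσ hγ hK hgrow hη y x n)
  have h0 := accum_nonneg hγ hK y n
  have h1 := prodCoef_nonneg hγ y n
  positivity

/-- After one step the quenched chain does not charge Lebesgue null sets. -/
lemma ae_chain_of_ae (hη : η ≪ volume) (hσ0 : ∀ y x, σ y x ≠ 0) {p : ℝ → Prop}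
    (hp : ∀ᵐ x, p x) (y : ℕ → E) (x : ℝ) (n : ℕ) :
    ∀ᵐ e ∂noise η, p (chain r σ y e x (n + 1)) := by
  obtain ⟨N, hN, hNm, hN0⟩ := exists_measurable_superset_of_null (ae_iff.1 hp)
  have hch : ∀ n, Measurable fun e => chain r σ y e x n := fun n =>
    Measurable.chain hr hσ measurable_const measurable_id measurable_const n
  have key : ∫⁻ e, N.indicator 1 (chain r σ y e x (n + 1)) ∂noise η = 0 := by
    have hm : Measurable (N.indicator (1 : ℝ → ENNReal)) := measurable_one.indicator hNm
    rw [lintegral_splice n (show Measurable fun e => N.indicator (1 : ℝ → ENNReal) (chain r σ y e x (n + 1)) from hm.comp (hch (n + 1)))]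
    refine (lintegral_congr fun e => ?_).trans lintegral_zero
    set c := chain r σ y e x n with hc
    have h1 : ∀ e' : ℕ → ℝ, N.indicator (1 : ℝ → ENNReal) (chain r σ y (splice n e e') x (n + 1)) =
        N.indicator 1 (r (y n) c + e' 0 * σ (y n) c) := by
      intro e'; rw [chain_splice, ← hc]; rfl
    simp only [h1]
    rw [lintegral_eval_noise 0 (f := fun z => N.indicator (1 : ℝ → ENNReal)
      (r (y n) c + z * σ (y n) c)) (hm.comp (by fun_prop))]
    -- An affine map of nonzero slope pulls Lebesgue null sets back to null sets, and `η` does not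
    -- charge these.
    have h3 : η ((fun z => r (y n) c + z * σ (y n) c) ⁻¹' N) = 0 := by
      refine hη ?_
      have : (fun z => r (y n) c + z * σ (y n) c) ⁻¹' N =
          (fun z => z * σ (y n) c) ⁻¹' ((fun z => r (y n) c + z) ⁻¹' N) := rfl
      rw [this, Real.volume_preimage_mul_right (hσ0 _ _), measure_preimage_add, hN0, mul_zero]
    have h4 : ∀ z, N.indicator (1 : ℝ → ENNReal) (r (y n) c + z * σ (y n) c) =
        ((fun z => r (y n) c + z * σ (y n) c) ⁻¹' N).indicator 1 z := fun z => rfl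
    simp only [h4]
    rw [lintegral_indicator_one (hNm.preimage (by fun_prop)), h3]
  rw [lintegral_eq_zero_iff (show Measurable fun e => N.indicator (1 : ℝ → ENNReal) (chain r σ y e x (n + 1))
    from (measurable_one.indicator hNm).comp (hch (n + 1)))] at key
  filter_upwards [key] with e he
  by_contra hne
  have : chain r σ y e x (n + 1) ∈ N := hN hne
  simp [this] at he

end Semi

/-! ### Minorization and contraction of oscillations over one block -/

/-- The environment state `v` gives the one-step law from almost every point of `[-R, R]` a common
uniform component on `[0, 1]` of mass `κ`. -/
def Minorized {E : Type*} (η : Measure ℝ) (r σ : E → ℝ → ℝ) (R κ : ℝ) (v : E) : Prop :=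
  ∀ᵐ x : ℝ, |x| ≤ R → ∀ h : ℝ → ℝ, IsUnitFun h →
    κ * ∫ u in Set.Icc (0 : ℝ) 1, h u ≤ ∫ z, h (r v x + z * σ v x) ∂η

/-- A function whose oscillation is at most `a` up to a cone is within the cone of a function
with range in an interval of length `a`. -/
lemma exists_clip {g : ℝ → ℝ} (hg : IsUnitFun g) {a c : ℝ} (ha : 0 < a) (hc : 0 ≤ c)
    (hosc : ∀ x x', |g x - g x'| ≤ a + c * (|x| + |x'|)) :
    ∃ (m : ℝ) (h : ℝ → ℝ), IsUnitFun h ∧ ∀ x, |g x - (m + a * h x)| ≤ c * |x| := by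
  -- By the choice of `m`, `g` lies above `m - c * |x|`, and the oscillation bound puts it below `m
  -- + a + c * |x|`. Clipping `g` to `[m, m + a]` therefore moves it by at most `c * |x|`.
  set m := ⨅ x, (g x + c * |x|) with hm
  have hbdd : BddBelow (Set.range fun x => g x + c * |x|) :=
    ⟨0, by rintro _ ⟨x, rfl⟩; have := hg.nonneg x; positivity⟩
  have h1 : ∀ x, m ≤ g x + c * |x| := fun x => ciInf_le hbdd x
  have h2 : ∀ x, g x - c * |x| ≤ m + a := by
    intro x
    rw [← sub_le_iff_le_add]
    refine le_ciInf fun x' => ?_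
    have := (abs_le.1 (hosc x x')).2
    linarith
  refine ⟨m, fun x => max 0 (min 1 ((g x - m) / a)), ⟨?_, fun x => le_max_left _ _, fun x =>
    max_le zero_le_one (min_le_left _ _)⟩, fun x => ?_⟩
  · exact measurable_const.max (measurable_const.min ((hg.measurable.sub_const m).div_const a))
  · change |g x - (m + a * max 0 (min 1 ((g x - m) / a)))| ≤ c * |x|
    have hx : g x = m + a * ((g x - m) / a) := by field_simp; ring
    have hcx : 0 ≤ c * |x| := by positivity
    have h1x := h1 x
    have h2x := h2 x
    rcases le_total ((g x - m) / a) 0 with h0 | h0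
    · rw [min_eq_right (h0.trans zero_le_one), max_eq_left h0, abs_le]
      have : a * ((g x - m) / a) ≤ 0 := mul_nonpos_of_nonneg_of_nonpos ha.le h0
      constructor <;> linarith
    · rcases le_total ((g x - m) / a) 1 with h3 | h3
      · rw [min_eq_right h3, max_eq_right h0, ← hx]; simpa using hcx
      · rw [min_eq_left h3, max_eq_right zero_le_one, abs_le]
        have : a * 1 ≤ a * ((g x - m) / a) := mul_le_mul_of_nonneg_left h3 ha.le
        constructor <;> linarith

/-- Doeblin's argument: the minorization applied to `h` and to `1 - h` traps both integrals in the
same interval of length `1 - κ`. -/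
lemma Minorized.abs_sub_le {E : Type*} {η : Measure ℝ} [IsProbabilityMeasure η] {r σ : E → ℝ → ℝ}
    {κ : ℝ} {v : E} {x x' : ℝ} {h : ℝ → ℝ} (hh : IsUnitFun h)
    (hx : ∀ h : ℝ → ℝ, IsUnitFun h →
      κ * ∫ u in Set.Icc (0 : ℝ) 1, h u ≤ ∫ z, h (r v x + z * σ v x) ∂η)
    (hx' : ∀ h : ℝ → ℝ, IsUnitFun h →
      κ * ∫ u in Set.Icc (0 : ℝ) 1, h u ≤ ∫ z, h (r v x' + z * σ v x') ∂η) :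
    |∫ z, h (r v x + z * σ v x) ∂η - ∫ z, h (r v x' + z * σ v x') ∂η| ≤ 1 - κ := by
  have key : ∀ x : ℝ, (∀ h : ℝ → ℝ, IsUnitFun h →
      κ * ∫ u in Set.Icc (0 : ℝ) 1, h u ≤ ∫ z, h (r v x + z * σ v x) ∂η) →
      ∫ z, h (r v x + z * σ v x) ∂η ≤ 1 - κ + κ * ∫ u in Set.Icc (0 : ℝ) 1, h u := by
    intro x hx
    have h1 := hx _ hh.one_sub
    rw [integral_sub (integrable_const _) (hh.integrable _),
      integral_sub (integrable_const _) ((hh.comp (φ := fun z => r v x + z * σ v x)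
        (by fun_prop)).integrable _)] at h1
    simp at h1
    linarith
  have := key x hx
  have := key x' hx'
  have := hx h hh
  have := hx' h hh
  rw [abs_sub_le_iff]
  constructor <;> linarith

section Contraction

variable {E : Type*} [MeasurableSpace E] {r σ : E → ℝ → ℝ} {γ K : E → ℝ}
  {η : Measure ℝ} [IsProbabilityMeasure η]
  (hr : Measurable (Function.uncurry r)) (hσ : Measurable (Function.uncurry σ))
  (hγ : ∀ y, 0 ≤ γ y) (hK : ∀ y, 0 ≤ K y)
  (hgrow : ∀ y x, |r y x| + |σ y x| ≤ γ y * |x| + K y)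
  (hη : ∫⁻ z, ENNReal.ofReal |z| ∂η ≤ 1)
include hr hσ hγ hK hgrow hη

/-- A block during which the drift is under control and that ends in a minorized state
contracts oscillations up to a cone. -/
lemma abs_semi_sub_le_of_minorized (hηac : η ≪ volume) (hσ0 : ∀ y x, σ y x ≠ 0) {R κ : ℝ}
    (hR : 0 < R) (hκ : 0 ≤ κ) {y : ℕ → E} {L : ℕ} (hL : 1 ≤ L)
    (hy : Minorized η r σ R κ (y L)) (hZ : accum γ K y L ≤ R / 4) {h : ℝ → ℝ} (hh : IsUnitFun h)
    (x x' : ℝ) :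
    |semi η r σ y (L + 1) h x - semi η r σ y (L + 1) h x'| ≤
      1 - κ / 2 + κ / R * prodCoef γ y L * (|x| + |x'|) := by
  rw [semi_add hr hσ hh, semi_add hr hσ hh]
  set g := semi η r σ (shift L y) 1 h with hg_def
  have hg : IsUnitFun g := hh.semi hr hσ _ _
  have hg1 : ∀ x, g x = ∫ z, h (r (y L) x + z * σ (y L) x) ∂η := fun x => semi_one hh _ x
  -- At least one step is needed: only then does the law of the chain ignore the null set of points
  -- where the minorization may fail.
  obtain ⟨n, rfl⟩ : ∃ n, L = n + 1 := ⟨L - 1, by omega⟩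
  have hae := ae_chain_of_ae hr hσ hηac hσ0 hy y x n
  have hae' := ae_chain_of_ae hr hσ hηac hσ0 hy y x' n
  have hi := integrable_abs_chain hr hσ hγ hK hgrow hη y x (n + 1)
  have hi' := integrable_abs_chain hr hσ hγ hK hgrow hη y x' (n + 1)
  have hm := integral_abs_chain_le hr hσ hγ hK hgrow hη y x (n + 1)
  have hm' := integral_abs_chain_le hr hσ hγ hK hgrow hη y x' (n + 1)
  unfold semi
  rw [← integral_sub ((hg.chain hr hσ y x _).integrable _) ((hg.chain hr hσ y x' _).integrable _)]
  have hb : ∀ᵐ e ∂noise η, ‖g (chain r σ y e x (n + 1)) - g (chain r σ y e x' (n + 1))‖ ≤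
      1 - κ + κ / R * (|chain r σ y e x (n + 1)| + |chain r σ y e x' (n + 1)|) := by
    filter_upwards [hae, hae'] with e he he'
    set u := chain r σ y e x (n + 1)
    set u' := chain r σ y e x' (n + 1)
    rw [Real.norm_eq_abs]
    -- Inside `[-R, R]` Doeblin's bound holds; otherwise `|u| + |u'| ≥ R`, and the cone term is at
    -- least `κ`, which raises `1 - κ` to the trivial bound `1`.
    by_cases hu : |u| ≤ R ∧ |u'| ≤ R
    · rw [hg1, hg1]
      have := Minorized.abs_sub_le hh (he hu.1) (he' hu.2)
      have : 0 ≤ κ / R * (|u| + |u'|) := by positivity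
      linarith
    · have h1 := hg.abs_sub_le_one u u'
      have h2 : R ≤ |u| + |u'| := by
        by_contra hlt
        push Not at hlt
        exact hu ⟨by linarith [abs_nonneg u'], by linarith [abs_nonneg u]⟩
      have h3 : κ / R * R ≤ κ / R * (|u| + |u'|) := by gcongr
      rw [div_mul_cancel₀ _ hR.ne'] at h3
      linarith
  have hii : Integrable (fun e => κ / R * (|chain r σ y e x (n + 1)| + |chain r σ y e x' (n + 1)|))
      (noise η) := (hi.add hi').const_mul _
  refine (norm_integral_le_of_norm_le ((integrable_const _).add hii) hb).trans ?_
  simp only [Pi.add_apply]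
  rw [integral_add (integrable_const _) hii, integral_const_mul, integral_add hi hi']
  simp only [integral_const, probReal_univ, one_smul]
  have h4 : κ / R * (∫ e, |chain r σ y e x (n + 1)| ∂noise η +
      ∫ e, |chain r σ y e x' (n + 1)| ∂noise η) ≤
      κ / R * (2 * (R / 4) + prodCoef γ y (n + 1) * (|x| + |x'|)) := by
    refine mul_le_mul_of_nonneg_left ?_ (by positivity)
    linarith
  -- Each chain contributes accumulated drift at most `R / 4`, so half of the Doeblin gain is spent
  -- and `κ / 2` remains.
  have h5 : κ / R * (2 * (R / 4)) = κ / 2 := by field_simp; ring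
  linarith

/-- Propagation of a total variation bound through a function with controlled oscillation. -/
lemma abs_semi_sub_le_of_osc {y : ℕ → E} {n : ℕ} {x x' S : ℝ}
    (hS : ∀ h : ℝ → ℝ, IsUnitFun h → |semi η r σ y n h x - semi η r σ y n h x'| ≤ S)
    {g : ℝ → ℝ} (hg : IsUnitFun g) {a c : ℝ} (ha : 0 < a) (hc : 0 ≤ c)
    (hosc : ∀ u u', |g u - g u'| ≤ a + c * (|u| + |u'|)) :
    |semi η r σ y n g x - semi η r σ y n g x'| ≤
      a * S + c * (2 * accum γ K y n + prodCoef γ y n * (|x| + |x'|)) := by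
  obtain ⟨m, h, hh, hgh⟩ := exists_clip hg ha hc hosc
  have key : ∀ x, |semi η r σ y n g x - (m + a * semi η r σ y n h x)| ≤
      c * (accum γ K y n + prodCoef γ y n * |x|) := by
    intro x
    have hi := integrable_abs_chain hr hσ hγ hK hgrow hη y x n
    have hm := integral_abs_chain_le hr hσ hγ hK hgrow hη y x n
    have hgi := (hg.chain hr hσ y x n).integrable (noise η)
    have hhi := (hh.chain hr hσ y x n).integrable (noise η)
    have : semi η r σ y n g x - (m + a * semi η r σ y n h x) =
        ∫ e, (g (chain r σ y e x n) - (m + a * h (chain r σ y e x n))) ∂noise η := by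
      symm
      have hmi : Integrable (fun e => m + a * h (chain r σ y e x n)) (noise η) :=
        (integrable_const m).add (hhi.const_mul a)
      rw [integral_sub hgi hmi, integral_add (integrable_const _) (hhi.const_mul a), integral_const_mul]
      simp [semi]
    rw [this]
    have hb : ∀ e, ‖g (chain r σ y e x n) - (m + a * h (chain r σ y e x n))‖ ≤
        c * |chain r σ y e x n| := fun e => hgh _
    refine (norm_integral_le_of_norm_le (hi.const_mul c) (ae_of_all _ hb)).trans ?_
    rw [integral_const_mul]
    gcongr
  have h1 := abs_le.1 (key x)
  have h2 := abs_le.1 (key x')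
  have h3 := abs_le.1 (hS h hh)
  have h4 := mul_le_mul_of_nonneg_left h3.1 ha.le
  have h5 := mul_le_mul_of_nonneg_left h3.2 ha.le
  rw [abs_le]
  constructor <;> linarith [h1.1, h1.2, h2.1, h2.2]

end Contraction

/-! ### Iteration over blocks in a fixed environment -/

/-- The environments along which the drift accumulated over `L` steps is at most `R / 4` and the
state after `L` steps lies in `A`. -/
def goodSet {E : Type*} (γ K : E → ℝ) (A : Set E) (R : ℝ) (L : ℕ) : Set (ℕ → E) :=
  {y | accum γ K y L ≤ R / 4 ∧ y L ∈ A}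

/-- Recursive bound for the total variation distance, after `i` blocks of length `2 * L`, between
two quenched chains whose starting points have absolute values that sum to `v`. -/
noncomputable def coupErr {E : Type*} (γ K : E → ℝ) (A : Set E) (R κ : ℝ) (L : ℕ) (y : ℕ → E)
    (v : ℝ) : ℕ → ℝ
  | 0 => 1
  | i + 1 => min 1
      ((1 - κ / 2 * (goodSet γ K A R L).indicator (fun _ => (1 : ℝ)) (shift (2 * L * i) y)) *
        coupErr γ K A R κ L y v i +
      min 1 (κ / R * prodCoef γ (shift (2 * L * i) y) L *
        (2 * accum γ K y (2 * L * i) + prodCoef γ y (2 * L * i) * v)))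

section CoupErr

variable {E : Type*} {γ K : E → ℝ} {A : Set E} {R κ : ℝ} {L : ℕ}

lemma coupErr_le_one (y : ℕ → E) (v : ℝ) (i : ℕ) : coupErr γ K A R κ L y v i ≤ 1 := by
  cases i with
  | zero => exact le_rfl
  | succ i => exact min_le_left _ _

lemma contraction_nonneg (hκ1 : κ ≤ 1) (y : ℕ → E) :
    0 ≤ 1 - κ / 2 * (goodSet γ K A R L).indicator (fun _ => (1 : ℝ)) y := by
  by_cases h : y ∈ goodSet γ K A R L <;> simp [h]
  linarith

lemma cone_nonneg (hγ : ∀ y, 0 ≤ γ y) (hK : ∀ y, 0 ≤ K y) (hR : 0 < R) (hκ : 0 ≤ κ) {v : ℝ}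
    (hv : 0 ≤ v) (y y' : ℕ → E) (n : ℕ) :
    0 ≤ κ / R * prodCoef γ y' L * (2 * accum γ K y n + prodCoef γ y n * v) := by
  have h1 := prodCoef_nonneg hγ y' L
  have h2 := prodCoef_nonneg hγ y n
  have h3 := accum_nonneg hγ hK y n
  positivity

lemma coupErr_nonneg (hγ : ∀ y, 0 ≤ γ y) (hK : ∀ y, 0 ≤ K y) (hR : 0 < R) (hκ : 0 ≤ κ)
    (hκ1 : κ ≤ 1) {v : ℝ} (hv : 0 ≤ v) (y : ℕ → E) (i : ℕ) :
    0 ≤ coupErr γ K A R κ L y v i := by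
  induction i with
  | zero => exact zero_le_one
  | succ i ih =>
    exact le_min zero_le_one (add_nonneg (mul_nonneg (contraction_nonneg hκ1 _) ih)
      (le_min zero_le_one (cone_nonneg hγ hK hR hκ hv _ _ _)))

/-- With this, a single environment functional serves all starting points in a bounded set, as the
stationary case requires. -/
lemma coupErr_mono (hγ : ∀ y, 0 ≤ γ y) (hR : 0 < R) (hκ : 0 ≤ κ)
    (hκ1 : κ ≤ 1) {v v' : ℝ} (hv : v ≤ v') (y : ℕ → E) (i : ℕ) :
    coupErr γ K A R κ L y v i ≤ coupErr γ K A R κ L y v' i := by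
  induction i with
  | zero => exact le_rfl
  | succ i ih =>
    have h0 := contraction_nonneg (γ := γ) (K := K) (A := A) (R := R) (L := L) hκ1
      (shift (2 * L * i) y)
    have h1 := prodCoef_nonneg hγ (shift (2 * L * i) y) L
    have h2 := prodCoef_nonneg hγ y (2 * L * i)
    simp only [coupErr]
    gcongr

lemma goodSet_congr {y y' : ℕ → E} (hy : ∀ j ≤ L, y j = y' j) :
    (goodSet γ K A R L).indicator (fun _ => (1 : ℝ)) y =
      (goodSet γ K A R L).indicator (fun _ => (1 : ℝ)) y' := by
  have : y ∈ goodSet γ K A R L ↔ y' ∈ goodSet γ K A R L := by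
    simp only [goodSet, Set.mem_ofPred_eq]
    rw [accum_congr γ K (fun i hi => hy i hi.le), hy L le_rfl]
  by_cases h : y ∈ goodSet γ K A R L
  · simp [h, this.1 h]
  · simp [h, mt this.2 h]

/-- The last block reads the environment only up to its own time `L`; its `L - 1` idle coordinates
are never used. The next block starts at `2 * L * i`, so a gap of length `L` is left for the mixing
of the environment. -/
lemma coupErr_congr {y y' : ℕ → E} (v : ℝ) (i : ℕ) (hy : ∀ j ≤ 2 * L * i - L, y j = y' j) :
    coupErr γ K A R κ L y v i = coupErr γ K A R κ L y' v i := by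
  induction i with
  | zero => rfl
  | succ i ih =>
    have hi : 2 * L * (i + 1) - L = 2 * L * i + L := by
      have : 2 * L * (i + 1) = 2 * L * i + L + L := by ring
      omega
    rw [hi] at hy
    have hs : ∀ j ≤ L, shift (2 * L * i) y j = shift (2 * L * i) y' j := fun j hj =>
      hy _ (by omega)
    simp only [coupErr]
    rw [ih fun j hj => hy j (by omega), goodSet_congr hs,
      prodCoef_congr γ fun j hj => hs j hj.le, prodCoef_congr γ fun j hj => hy j (by omega),
      accum_congr γ K fun j hj => hy j (by omega)]

lemma measurableSet_goodSet [MeasurableSpace E] (hγ : Measurable γ) (hK : Measurable K)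
    (hA : MeasurableSet A) : MeasurableSet (goodSet γ K A R L) :=
  (measurableSet_le (measurable_accum hγ hK L) measurable_const).inter
    (hA.preimage (measurable_pi_apply L))

lemma measurable_coupErr [MeasurableSpace E] (hγ : Measurable γ) (hK : Measurable K)
    (hA : MeasurableSet A) (i : ℕ) :
    Measurable fun p : (ℕ → E) × ℝ => coupErr γ K A R κ L p.1 p.2 i := by
  induction i with
  | zero => exact measurable_const
  | succ i ih =>
    have h1 : Measurable fun p : (ℕ → E) × ℝ => shift (2 * L * i) p.1 := by fun_prop
    have h2 := (IsUnitFun.indicator_one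
      (measurableSet_goodSet (R := R) (L := L) hγ hK hA)).measurable.comp h1
    have h3 := (measurable_prodCoef hγ L).comp h1
    have h4 := (measurable_prodCoef hγ (2 * L * i)).comp
      (measurable_fst : Measurable (Prod.fst : (ℕ → E) × ℝ → ℕ → E))
    have h5 := (measurable_accum hγ hK (2 * L * i)).comp
      (measurable_fst : Measurable (Prod.fst : (ℕ → E) × ℝ → ℕ → E))
    simp only [Function.comp_def] at h2 h3 h4 h5
    simp only [coupErr]
    fun_prop

variable [MeasurableSpace E] {r σ : E → ℝ → ℝ} {η : Measure ℝ} [IsProbabilityMeasure η]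
  (hr : Measurable (Function.uncurry r)) (hσ : Measurable (Function.uncurry σ))
  (hγ : ∀ y, 0 ≤ γ y) (hK : ∀ y, 0 ≤ K y)
  (hgrow : ∀ y x, |r y x| + |σ y x| ≤ γ y * |x| + K y)
  (hη : ∫⁻ z, ENNReal.ofReal |z| ∂η ≤ 1)
include hr hσ hγ hK hgrow hη

/-- The quenched chains started from two points merge at the rate given by `coupErr`. -/
lemma abs_semi_sub_le_coupErr (hηac : η ≪ volume) (hσ0 : ∀ y x, σ y x ≠ 0)
    (hR : 0 < R) (hκ : 0 ≤ κ) (hκ1 : κ ≤ 1) (hA : ∀ v ∈ A, Minorized η r σ R κ v) (hL : 1 ≤ L)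
    (y : ℕ → E) (x x' : ℝ) (i : ℕ) {h : ℝ → ℝ} (hh : IsUnitFun h) :
    |semi η r σ y (2 * L * i) h x - semi η r σ y (2 * L * i) h x'| ≤
      coupErr γ K A R κ L y (|x| + |x'|) i := by
  induction i generalizing h with
  | zero => exact (hh.semi hr hσ y _).abs_sub_le_one _ _
  | succ i ih =>
    refine le_min ((hh.semi hr hσ y _).abs_sub_le_one _ _) ?_
    set n := 2 * L * i with hn
    set S := coupErr γ K A R κ L y (|x| + |x'|) i
    have hS0 : 0 ≤ S := coupErr_nonneg hγ hK hR hκ hκ1 (by positivity) y i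
    have hcone := cone_nonneg (L := L) hγ hK hR hκ (v := |x| + |x'|) (by positivity) y (shift n y) n
    -- If the truncation of the cone term is active, the claim is weaker than the trivial bound `1`.
    by_cases hone : 1 ≤ κ / R * prodCoef γ (shift n y) L *
        (2 * accum γ K y n + prodCoef γ y n * (|x| + |x'|))
    · rw [min_eq_left hone]
      have h1 := (hh.semi (η := η) hr hσ y (2 * L * (i + 1))).abs_sub_le_one x x'
      have h2 := mul_nonneg (contraction_nonneg (γ := γ) (K := K) (A := A) (R := R) (L := L) hκ1
        (shift n y)) hS0
      linarith
    rw [min_eq_right (not_le.1 hone).le]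
    -- The new block: `L` steps of drift, one minorized step, and `L - 1` idle steps that are
    -- absorbed into the test function.
    have hlen : 2 * L * (i + 1) = n + (L + 1 + (L - 1)) := by
      have : 2 * L * (i + 1) = n + 2 * L := by rw [hn]; ring
      omega
    rw [hlen, semi_add hr hσ hh, semi_add hr hσ hh y n]
    by_cases hgood : shift n y ∈ goodSet γ K A R L
    · have hh1 := hh.semi (η := η) hr hσ (shift (L + 1) (shift n y)) (L - 1)
      have hosc := abs_semi_sub_le_of_minorized hr hσ hγ hK hgrow hη hηac hσ0 hR hκ hL
        (hA _ hgood.2) hgood.1 hh1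
      simp only [← semi_add hr hσ hh] at hosc
      -- The previous bound holds for all test functions, so it controls the clipped part, with
      -- factor `1 - κ / 2`; the cone part is paid for by the moment bound at time `n`.
      have := abs_semi_sub_le_of_osc hr hσ hγ hK hgrow hη (fun h hh => ih hh)
        (hh.semi hr hσ (shift n y) (L + 1 + (L - 1))) (by linarith)
        (mul_nonneg (div_nonneg hκ hR.le) (prodCoef_nonneg hγ (shift n y) L)) hosc
      simpa [hgood] using this
    · have := ih (hh.semi (η := η) hr hσ (shift n y) (L + 1 + (L - 1)))
      simp only [hgood, not_false_eq_true, Set.indicator_of_notMem, mul_zero, sub_zero, one_mul]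
      linarith

/-- Steps after the last complete block merely replace `h` by another function with values in `[0,
1]`. -/
lemma abs_semi_sub_le_coupErr_of_le (hηac : η ≪ volume) (hσ0 : ∀ y x, σ y x ≠ 0)
    (hR : 0 < R) (hκ : 0 ≤ κ) (hκ1 : κ ≤ 1) (hA : ∀ v ∈ A, Minorized η r σ R κ v) (hL : 1 ≤ L)
    (y : ℕ → E) (x x' : ℝ) {i n : ℕ} (hn : 2 * L * i ≤ n) {h : ℝ → ℝ} (hh : IsUnitFun h) :
    |semi η r σ y n h x - semi η r σ y n h x'| ≤ coupErr γ K A R κ L y (|x| + |x'|) i := by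
  obtain ⟨m, rfl⟩ := Nat.exists_eq_add_of_le hn
  rw [semi_add hr hσ hh, semi_add hr hσ hh]
  exact abs_semi_sub_le_coupErr hr hσ hγ hK hgrow hη hηac hσ0 hR hκ hκ1 hA hL y x x' i
    (hh.semi hr hσ _ _)

end CoupErr

/-! ### Averaging the coupling error over the environment -/

/-- Covariance bounds `α` between the past and the future of a stationary path. -/
def MixBound {S : Type*} [MeasurableSpace S] (π : Measure (ℕ → S)) (α : ℕ → ℝ) : Prop :=
  ∀ (n j : ℕ) (f g : (ℕ → S) → ℝ), IsUnitFun f → IsUnitFun g → (∀ y, f (freeze j y) = f y) →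
    |∫ y, f y * g (shift (j + n) y) ∂π - (∫ y, f y ∂π) * ∫ y, g y ∂π| ≤ α n

lemma MixBound.nonneg {S : Type*} [MeasurableSpace S] {π : Measure (ℕ → S)} {α : ℕ → ℝ}
    (h : MixBound π α) (n : ℕ) : 0 ≤ α n := by
  have h0 : IsUnitFun fun _ : ℕ → S => (0 : ℝ) :=
    ⟨measurable_const, fun _ => le_rfl, fun _ => zero_le_one⟩
  simpa using h n 0 _ _ h0 h0 fun _ => rfl

/-- The covariance bound is unaffected by an independent randomization. -/
lemma MixBound.prod {S T : Type*} [MeasurableSpace S] [MeasurableSpace T] {π : Measure (ℕ → S)}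
    [IsProbabilityMeasure π] {α : ℕ → ℝ} (h : MixBound π α) (Q : Measure T)
    [IsProbabilityMeasure Q] {n j : ℕ} {F : (ℕ → S) × T → ℝ} {g : (ℕ → S) → ℝ} (hF : IsUnitFun F)
    (hg : IsUnitFun g) (hFj : ∀ y e, F (freeze j y, e) = F (y, e)) :
    |∫ p, F p * g (shift (j + n) p.1) ∂π.prod Q - (∫ p, F p ∂π.prod Q) * ∫ y, g y ∂π| ≤ α n := by
  have hFg : IsUnitFun fun p : (ℕ → S) × T => F p * g (shift (j + n) p.1) :=
    hF.mul (hg.comp (by fun_prop))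
  have hi := hFg.integrable (π.prod Q)
  have hi' := hF.integrable (π.prod Q)
  rw [integral_prod_symm _ hi, integral_prod_symm _ hi', ← integral_mul_const,
    ← integral_sub hi.integral_prod_right (hi'.integral_prod_right.mul_const _)]
  have hb : ∀ e, ‖∫ y, F (y, e) * g (shift (j + n) y) ∂π - (∫ y, F (y, e) ∂π) * ∫ y, g y ∂π‖ ≤
      α n := fun e => h n j _ g (hF.comp measurable_prodMk_right) hg fun y => hFj y e
  simpa using norm_integral_le_of_norm_le_const (μ := Q) (ae_of_all _ hb)

section Expectation

variable {E : Type*} [MeasurableSpace E] {r σ : E → ℝ → ℝ} {γ K : E → ℝ} {A : Set E} {R κ : ℝ}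
  {L : ℕ} {η : Measure ℝ} [IsProbabilityMeasure η] {π : Measure (ℕ → E)} [IsProbabilityMeasure π]
  {α : ℕ → ℝ} {s : ℕ} {x z p : ℝ}

lemma isUnitFun_coupErr (hr : Measurable (Function.uncurry r))
    (hσ : Measurable (Function.uncurry σ)) (hγ : ∀ y, 0 ≤ γ y) (hK : ∀ y, 0 ≤ K y)
    (hγm : Measurable γ) (hKm : Measurable K) (hAm : MeasurableSet A) (hR : 0 < R) (hκ : 0 ≤ κ)
    (hκ1 : κ ≤ 1) (s : ℕ) (x : ℝ) (i : ℕ) :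
    IsUnitFun fun q : (ℕ → E) × (ℕ → ℝ) =>
      coupErr γ K A R κ L (shift s q.1) |chain r σ q.1 q.2 x s| i := by
  refine ⟨?_, fun q => coupErr_nonneg hγ hK hR hκ hκ1 (abs_nonneg _) _ _,
    fun q => coupErr_le_one _ _ _⟩
  refine (measurable_coupErr hγm hKm hAm i).comp
    (((measurable_shift s).comp measurable_fst).prodMk ?_)
  exact (Measurable.chain hr hσ measurable_fst measurable_snd measurable_const s).abs

omit [IsProbabilityMeasure π] in
/-- The expected cone term of a block. -/
lemma lintegral_cone_le (hr : Measurable (Function.uncurry r))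
    (hσ : Measurable (Function.uncurry σ)) (hγ : ∀ y, 0 ≤ γ y) (hK : ∀ y, 0 ≤ K y)
    (hγm : Measurable γ) (hKm : Measurable K)
    (hgrow : ∀ y x, |r y x| + |σ y x| ≤ γ y * |x| + K y)
    (hη : ∫⁻ z, ENNReal.ofReal |z| ∂η ≤ 1) (hR : 0 < R) (hκ : 0 ≤ κ)
    (hstat : ∀ k, MeasurePreserving (shift k) π π) (hγ1 : ∀ᵐ y ∂π, ∀ n, γ (y n) ≤ 1)
    (hz0 : 0 ≤ z)
    (hz1 : ∀ t, ∫⁻ y, ENNReal.ofReal (accum γ K y t * prodCoef γ (shift t y) L) ∂π ≤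
      ENNReal.ofReal z)
    (hz2 : ∫⁻ y, ENNReal.ofReal (prodCoef γ y L) ∂π ≤ ENNReal.ofReal z) (n : ℕ) :
    ∫⁻ q, ENNReal.ofReal (κ / R * prodCoef γ (shift n (shift s q.1)) L *
        (2 * accum γ K (shift s q.1) n + prodCoef γ (shift s q.1) n * |chain r σ q.1 q.2 x s|))
      ∂π.prod (noise η) ≤ ENNReal.ofReal (κ / R * ((2 + |x|) * z)) := by
  have hm1 : ∀ k l, Measurable fun y : ℕ → E => prodCoef γ (shift k y) l := fun k l =>
    (measurable_prodCoef hγm l).comp (measurable_shift k)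
  have hm2 : ∀ k l, Measurable fun y : ℕ → E => accum γ K (shift k y) l := fun k l =>
    (measurable_accum hγm hKm l).comp (measurable_shift k)
  have hm2' := fun n => measurable_accum (γ := γ) (K := K) hγm hKm n
  have hmc : Measurable fun q : (ℕ → E) × (ℕ → ℝ) => |chain r σ q.1 q.2 x s| :=
    (Measurable.chain hr hσ measurable_fst measurable_snd measurable_const s).abs
  have hp := fun y n => prodCoef_nonneg hγ y n
  have ha := fun y n => accum_nonneg hγ hK y n
  have hκR : 0 ≤ κ / R := div_nonneg hκ hR.le
  simp only [shift_shift]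
  rw [lintegral_prod _ (by
    have h1 := (hm1 (s + n) L).comp
      (measurable_fst : Measurable (Prod.fst : (ℕ → E) × (ℕ → ℝ) → ℕ → E))
    have h2 := (hm1 s n).comp
      (measurable_fst : Measurable (Prod.fst : (ℕ → E) × (ℕ → ℝ) → ℕ → E))
    have h3 := (hm2 s n).comp
      (measurable_fst : Measurable (Prod.fst : (ℕ → E) × (ℕ → ℝ) → ℕ → E))
    simp only [Function.comp_def] at h1 h2 h3
    fun_prop)]
  calc _ ≤ ∫⁻ y, ENNReal.ofReal (κ / R) *
          (ENNReal.ofReal (2 * (accum γ K y (s + n) * prodCoef γ (shift (s + n) y) L)) +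
          ENNReal.ofReal (|x| * prodCoef γ (shift (s + n) y) L)) ∂π := by
        refine lintegral_mono_ae ?_
        filter_upwards [hγ1] with y hy
        have hle1 : prodCoef γ y (s + n) ≤ 1 := Finset.prod_le_one (fun _ _ => hγ _) fun i _ => hy i
        have h1 : ∀ e, ENNReal.ofReal (κ / R * prodCoef γ (shift (s + n) y) L *
            (2 * accum γ K (shift s y) n + prodCoef γ (shift s y) n * |chain r σ y e x s|)) =
            ENNReal.ofReal (κ / R * prodCoef γ (shift (s + n) y) L) *
            (ENNReal.ofReal (2 * accum γ K (shift s y) n) + ENNReal.ofReal (prodCoef γ (shift s y) n)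
              * ENNReal.ofReal |chain r σ y e x s|) := by
          intro e
          rw [ENNReal.ofReal_mul (mul_nonneg hκR (hp _ _)), ENNReal.ofReal_add
            (mul_nonneg two_pos.le (ha _ _)) (mul_nonneg (hp _ _) (abs_nonneg _)),
            ENNReal.ofReal_mul (hp _ _)]
        have hmc' : Measurable fun e => ENNReal.ofReal |chain r σ y e x s| :=
          (hmc.comp measurable_prodMk_left).ennreal_ofReal
        simp only [h1]
        rw [lintegral_const_mul _ ((hmc'.const_mul _).const_add _),
          lintegral_add_left measurable_const, lintegral_const_mul _ hmc']
        simp only [lintegral_const, measure_univ, mul_one]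
        calc _ ≤ ENNReal.ofReal (κ / R * prodCoef γ (shift (s + n) y) L) *
              (ENNReal.ofReal (2 * accum γ K (shift s y) n) + ENNReal.ofReal (prodCoef γ (shift s y) n)
              * ENNReal.ofReal (accum γ K y s + prodCoef γ y s * |x|)) := by
              gcongr
              exact lintegral_abs_chain_le hr hσ hγ hK hgrow hη y x s
          _ = ENNReal.ofReal (κ / R * prodCoef γ (shift (s + n) y) L *
              (2 * accum γ K (shift s y) n + prodCoef γ (shift s y) n *
                (accum γ K y s + prodCoef γ y s * |x|))) := by
              have h2 : 0 ≤ accum γ K y s + prodCoef γ y s * |x| :=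
                add_nonneg (ha _ _) (mul_nonneg (hp _ _) (abs_nonneg _))
              rw [ENNReal.ofReal_mul (mul_nonneg hκR (hp _ _)), ENNReal.ofReal_add
                (mul_nonneg two_pos.le (ha _ _)) (mul_nonneg (hp _ _) h2),
                ENNReal.ofReal_mul (hp _ _)]
          _ ≤ ENNReal.ofReal (κ / R * (2 * (accum γ K y (s + n) * prodCoef γ (shift (s + n) y) L) +
              |x| * prodCoef γ (shift (s + n) y) L)) := by
              refine ENNReal.ofReal_le_ofReal ?_
              rw [mul_assoc]
              refine mul_le_mul_of_nonneg_left ?_ hκR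
              -- The drift inherited from the first `s` steps recombines with the later drift into
              -- the one accumulated up to `s + n`. This keeps the bound uniform in `s`.
              have h3 : 2 * accum γ K (shift s y) n + prodCoef γ (shift s y) n *
                  (accum γ K y s + prodCoef γ y s * |x|) ≤ 2 * accum γ K y (s + n) + |x| := by
                rw [accum_add, mul_add, ← mul_assoc (prodCoef γ (shift s y) n),
                  mul_comm (prodCoef γ (shift s y) n) (prodCoef γ y s), ← prodCoef_add]
                have h4 := mul_nonneg (hp (shift s y) n) (ha y s)
                have h5 := mul_le_mul_of_nonneg_right hle1 (abs_nonneg x)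
                linarith
              have := mul_le_mul_of_nonneg_left h3 (hp (shift (s + n) y) L)
              linarith
          _ = _ := by
              rw [ENNReal.ofReal_mul hκR, ENNReal.ofReal_add
                (mul_nonneg two_pos.le (mul_nonneg (ha _ _) (hp _ _)))
                (mul_nonneg (abs_nonneg _) (hp _ _))]
    _ = ENNReal.ofReal (κ / R) * (ENNReal.ofReal 2 *
          (∫⁻ y, ENNReal.ofReal (accum γ K y (s + n) * prodCoef γ (shift (s + n) y) L) ∂π) +
          ENNReal.ofReal |x| * ∫⁻ y, ENNReal.ofReal (prodCoef γ y L) ∂π) := by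
        have hm3 := hm1 (s + n) L
        have hm4 := hm2' (s + n)
        rw [lintegral_const_mul _ (by fun_prop), lintegral_add_left (by fun_prop)]
        simp only [ENNReal.ofReal_mul two_pos.le, ENNReal.ofReal_mul (abs_nonneg x)]
        rw [lintegral_const_mul _ (by fun_prop), lintegral_const_mul _ (by fun_prop),
          (hstat (s + n)).lintegral_comp (f := fun y => ENNReal.ofReal (prodCoef γ y L))
            (measurable_prodCoef hγm L).ennreal_ofReal]
    _ ≤ ENNReal.ofReal (κ / R) * (ENNReal.ofReal 2 * ENNReal.ofReal z +
          ENNReal.ofReal |x| * ENNReal.ofReal z) := by gcongr; exact hz1 _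
    _ = _ := by
        rw [← ENNReal.ofReal_mul two_pos.le, ← ENNReal.ofReal_mul (abs_nonneg x),
          ← ENNReal.ofReal_add (by positivity) (by positivity), ← ENNReal.ofReal_mul hκR]
        congr 1; ring

/-- One block contracts the expected coupling error. -/
lemma integral_coupErr_succ_le (hr : Measurable (Function.uncurry r))
    (hσ : Measurable (Function.uncurry σ)) (hγ : ∀ y, 0 ≤ γ y) (hK : ∀ y, 0 ≤ K y)
    (hγm : Measurable γ) (hKm : Measurable K) (hAm : MeasurableSet A)
    (hgrow : ∀ y x, |r y x| + |σ y x| ≤ γ y * |x| + K y)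
    (hη : ∫⁻ z, ENNReal.ofReal |z| ∂η ≤ 1) (hR : 0 < R) (hκ : 0 ≤ κ) (hκ1 : κ ≤ 1)
    (hstat : ∀ k, MeasurePreserving (shift k) π π) (hγ1 : ∀ᵐ y ∂π, ∀ n, γ (y n) ≤ 1)
    (hmix : MixBound π α)
    (hz0 : 0 ≤ z)
    (hz1 : ∀ t, ∫⁻ y, ENNReal.ofReal (accum γ K y t * prodCoef γ (shift t y) L) ∂π ≤
      ENNReal.ofReal z)
    (hz2 : ∫⁻ y, ENNReal.ofReal (prodCoef γ y L) ∂π ≤ ENNReal.ofReal z)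
    (hp : p ≤ π.real (goodSet γ K A R L)) (i : ℕ) :
    ∫ q, coupErr γ K A R κ L (shift s q.1) |chain r σ q.1 q.2 x s| (i + 1) ∂π.prod (noise η) ≤
      (1 - κ / 2 * p) *
        ∫ q, coupErr γ K A R κ L (shift s q.1) |chain r σ q.1 q.2 x s| i ∂π.prod (noise η) +
      (κ / 2 * α L + κ / R * ((2 + |x|) * z)) := by
  set S := fun (i : ℕ) (q : (ℕ → E) × (ℕ → ℝ)) =>
    coupErr γ K A R κ L (shift s q.1) |chain r σ q.1 q.2 x s| i with hS
  have hSu : ∀ i, IsUnitFun (S i) := fun i =>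
    isUnitFun_coupErr hr hσ hγ hK hγm hKm hAm hR hκ hκ1 s x i
  set G := (goodSet γ K A R L).indicator (fun _ => (1 : ℝ)) with hG
  have hGu : IsUnitFun G := IsUnitFun.indicator_one (measurableSet_goodSet hγm hKm hAm)
  have hGi : ∫ y, G y ∂π = π.real (goodSet γ K A R L) :=
    integral_indicator_one (measurableSet_goodSet hγm hKm hAm)
  set n := 2 * L * i with hn
  set φ := fun q : (ℕ → E) × (ℕ → ℝ) => κ / R * prodCoef γ (shift n (shift s q.1)) L *
    (2 * accum γ K (shift s q.1) n + prodCoef γ (shift s q.1) n * |chain r σ q.1 q.2 x s|) with hφ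
  have hφ0 : ∀ q, 0 ≤ φ q := fun q => cone_nonneg hγ hK hR hκ (abs_nonneg _) _ _ _
  have hφm : Measurable φ := by
    have h0 : Measurable fun q : (ℕ → E) × (ℕ → ℝ) => |chain r σ q.1 q.2 x s| :=
      (Measurable.chain hr hσ measurable_fst measurable_snd measurable_const s).abs
    have hs : Measurable fun q : (ℕ → E) × (ℕ → ℝ) => shift s q.1 := by fun_prop
    have h1 := (measurable_prodCoef hγm L).comp ((measurable_shift n).comp hs)
    have h2 := (measurable_prodCoef hγm n).comp hs
    have h3 := (measurable_accum hγm hKm n).comp hs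
    simp only [Function.comp_def] at h1 h2 h3
    fun_prop
  have hφu : IsUnitFun fun q => min 1 (φ q) :=
    ⟨measurable_const.min hφm, fun q => le_min zero_le_one (hφ0 q), fun q => min_le_left _ _⟩
  have hφi : ∫ q, min 1 (φ q) ∂π.prod (noise η) ≤ κ / R * ((2 + |x|) * z) := by
    rw [integral_eq_lintegral_of_nonneg_ae (ae_of_all _ hφu.nonneg)
      hφu.measurable.aestronglyMeasurable]
    refine ENNReal.toReal_le_of_le_ofReal (by positivity) ?_
    refine (lintegral_mono fun q => ENNReal.ofReal_le_ofReal (min_le_right _ _)).trans ?_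
    exact lintegral_cone_le hr hσ hγ hK hγm hKm hgrow hη hR hκ hstat hγ1 hz0 hz1 hz2 n
  have hcov : |∫ q, S i q * G (shift (s + n) q.1) ∂π.prod (noise η) -
      (∫ q, S i q ∂π.prod (noise η)) * ∫ y, G y ∂π| ≤ α L := by
    -- For `i = 0` there is no gap before the first block, but the error is the constant `1` and
    -- stationarity alone gives the product.
    cases i with
    | zero =>
      have h1 : ∫ q, G (shift (s + n) (Prod.fst q)) ∂π.prod (noise η) = ∫ y, G y ∂π := by
        have hg : IsUnitFun fun q : (ℕ → E) × (ℕ → ℝ) => G (shift (s + n) q.1) :=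
          hGu.comp (by fun_prop)
        rw [integral_prod _ (hg.integrable _)]
        simp only [integral_const, probReal_univ, one_smul]
        rw [← (hstat (s + n)).map_eq, integral_map (hstat (s + n)).measurable.aemeasurable
          hGu.measurable.aestronglyMeasurable, (hstat (s + n)).map_eq]
      simp only [hS, coupErr, one_mul]
      rw [h1]
      simpa using hmix.nonneg L
    | succ i =>
      have hLn : L ≤ n := by
        have : n = 2 * L * i + L + L := by rw [hn]; ring
        omega
      -- The error depends on the environment up to time `s + n - L` only, and the good-block event
      -- on its path from `s + n` on.
      have hsn : s + n = (s + n - L) + L := by omega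
      rw [hsn]
      refine hmix.prod (noise η) (hSu _) hGu fun y e => ?_
      simp only [hS]
      rw [chain_congr r σ (y := freeze (s + n - L) y) (y' := y) (e' := e) x
        (fun j hj => by simp only [freeze]; congr 1; omega) fun _ _ => rfl]
      refine coupErr_congr _ _ fun j hj => ?_
      simp only [shift, freeze]; congr 1; omega
  have hpt : ∀ q, S (i + 1) q ≤ S i q - κ / 2 * (S i q * G (shift (s + n) q.1)) + min 1 (φ q) := by
    intro q
    refine (min_le_right _ _).trans (le_of_eq ?_)
    rw [shift_shift s]
    simp only [hS, hφ, shift_shift, hG, hn]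
    ring
  have hI1 := (hSu i).integrable (π.prod (noise η))
  have hI2 := ((hSu i).mul (hGu.comp (φ := fun q : (ℕ → E) × (ℕ → ℝ) => shift (s + n) q.1)
    (by fun_prop))).integrable (π.prod (noise η))
  have hI3 := hφu.integrable (π.prod (noise η))
  have hint : ∫ q, S (i + 1) q ∂π.prod (noise η) ≤ ∫ q, S i q ∂π.prod (noise η) -
      κ / 2 * ∫ q, S i q * G (shift (s + n) q.1) ∂π.prod (noise η) +
      ∫ q, min 1 (φ q) ∂π.prod (noise η) := by
    have hI4 : Integrable (fun q => S i q - κ / 2 * (S i q * G (shift (s + n) q.1)))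
        (π.prod (noise η)) := hI1.sub (hI2.const_mul _)
    rw [← integral_const_mul, ← integral_sub hI1 (hI2.const_mul _), ← integral_add hI4 hI3]
    exact integral_mono ((hSu _).integrable _) (hI4.add hI3) hpt
  have hD := (hSu i).integral_nonneg (π.prod (noise η))
  have h1 := (abs_le.1 hcov).1
  rw [hGi] at h1
  have h2 := mul_le_mul_of_nonneg_left hp hD
  have h3 := mul_le_mul_of_nonneg_left (h2.trans (by linarith : _ ≤
    ∫ q, S i q * G (shift (s + n) q.1) ∂π.prod (noise η) + α L)) (by linarith : 0 ≤ κ / 2)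
  change ∫ q, S (i + 1) q ∂π.prod (noise η) ≤ (1 - κ / 2 * p) * ∫ q, S i q ∂π.prod (noise η) + _
  linarith

/-- The value `c / δ` dominates its own image under the affine recursion because `ρ ≤ 1 - δ`; the
remaining part decays geometrically. -/
lemma le_geom_of_succ_le {D : ℕ → ℝ} {ρ δ c : ℝ} (hρ : 0 ≤ ρ) (hδ : ρ ≤ 1 - δ) (hδ0 : 0 < δ)
    (hc : 0 ≤ c) (h0 : D 0 ≤ 1) (hD : ∀ i, D (i + 1) ≤ ρ * D i + c) (i : ℕ) :
    D i ≤ ρ ^ i + c / δ := by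
  induction i with
  | zero => simp only [pow_zero]; linarith [div_nonneg hc hδ0.le]
  | succ i ih =>
    have h1 := mul_le_mul_of_nonneg_left ih hρ
    have h2 := mul_le_mul_of_nonneg_right hδ (div_nonneg hc hδ0.le)
    have h3 : δ * (c / δ) = c := by field_simp
    rw [pow_succ]
    linarith [hD i]

/-- Geometric decay of the expected coupling error, up to the mixing and drift errors of one
block. -/
lemma integral_coupErr_le (hr : Measurable (Function.uncurry r))
    (hσ : Measurable (Function.uncurry σ)) (hγ : ∀ y, 0 ≤ γ y) (hK : ∀ y, 0 ≤ K y)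
    (hγm : Measurable γ) (hKm : Measurable K) (hAm : MeasurableSet A)
    (hgrow : ∀ y x, |r y x| + |σ y x| ≤ γ y * |x| + K y)
    (hη : ∫⁻ z, ENNReal.ofReal |z| ∂η ≤ 1) (hR : 0 < R) (hκ : 0 < κ) (hκ1 : κ ≤ 1)
    (hstat : ∀ k, MeasurePreserving (shift k) π π) (hγ1 : ∀ᵐ y ∂π, ∀ n, γ (y n) ≤ 1)
    (hmix : MixBound π α)
    (hz0 : 0 ≤ z)
    (hz1 : ∀ t, ∫⁻ y, ENNReal.ofReal (accum γ K y t * prodCoef γ (shift t y) L) ∂π ≤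
      ENNReal.ofReal z)
    (hz2 : ∫⁻ y, ENNReal.ofReal (prodCoef γ y L) ∂π ≤ ENNReal.ofReal z)
    (hp0 : 0 < p) (hp1 : p ≤ 1) (hp : p ≤ π.real (goodSet γ K A R L)) (q : ℕ) :
    ∫ w, coupErr γ K A R κ L (shift s w.1) |chain r σ w.1 w.2 x s| q ∂π.prod (noise η) ≤
      (1 - κ / 2 * p) ^ q + (κ / 2 * α L + κ / R * ((2 + |x|) * z)) / (κ / 2 * p) := by
  have h1 : κ / 2 * p ≤ 1 := mul_le_one₀ (by linarith) hp0.le hp1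
  have := hmix.nonneg L
  refine le_geom_of_succ_le (D := fun q => ∫ w, coupErr γ K A R κ L (shift s w.1)
    |chain r σ w.1 w.2 x s| q ∂π.prod (noise η)) (by linarith) le_rfl (by positivity)
    (by positivity) (by simp [coupErr]) (fun i => ?_) q
  exact integral_coupErr_succ_le hr hσ hγ hK hγm hKm hAm hgrow hη hR hκ.le hκ1 hstat hγ1 hmix hz0
    hz1 hz2 hp i

end Expectation

/-! ### Mixing of the pair for a started chain -/

/-- The joint path of the autoregression started at `x` and of its environment. -/
def jointPath {E : Type*} (r σ : E → ℝ → ℝ) (x : ℝ) (q : (ℕ → E) × (ℕ → ℝ)) : ℕ → ℝ × E :=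
  fun k => (chain r σ q.1 q.2 x k, q.1 k)

/-- The quenched expectation of a functional of the joint path after time `n`. -/
noncomputable def tailMean {E : Type*} (η : Measure ℝ) (r σ : E → ℝ → ℝ) (g : (ℕ → ℝ × E) → ℝ)
    (n : ℕ) (y : ℕ → E) (u : ℝ) : ℝ :=
  ∫ e, g (shift n (jointPath r σ u (y, e))) ∂noise η

section JointPath

variable {E : Type*} {r σ : E → ℝ → ℝ}

lemma shift_jointPath_splice (n k : ℕ) (y : ℕ → E) (e e' : ℕ → ℝ) (x : ℝ) :
    shift (n + k) (jointPath r σ x (y, splice n e e')) =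
      shift k (jointPath r σ (chain r σ y e x n) (shift n y, e')) := by
  funext i
  simp only [shift, jointPath]
  rw [add_assoc, chain_splice]

lemma freeze_jointPath_splice {j n : ℕ} (hj : j ≤ n) (y : ℕ → E) (e e' : ℕ → ℝ) (x : ℝ) :
    freeze j (jointPath r σ x (y, splice n e e')) = freeze j (jointPath r σ x (y, e)) := by
  funext i
  simp only [freeze, jointPath]
  rw [chain_congr r σ x (fun _ _ => rfl) fun l hl => splice_of_lt (by omega) e e']

lemma freeze_jointPath_freeze (j : ℕ) (y : ℕ → E) (e : ℕ → ℝ) (x : ℝ) :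
    freeze j (jointPath r σ x (freeze j y, e)) = freeze j (jointPath r σ x (y, e)) := by
  funext i
  simp only [freeze, jointPath]
  rw [chain_congr r σ (y := freeze j y) (y' := y) x
    (fun l hl => by simp only [freeze]; congr 1; omega) fun _ _ => rfl]
  simp

variable [MeasurableSpace E]

lemma measurable_jointPath (hr : Measurable (Function.uncurry r))
    (hσ : Measurable (Function.uncurry σ)) :
    Measurable fun p : ℝ × (ℕ → E) × (ℕ → ℝ) => jointPath r σ p.1 p.2 :=
  measurable_pi_lambda _ fun k =>
    (Measurable.chain hr hσ measurable_snd.fst measurable_snd.snd measurable_fst k).prodMk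
      ((measurable_pi_apply k).comp measurable_snd.fst)

variable {η : Measure ℝ} [IsProbabilityMeasure η]
  (hr : Measurable (Function.uncurry r)) (hσ : Measurable (Function.uncurry σ))
include hr hσ

lemma IsUnitFun.jointPath {g : (ℕ → ℝ × E) → ℝ} (hg : IsUnitFun g) (x : ℝ) (n : ℕ) :
    IsUnitFun fun q => g (shift n (jointPath r σ x q)) :=
  hg.comp ((measurable_shift n).comp ((measurable_jointPath hr hσ).comp measurable_prodMk_left))

lemma IsUnitFun.tailMean {g : (ℕ → ℝ × E) → ℝ} (hg : IsUnitFun g) (n : ℕ) :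
    IsUnitFun fun p : (ℕ → E) × ℝ => tailMean η r σ g n p.1 p.2 := by
  have h1 : Measurable fun p : ((ℕ → E) × ℝ) × (ℕ → ℝ) => (p.1.2, p.1.1, p.2) := by fun_prop
  exact (hg.comp ((measurable_shift n).comp ((measurable_jointPath hr hσ).comp h1))).integral_prod
    (noise η)

/-- A functional of the whole future is, after `n` steps, a test function of the current position.
Estimates on `semi` thus extend from one-time functions to path functionals. -/
lemma tailMean_add {g : (ℕ → ℝ × E) → ℝ} (hg : IsUnitFun g) (n k : ℕ) (y : ℕ → E) (u : ℝ) :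
    tailMean η r σ g (n + k) y u = semi η r σ y n (tailMean η r σ g k (shift n y)) u := by
  unfold tailMean semi
  rw [integral_splice n ((hg.jointPath hr hσ u (n + k)).comp measurable_prodMk_left)]
  simp only [shift_jointPath_splice]

/-- Markov property of the joint path at time `s`. -/
lemma integral_mul_jointPath {π : Measure (ℕ → E)} [IsProbabilityMeasure π]
    {f g : (ℕ → ℝ × E) → ℝ} (hf : IsUnitFun f) (hg : IsUnitFun g) {j s : ℕ} (hjs : j ≤ s)
    (hfj : ∀ w, f (freeze j w) = f w) (x : ℝ) (n : ℕ) :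
    ∫ q, f (jointPath r σ x q) * g (shift (s + n) (jointPath r σ x q)) ∂π.prod (noise η) =
      ∫ q, f (jointPath r σ x q) *
        tailMean η r σ g n (shift s q.1) (chain r σ q.1 q.2 x s) ∂π.prod (noise η) := by
  have hfx : IsUnitFun fun q => f (jointPath r σ x q) :=
    hf.comp ((measurable_jointPath hr hσ).comp measurable_prodMk_left)
  have h1 := hfx.mul (hg.jointPath hr hσ x (s + n))
  have h2 : IsUnitFun fun q : (ℕ → E) × (ℕ → ℝ) => f (jointPath r σ x q) *
      tailMean η r σ g n (shift s q.1) (chain r σ q.1 q.2 x s) :=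
    hfx.mul ((hg.tailMean (η := η) hr hσ n).comp (φ := fun q : (ℕ → E) × (ℕ → ℝ) =>
      (shift s q.1, chain r σ q.1 q.2 x s)) (((measurable_shift s).comp measurable_fst).prodMk
        (Measurable.chain hr hσ measurable_fst measurable_snd measurable_const s)))
  rw [integral_prod _ (h1.integrable _), integral_prod _ (h2.integrable _)]
  refine integral_congr_ae (ae_of_all _ fun y => ?_)
  simp only
  rw [integral_splice s (h1.comp measurable_prodMk_left)]
  refine integral_congr_ae (ae_of_all _ fun e => ?_)
  simp only
  have h3 : ∀ e', f (jointPath r σ x (y, splice s e e')) = f (jointPath r σ x (y, e)) := by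
    intro e'
    rw [← hfj, freeze_jointPath_splice hjs, hfj]
  simp only [h3, shift_jointPath_splice]
  rw [integral_const_mul]
  rfl

variable {γ K : E → ℝ} {A : Set E} {R κ : ℝ} {L : ℕ}
  (hγ : ∀ y, 0 ≤ γ y) (hK : ∀ y, 0 ≤ K y)
  (hgrow : ∀ y x, |r y x| + |σ y x| ≤ γ y * |x| + K y)
  (hη : ∫⁻ z, ENNReal.ofReal |z| ∂η ≤ 1)
include hγ hK hgrow hη

/-- Quenched loss of memory for functionals of the future of the joint path. -/
lemma abs_tailMean_sub_le (hηac : η ≪ volume) (hσ0 : ∀ y x, σ y x ≠ 0)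
    (hR : 0 < R) (hκ : 0 ≤ κ) (hκ1 : κ ≤ 1) (hA : ∀ v ∈ A, Minorized η r σ R κ v) (hL : 1 ≤ L)
    {i n : ℕ} (hn : 2 * L * i ≤ n) {g : (ℕ → ℝ × E) → ℝ} (hg : IsUnitFun g) (y : ℕ → E)
    (u : ℝ) :
    |tailMean η r σ g n y u - tailMean η r σ g n y 0| ≤ coupErr γ K A R κ L y |u| i := by
  have hh : IsUnitFun (tailMean η r σ g 0 (shift n y)) :=
    (hg.tailMean (η := η) hr hσ 0).comp measurable_prodMk_left
  have := abs_semi_sub_le_coupErr_of_le hr hσ hγ hK hgrow hη hηac hσ0 hR hκ hκ1 hA hL y u 0 hn hh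
  simpa only [← tailMean_add hr hσ hg n 0, add_zero, abs_zero] using this

/-- Mixing of the joint path of the started chain in a mixing stationary environment. -/
theorem abs_cov_jointPath_le {π : Measure (ℕ → E)} [IsProbabilityMeasure π] {α : ℕ → ℝ}
    (hγm : Measurable γ) (hKm : Measurable K) (hAm : MeasurableSet A)
    (hηac : η ≪ volume) (hσ0 : ∀ y x, σ y x ≠ 0)
    (hR : 0 < R) (hκ : 0 ≤ κ) (hκ1 : κ ≤ 1) (hA : ∀ v ∈ A, Minorized η r σ R κ v) (hL : 1 ≤ L)
    (hstat : ∀ k, MeasurePreserving (shift k) π π) (hmix : MixBound π α) {x D : ℝ} {m q : ℕ}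
    (hm : L + 2 * L * q ≤ m) {j : ℕ}
    (hD : ∫ w, coupErr γ K A R κ L (shift (j + L) w.1) |chain r σ w.1 w.2 x (j + L)| q
      ∂π.prod (noise η) ≤ D)
    {f g : (ℕ → ℝ × E) → ℝ} (hf : IsUnitFun f) (hg : IsUnitFun g)
    (hfj : ∀ w, f (freeze j w) = f w) :
    |∫ w, f (jointPath r σ x w) * g (shift (j + m) (jointPath r σ x w)) ∂π.prod (noise η) -
      (∫ w, f (jointPath r σ x w) ∂π.prod (noise η)) *
        ∫ w, g (shift (j + m) (jointPath r σ x w)) ∂π.prod (noise η)| ≤ α L + 2 * D := by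
  obtain ⟨n, rfl⟩ : ∃ n, m = L + n := Nat.exists_eq_add_of_le (by omega)
  have hn : 2 * L * q ≤ n := by omega
  rw [← add_assoc]
  set s := j + L with hs
  -- Restarting at `0` removes the dependence on the chain, so `ψ` is a functional of the
  -- environment after `s = j + L`, separated from the past by `L`.
  set ψ := fun y : ℕ → E => tailMean η r σ g n y 0 with hψ
  have hψu : IsUnitFun ψ := (hg.tailMean (η := η) hr hσ n).comp measurable_prodMk_right
  have hchain : Measurable fun q : (ℕ → E) × (ℕ → ℝ) => chain r σ q.1 q.2 x s :=
    Measurable.chain hr hσ measurable_fst measurable_snd measurable_const s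
  have hSu : IsUnitFun fun w : (ℕ → E) × (ℕ → ℝ) =>
      coupErr γ K A R κ L (shift s w.1) |chain r σ w.1 w.2 x s| q :=
    isUnitFun_coupErr hr hσ hγ hK hγm hKm hAm hR hκ hκ1 s x q
  have happrox : ∀ f : (ℕ → ℝ × E) → ℝ, IsUnitFun f → (∀ w, f (freeze j w) = f w) →
      |∫ w, f (jointPath r σ x w) * g (shift (s + n) (jointPath r σ x w)) ∂π.prod (noise η) -
        ∫ w, f (jointPath r σ x w) * ψ (shift s w.1) ∂π.prod (noise η)| ≤ D := by
    intro f hf hfj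
    have hfx : IsUnitFun fun q => f (jointPath r σ x q) :=
      hf.comp ((measurable_jointPath hr hσ).comp measurable_prodMk_left)
    have h1 := hfx.mul ((hg.tailMean (η := η) hr hσ n).comp
      (φ := fun q : (ℕ → E) × (ℕ → ℝ) => (shift s q.1, chain r σ q.1 q.2 x s))
      (((measurable_shift s).comp measurable_fst).prodMk hchain))
    have h2 := hfx.mul (hψu.comp (φ := fun w : (ℕ → E) × (ℕ → ℝ) => shift s w.1) (by fun_prop))
    rw [integral_mul_jointPath hr hσ hf hg (by omega) hfj x n,
      ← integral_sub (h1.integrable _) (h2.integrable _)]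
    have hb : ∀ w : (ℕ → E) × (ℕ → ℝ), ‖f (jointPath r σ x w) *
        tailMean η r σ g n (shift s w.1) (chain r σ w.1 w.2 x s) -
        f (jointPath r σ x w) * ψ (shift s w.1)‖ ≤
        coupErr γ K A R κ L (shift s w.1) |chain r σ w.1 w.2 x s| q := by
      intro w
      rw [Real.norm_eq_abs, ← mul_sub, abs_mul, abs_of_nonneg (hf.nonneg _)]
      exact (mul_le_of_le_one_left (abs_nonneg _) (hf.le_one _)).trans
        (abs_tailMean_sub_le hr hσ hγ hK hgrow hη hηac hσ0 hR hκ hκ1 hA hL hn hg _ _)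
    exact (norm_integral_le_of_norm_le (hSu.integrable _) (ae_of_all _ hb)).trans hD
  have hfx : IsUnitFun fun q => f (jointPath r σ x q) :=
    hf.comp ((measurable_jointPath hr hσ).comp measurable_prodMk_left)
  have h1 := happrox f hf hfj
  -- The constant past functional compares the unconditional means of `g` and `ψ`.
  have h2 := happrox (fun _ => 1) ⟨measurable_const, fun _ => zero_le_one, fun _ => le_rfl⟩
    fun _ => rfl
  have h3 := hmix.prod (noise η) (n := L) (j := j) hfx hψu fun y e => by
    rw [← hfj, freeze_jointPath_freeze, hfj]
  have h4 : ∫ w, ψ (shift s (Prod.fst w)) ∂π.prod (noise η) = ∫ y, ψ y ∂π := by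
    have hg : IsUnitFun fun w : (ℕ → E) × (ℕ → ℝ) => ψ (shift s w.1) := hψu.comp (by fun_prop)
    rw [integral_prod _ (hg.integrable _)]
    simp only [integral_const, probReal_univ, one_smul]
    rw [← (hstat s).map_eq, integral_map (hstat s).measurable.aemeasurable
      hψu.measurable.aestronglyMeasurable, (hstat s).map_eq]
  simp only [one_mul] at h2
  rw [h4] at h2
  have hF0 := hfx.integral_nonneg (π.prod (noise η))
  have hF1 := hfx.integral_le_one (π.prod (noise η))
  set F := ∫ w, f (jointPath r σ x w) ∂π.prod (noise η)
  have h5 : |F * ∫ y, ψ y ∂π - F * ∫ w, g (shift (s + n) (jointPath r σ x w)) ∂π.prod (noise η)|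
      ≤ D := by
    rw [← mul_sub, abs_mul, abs_of_nonneg hF0, abs_sub_comm]
    exact (mul_le_of_le_one_left (abs_nonneg _) hF1).trans h2
  rw [abs_le] at *
  constructor <;> linarith [h1.1, h1.2, h3.1, h3.2, h5.1, h5.2]

end JointPath

/-! ### Minorization from a density bounded below on compacts -/

section SmallSet

variable {E : Type*} {r σ : E → ℝ → ℝ} {f : ℝ → ℝ}

/-- A lower bound on the density of the noise and two-sided bounds on the scale give a uniform
component of the one-step law. -/
lemma le_integral_of_density_le (hf : Measurable f) (hf0 : ∀ z, 0 ≤ f z)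
    [IsProbabilityMeasure (volume.withDensity fun z => ENNReal.ofReal (f z))]
    {ρ s B b c : ℝ} (hs0 : 0 < b) (hbs : b ≤ s) (hsB : s ≤ B) (hρ : |ρ| ≤ B) (hc : 0 ≤ c)
    (hfc : ∀ z ∈ Set.Icc (-((1 + B) / b)) ((1 + B) / b), c ≤ f z) {h : ℝ → ℝ} (hh : IsUnitFun h) :
    c / B * ∫ u in Set.Icc (0 : ℝ) 1, h u ≤
      ∫ z, h (ρ + z * s) ∂(volume.withDensity fun z => ENNReal.ofReal (f z)) := by
  have hs : 0 < s := hs0.trans_le hbs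
  have hB : 0 < B := hs.trans_le hsB
  set k := (Set.Icc (0 : ℝ) 1).indicator h with hk
  have hk0 : ∀ u, 0 ≤ k u := fun u => Set.indicator_nonneg (fun u _ => hh.nonneg u) u
  -- Lebesgue measure scales by `s⁻¹`, which is at least `B⁻¹`; this is the origin of the constant
  -- `c / B`.
  have hcomp := Measure.integral_comp_mul_right (fun u => k (ρ + u)) s
  rw [integral_add_left_eq_self k ρ, abs_of_pos (inv_pos.2 hs), smul_eq_mul] at hcomp
  have hint : ∫ u, k u = ∫ u in Set.Icc (0 : ℝ) 1, h u := integral_indicator measurableSet_Icc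
  have hI0 : 0 ≤ ∫ u, k u := integral_nonneg hk0
  have hhi : Integrable (fun z => f z * h (ρ + z * s)) := by
    have h1 := (hh.comp (φ := fun z => ρ + z * s) (by fun_prop)).integrable
      (volume.withDensity fun z => ENNReal.ofReal (f z))
    rw [integrable_withDensity_iff hf.ennreal_ofReal (ae_of_all _ fun _ => ENNReal.ofReal_lt_top)]
      at h1
    refine h1.congr (ae_of_all _ fun z => ?_)
    simp only [ENNReal.toReal_ofReal (hf0 z)]
    ring
  rw [integral_withDensity_eq_integral_toReal_smul hf.ennreal_ofReal
    (ae_of_all _ fun _ => ENNReal.ofReal_lt_top), ← hint]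
  simp only [ENNReal.toReal_ofReal (hf0 _), smul_eq_mul]
  calc c / B * ∫ u, k u ≤ c * (s⁻¹ * ∫ u, k u) := by
        rw [div_eq_mul_inv, mul_assoc]
        gcongr
    _ = ∫ z, c * k (ρ + z * s) := by rw [integral_const_mul, hcomp]
    _ ≤ ∫ z, f z * h (ρ + z * s) := by
        refine integral_mono_of_nonneg (ae_of_all _ fun z => mul_nonneg hc (hk0 _)) hhi
          (ae_of_all _ fun z => ?_)
        simp only
        by_cases hz : ρ + z * s ∈ Set.Icc (0 : ℝ) 1
        · rw [hk, Set.indicator_of_mem hz]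
          refine mul_le_mul_of_nonneg_right (hfc z ?_) (hh.nonneg _)
          have h1 := abs_le.1 hρ
          -- Innovations that send the chain into `[0, 1]` are bounded by `(1 + B) / b`, so the
          -- density is at least `c` there.
          have h2 : |z| ≤ (1 + B) / b := by
            rw [le_div_iff₀ hs0]
            refine (mul_le_mul_of_nonneg_left hbs (abs_nonneg z)).trans ?_
            have : |z| * s = |z * s| := by rw [abs_mul, abs_of_pos hs]
            rw [this, abs_le]
            constructor <;> linarith [hz.1, hz.2]
          exact abs_le.1 h2
        · rw [hk, Set.indicator_of_notMem hz, mul_zero]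
          exact mul_nonneg (hf0 _) (hh.nonneg _)

variable [MeasurableSpace E]

/-- Environment states outside a set of small probability are minorized, uniformly. -/
theorem exists_minorized (hf : Measurable f) (hf0 : ∀ z, 0 ≤ f z)
    [IsProbabilityMeasure (volume.withDensity fun z => ENNReal.ofReal (f z))]
    (hfpos : ∀ u v : ℝ, ∃ δ > 0, ∀ z ∈ Set.Icc u v, δ ≤ f z)
    (hσ : Measurable (Function.uncurry σ)) {γ K : E → ℝ}
    (hγm : Measurable γ) (hKm : Measurable K)
    (hgrow : ∀ y x, |r y x| + |σ y x| ≤ γ y * |x| + K y)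
    (hσpos : ∀ R > 0, ∀ y, ∃ δ > 0, ∀ x, |x| ≤ R → δ ≤ σ y x)
    (ν : Measure E) [IsProbabilityMeasure ν] {R : ℝ} (hR : 0 < R) :
    ∃ (A : Set E) (κ : ℝ), MeasurableSet A ∧ 0 < κ ∧ κ ≤ 1 ∧ 3 / 4 ≤ ν.real A ∧
      ∀ v ∈ A, Minorized (volume.withDensity fun z => ENNReal.ofReal (f z)) r σ R κ v := by
  -- The infimum of `σ` over the uncountable interval `[-R, R]` need not be measurable in the
  -- environment state. Requiring a null section of `T n` is a measurable condition, at the price of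
  -- a minorization for almost every `x` only.
  set T : ℕ → Set (E × ℝ) := fun n => {p | |p.2| ≤ R ∧ σ p.1 p.2 < 1 / ((n : ℝ) + 1)} with hT
  have hTm : ∀ n, MeasurableSet (T n) := fun n =>
    (measurableSet_le measurable_snd.abs measurable_const).inter
      (measurableSet_lt hσ measurable_const)
  set A : ℕ → Set E := fun n => {v | γ v ≤ n ∧ K v ≤ n ∧ volume (Prod.mk v ⁻¹' T n) = 0} with hA
  have hAm : ∀ n, MeasurableSet (A n) := fun n =>
    (measurableSet_le hγm measurable_const).inter ((measurableSet_le hKm measurable_const).inter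
      (measurable_measure_prodMk_left (hTm n) (measurableSet_singleton 0)))
  have hTanti : ∀ {m n : ℕ}, m ≤ n → T n ⊆ T m := by
    intro m n hmn p hp
    refine ⟨hp.1, hp.2.trans_le ?_⟩
    gcongr
  have hAmono : Monotone A := by
    intro m n hmn v hv
    have : (m : ℝ) ≤ n := by exact_mod_cast hmn
    exact ⟨hv.1.trans this, hv.2.1.trans this,
      measure_mono_null (Set.preimage_mono (hTanti hmn)) hv.2.2⟩
  have hAun : ⋃ n, A n = Set.univ := by
    refine Set.eq_univ_of_forall fun v => Set.mem_iUnion.2 ?_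
    obtain ⟨δ, hδ, hδσ⟩ := hσpos R hR v
    obtain ⟨n1, hn1⟩ := exists_nat_ge (γ v)
    obtain ⟨n2, hn2⟩ := exists_nat_ge (K v)
    obtain ⟨n3, hn3⟩ := exists_nat_one_div_lt hδ
    refine ⟨max n1 (max n2 n3), hn1.trans (by simp), hn2.trans (by simp), ?_⟩
    refine measure_mono_null (t := ∅) (fun x hx => ?_) measure_empty
    have h1 : x ∈ Prod.mk v ⁻¹' T n3 := hTanti (by simp) hx
    exact absurd (hδσ x h1.1) (not_le.2 (lt_trans h1.2 hn3))
  have hlim : Tendsto (fun n => ν.real (A n)) atTop (𝓝 1) := by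
    have := tendsto_measure_iUnion_atTop (μ := ν) hAmono
    rw [hAun, measure_univ] at this
    exact (ENNReal.tendsto_toReal ENNReal.one_ne_top).comp this
  obtain ⟨n, hn1, hn2⟩ := ((hlim.eventually_const_le (u := 3 / 4) (by norm_num)).and
    (eventually_ge_atTop 1)).exists
  set B : ℝ := n * R + n with hB
  have hn0 : (1 : ℝ) ≤ n := by exact_mod_cast hn2
  have hB0 : 0 < B := by positivity
  set b : ℝ := 1 / ((n : ℝ) + 1) with hb
  have hb0 : 0 < b := by positivity
  obtain ⟨c, hc, hfc⟩ := hfpos (-((1 + B) / b)) ((1 + B) / b)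
  refine ⟨A n, min 1 (c / B), hAm n, lt_min one_pos (by positivity), min_le_left _ _, hn1,
    fun v hv => ?_⟩
  have hae : ∀ᵐ x : ℝ, x ∉ Prod.mk v ⁻¹' T n := measure_eq_zero_iff_ae_notMem.1 hv.2.2
  filter_upwards [hae] with x hx hxR h hh
  have hσx : b ≤ σ v x := by
    by_contra hlt
    exact hx ⟨hxR, not_le.1 hlt⟩
  have hbound : |r v x| + |σ v x| ≤ B := by
    refine (hgrow v x).trans (add_le_add ?_ hv.2.1)
    exact mul_le_mul hv.1 hxR (abs_nonneg _) (by positivity)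
  have h0 : 0 ≤ ∫ u in Set.Icc (0 : ℝ) 1, h u := hh.integral_nonneg _
  refine (mul_le_mul_of_nonneg_right (min_le_right _ _) h0).trans ?_
  exact le_integral_of_density_le hf hf0 hb0 hσx
    ((le_abs_self _).trans (by linarith [abs_nonneg (r v x)]))
    (by linarith [abs_nonneg (σ v x)]) hc.le hfc hh

end SmallSet

/-! ### Drift, good blocks and contraction in a stationary environment -/

section Environment

variable {E : Type*} [MeasurableSpace E] {γ K : E → ℝ} {π : Measure (ℕ → E)}

lemma MeasureTheory.MeasurePreserving.lintegral_shift {S : Type*} [MeasurableSpace S]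
    {π : Measure (ℕ → S)} {k : ℕ} (h : MeasurePreserving (shift k) π π)
    {F : (ℕ → S) → ENNReal} (hF : Measurable F) : ∫⁻ y, F (shift k y) ∂π = ∫⁻ y, F y ∂π :=
  h.lintegral_comp hF

/-- Expansion of the expected contracted drift along the ages of its terms. -/
lemma lintegral_accum_mul_prodCoef (hγ : ∀ y, 0 ≤ γ y) (hK : ∀ y, 0 ≤ K y) (hγm : Measurable γ)
    (hKm : Measurable K) (hstat : ∀ k, MeasurePreserving (shift k) π π) (s L : ℕ) :
    ∫⁻ y, ENNReal.ofReal (accum γ K y s * prodCoef γ (shift s y) L) ∂π =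
      ∑ i ∈ Finset.range s,
        ∫⁻ y, ENNReal.ofReal (K (y 0) * prodCoef γ (shift 1 y) (L + i)) ∂π := by
  induction s generalizing L with
  | zero => simp [accum]
  | succ s ih =>
    have hp := fun y n => prodCoef_nonneg hγ y n
    have ha := fun y n => accum_nonneg hγ hK y n
    have hm1 : ∀ k l, Measurable fun y : ℕ → E => prodCoef γ (shift k y) l := fun k l =>
      (measurable_prodCoef hγm l).comp (measurable_shift k)
    have hm2 := measurable_accum (γ := γ) (K := K) hγm hKm s
    have hm3 : ∀ k, Measurable fun y : ℕ → E => K (y k) := fun k => hKm.comp (measurable_pi_apply k)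
    have hsplit : ∀ y, ENNReal.ofReal (accum γ K y (s + 1) * prodCoef γ (shift (s + 1) y) L) =
        ENNReal.ofReal (accum γ K y s * prodCoef γ (shift s y) (L + 1)) +
        ENNReal.ofReal (K (shift s y 0) * prodCoef γ (shift 1 (shift s y)) L) := by
      intro y
      rw [← ENNReal.ofReal_add (mul_nonneg (ha _ _) (hp _ _)) (mul_nonneg (hK _) (hp _ _)),
        add_comm L 1, prodCoef_add γ (shift s y) 1 L, shift_shift]
      simp only [accum, prodCoef, Finset.prod_range_one, shift, add_zero]
      congr 1; ring
    simp only [hsplit]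
    have hm4 := hm1 s (L + 1)
    have hm5 : Measurable fun y : ℕ → E => ENNReal.ofReal (K (y 0) * prodCoef γ (shift 1 y) L) :=
      ((hm3 0).mul (hm1 1 L)).ennreal_ofReal
    rw [lintegral_add_left (by fun_prop), ih, (hstat s).lintegral_shift hm5,
      Finset.sum_range_succ', add_zero]
    congr 1
    exact Finset.sum_congr rfl fun i _ => by rw [add_right_comm, add_assoc]

/-- After `L` further contractions every drift term has age at least `L`, so a tail of the series
bounds the sum uniformly in `s`. -/
lemma lintegral_accum_mul_prodCoef_le (hγ : ∀ y, 0 ≤ γ y) (hK : ∀ y, 0 ≤ K y)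
    (hγm : Measurable γ) (hKm : Measurable K) (hstat : ∀ k, MeasurePreserving (shift k) π π)
    {c : ℕ → ℝ} (hc0 : ∀ l, 0 ≤ c l) (hcs : Summable c)
    (hc : ∀ l, ∫⁻ y, ENNReal.ofReal (K (y 0) * prodCoef γ (shift 1 y) l) ∂π ≤
      ENNReal.ofReal (c l)) (s L : ℕ) :
    ∫⁻ y, ENNReal.ofReal (accum γ K y s * prodCoef γ (shift s y) L) ∂π ≤
      ENNReal.ofReal (∑' i, c (L + i)) := by
  rw [lintegral_accum_mul_prodCoef hγ hK hγm hKm hstat]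
  refine (Finset.sum_le_sum fun i _ => hc (L + i)).trans ?_
  rw [← ENNReal.ofReal_sum_of_nonneg fun i _ => hc0 _]
  refine ENNReal.ofReal_le_ofReal (Summable.sum_le_tsum _ (fun i _ => hc0 _) ?_)
  exact hcs.comp_injective (add_right_injective L)

/-- Under a uniform bound on the expected accumulated drift, good blocks have probability at
least `1 / 2`. -/
lemma half_le_measureReal_goodSet [IsProbabilityMeasure π] (hγ : ∀ y, 0 ≤ γ y)
    (hK : ∀ y, 0 ≤ K y) (hγm : Measurable γ)
    (hKm : Measurable K) (hstat : ∀ k, MeasurePreserving (shift k) π π) {C R : ℝ} (hC : 0 ≤ C)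
    (hZ : ∀ t, ∫⁻ y, ENNReal.ofReal (accum γ K y t) ∂π ≤ ENNReal.ofReal C)
    (hR : 16 * C + 1 ≤ R) {A : Set E} (hA : MeasurableSet A)
    (hAp : 3 / 4 ≤ (π.map fun y => y 0).real A) (L : ℕ) :
    1 / 2 ≤ π.real (goodSet γ K A R L) := by
  set U : Set (ℕ → E) := {y | R / 4 ≤ accum γ K y L} with hU
  have ha : Measurable fun y : ℕ → E => accum γ K y L := measurable_accum hγm hKm L
  -- Markov's inequality gives `4 * C / R ≤ 1 / 4`, which explains the constant `16`; then `3 / 4 -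
  -- 1 / 4 = 1 / 2`.
  have hUp : π.real U ≤ 1 / 4 := by
    have h1 := mul_meas_ge_le_lintegral (μ := π) ha.ennreal_ofReal (ENNReal.ofReal (R / 4))
    have h2 : {y | ENNReal.ofReal (R / 4) ≤ ENNReal.ofReal (accum γ K y L)} = U := by
      ext y
      exact ENNReal.ofReal_le_ofReal_iff (accum_nonneg hγ hK y L)
    rw [h2] at h1
    have h3 := ENNReal.toReal_mono ENNReal.ofReal_ne_top (h1.trans (hZ L))
    rw [ENNReal.toReal_mul, ENNReal.toReal_ofReal (by linarith), ENNReal.toReal_ofReal hC] at h3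
    change R / 4 * π.real U ≤ C at h3
    by_contra hlt
    push Not at hlt
    nlinarith
  have hAL : π.real ((fun y => y L) ⁻¹' A) = (π.map fun y => y 0).real A := by
    rw [map_measureReal_apply (measurable_pi_apply 0) hA]
    have h1 : (fun y : ℕ → E => y L) ⁻¹' A = shift L ⁻¹' ((fun y : ℕ → E => y 0) ⁻¹' A) := rfl
    rw [h1]
    exact (hstat L).measureReal_preimage (hA.preimage (measurable_pi_apply 0)).nullMeasurableSet
  have hsub : (fun y : ℕ → E => y L) ⁻¹' A ⊆ goodSet γ K A R L ∪ U := by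
    intro y hy
    by_cases h : accum γ K y L ≤ R / 4
    · exact Or.inl ⟨h, hy⟩
    · exact Or.inr (not_le.1 h).le
  have h1 := measureReal_mono (μ := π) hsub
  have h2 := measureReal_union_le (μ := π) (goodSet γ K A R L) U
  linarith

variable [IsProbabilityMeasure π]

/-- In a mixing environment, contraction coefficients that are not almost surely `1` have products
that decay in mean. -/
lemma lintegral_prodCoef_le (hγ : ∀ y, 0 ≤ γ y) (hγm : Measurable γ)
    {α : ℕ → ℝ} (hmix : MixBound π α)
    (hγ1 : ∀ᵐ y ∂π, ∀ n, γ (y n) ≤ 1) {ρ : ℝ} (hρ : ∫ y, min 1 (γ (y 0)) ∂π ≤ ρ) (hρ1 : ρ < 1)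
    {l q g : ℕ} (hg : 1 ≤ g) (hqg : q * g ≤ l) :
    ∫⁻ y, ENNReal.ofReal (prodCoef γ y l) ∂π ≤ ENNReal.ofReal (ρ ^ q + α g / (1 - ρ)) := by
  set γ' : E → ℝ := fun v => min 1 (γ v) with hγ'
  have hγ'u : IsUnitFun γ' := ⟨measurable_const.min hγm, fun v => le_min zero_le_one (hγ v),
    fun v => min_le_left _ _⟩
  have hγ'n : ∀ n, IsUnitFun fun y : ℕ → E => γ' (y n) := fun n =>
    hγ'u.comp (measurable_pi_apply n)
  have hρ0 : 0 ≤ ρ := ((hγ'n 0).integral_nonneg π).trans hρ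
  -- Only every `g`-th factor is kept; the discarded ones are at most `1`. The kept factors are `g`
  -- apart, so each multiplies the mean by at most `ρ` up to an error `α g`.
  set F : ℕ → (ℕ → E) → ℝ := fun q y => ∏ i ∈ Finset.range q, γ' (y (i * g)) with hF
  have hFs : ∀ q y, F (q + 1) y = F q y * γ' (y (q * g)) := fun q y => Finset.prod_range_succ _ _
  have hFu : ∀ q, IsUnitFun (F q) := by
    intro q
    induction q with
    | zero => exact ⟨by simp [hF], fun y => by simp [hF], fun y => by simp [hF]⟩
    | succ q ih =>
      have := ih.mul (hγ'n (q * g))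
      simp only [← hFs] at this
      exact this
  have hlint : ∀ q, q * g ≤ l → ∀ y, prodCoef γ' y l ≤ F q y := by
    have hle : ∀ y n, prodCoef γ' y n ≤ 1 := fun y n =>
      Finset.prod_le_one (fun _ _ => hγ'u.nonneg _) fun _ _ => hγ'u.le_one _
    have hmul : ∀ q y, prodCoef γ' y (q * g) ≤ F q y := by
      intro q y
      induction q with
      | zero => simp [hF]
      | succ q ih =>
        rw [hFs, add_mul, one_mul, prodCoef_add]
        refine mul_le_mul ih ?_ (prodCoef_nonneg hγ'u.nonneg _ _) ((hFu q).nonneg _)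
        obtain ⟨g', rfl⟩ : ∃ g', g = 1 + g' := Nat.exists_eq_add_of_le hg
        rw [prodCoef_add]
        refine (mul_le_of_le_one_right (prodCoef_nonneg hγ'u.nonneg _ _) (hle _ _)).trans_eq ?_
        simp [prodCoef, shift]
    intro q hq y
    obtain ⟨l', rfl⟩ := Nat.exists_eq_add_of_le hq
    rw [prodCoef_add]
    exact (mul_le_of_le_one_right (prodCoef_nonneg hγ'u.nonneg _ _) (hle _ _)).trans (hmul q y)
  have hα := hmix.nonneg g
  have hD : ∀ q, ∫ y, F q y ∂π ≤ ρ ^ q + α g / (1 - ρ) := by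
    refine le_geom_of_succ_le hρ0 (by linarith) (by linarith) hα (by simp [hF]) fun q => ?_
    have hcov : |∫ y, F q y * γ' (y (q * g)) ∂π - (∫ y, F q y ∂π) * ∫ y, γ' (y 0) ∂π| ≤ α g := by
      cases q with
      | zero => simpa [hF] using hα
      | succ q =>
        have := hmix g (q * g) (F (q + 1)) (fun y => γ' (y 0)) (hFu _) (hγ'n 0) fun y => by
          refine Finset.prod_congr rfl fun i hi => ?_
          have : i * g ≤ q * g :=
            Nat.mul_le_mul_right g (Nat.lt_succ_iff.1 (Finset.mem_range.1 hi))
          simp only [freeze, min_eq_left this]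
        simpa only [shift_apply, add_zero, add_mul, one_mul] using this
    simp only [hFs]
    have h1 := mul_le_mul_of_nonneg_left hρ ((hFu q).integral_nonneg π)
    have h2 := (abs_le.1 hcov).2
    linarith
  calc ∫⁻ y, ENNReal.ofReal (prodCoef γ y l) ∂π ≤ ∫⁻ y, ENNReal.ofReal (F q y) ∂π := by
        refine lintegral_mono_ae ?_
        filter_upwards [hγ1] with y hy
        refine ENNReal.ofReal_le_ofReal (le_trans (le_of_eq ?_) (hlint q hqg y))
        exact Finset.prod_congr rfl fun i _ => (min_eq_right (hy i)).symm
    _ = ENNReal.ofReal (∫ y, F q y ∂π) :=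
        (ofReal_integral_eq_lintegral_ofReal ((hFu q).integrable π)
          (ae_of_all _ (hFu q).nonneg)).symm
    _ ≤ _ := ENNReal.ofReal_le_ofReal (hD q)

omit [IsProbabilityMeasure π] in
/-- Hölder bound for a drift term contracted `l` times. -/
lemma lintegral_mul_prodCoef_le (hγ : ∀ y, 0 ≤ γ y) (hK : ∀ y, 0 ≤ K y) (hγm : Measurable γ)
    (hKm : Measurable K) (hstat : ∀ k, MeasurePreserving (shift k) π π)
    (hγ1 : ∀ᵐ y ∂π, ∀ n, γ (y n) ≤ 1) {k : ℝ} (hk : 1 < k)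
    (hKk : Integrable (fun y : ℕ → E => K (y 0) ^ k) π) {l : ℕ} {p : ℝ} (hp0 : 0 ≤ p)
    (hp : ∫⁻ y, ENNReal.ofReal (prodCoef γ y l) ∂π ≤ ENNReal.ofReal p) :
    ∫⁻ y, ENNReal.ofReal (K (y 0) * prodCoef γ (shift 1 y) l) ∂π ≤
      ENNReal.ofReal ((∫ y, K (y 0) ^ k ∂π) ^ (1 / k) * p ^ ((k - 1) / k)) := by
  have hk0 : 0 < k := by linarith
  have hconj : k.HolderConjugate (k / (k - 1)) := Real.HolderConjugate.conjExponent hk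
  have hq1 : 1 ≤ k / (k - 1) := by rw [one_le_div (by linarith)]; linarith
  have hm1 : Measurable fun y : ℕ → E => K (y 0) := hKm.comp (measurable_pi_apply 0)
  have hm2 : Measurable fun y : ℕ → E => prodCoef γ (shift 1 y) l :=
    (measurable_prodCoef hγm l).comp (measurable_shift 1)
  have hholder := ENNReal.lintegral_mul_le_Lp_mul_Lq π hconj hm1.ennreal_ofReal.aemeasurable
    hm2.ennreal_ofReal.aemeasurable
  have hI0 : 0 ≤ ∫ y, K (y 0) ^ k ∂π := integral_nonneg fun y => Real.rpow_nonneg (hK _) _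
  have h1 : ∫⁻ y, ENNReal.ofReal (K (y 0)) ^ k ∂π = ENNReal.ofReal (∫ y, K (y 0) ^ k ∂π) := by
    rw [ofReal_integral_eq_lintegral_ofReal hKk
      (ae_of_all _ fun y => Real.rpow_nonneg (hK _) _)]
    exact lintegral_congr fun y => ENNReal.ofReal_rpow_of_nonneg (hK _) hk0.le
  -- The product lies almost surely in `[0, 1]` and the conjugate exponent is at least `1`, so the
  -- power is bounded by the product itself.
  have h2 : ∫⁻ y, ENNReal.ofReal (prodCoef γ (shift 1 y) l) ^ (k / (k - 1)) ∂π ≤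
      ENNReal.ofReal p := by
    refine le_trans ?_ hp
    rw [← (hstat 1).lintegral_shift (measurable_prodCoef hγm l).ennreal_ofReal]
    refine lintegral_mono_ae ?_
    filter_upwards [hγ1] with y hy
    have hle : prodCoef γ (shift 1 y) l ≤ 1 :=
      Finset.prod_le_one (fun _ _ => hγ _) fun i _ => hy _
    rw [ENNReal.ofReal_rpow_of_nonneg (prodCoef_nonneg hγ _ _) (by linarith)]
    refine ENNReal.ofReal_le_ofReal ?_
    exact (Real.rpow_le_rpow_of_exponent_ge' (prodCoef_nonneg hγ _ _) hle zero_le_one hq1).trans_eq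
      (Real.rpow_one _)
  simp only [Pi.mul_apply] at hholder
  calc _ = ∫⁻ y, ENNReal.ofReal (K (y 0)) * ENNReal.ofReal (prodCoef γ (shift 1 y) l) ∂π :=
        lintegral_congr fun y => ENNReal.ofReal_mul (hK _)
    _ ≤ _ := hholder
    _ ≤ ENNReal.ofReal (∫ y, K (y 0) ^ k ∂π) ^ (1 / k) *
          ENNReal.ofReal p ^ (1 / (k / (k - 1))) := by
        rw [h1]
        gcongr
    _ = _ := by
        rw [one_div_div, ENNReal.ofReal_rpow_of_nonneg hI0 (by positivity),
          ENNReal.ofReal_rpow_of_nonneg hp0 (div_nonneg (by linarith) hk0.le),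
          ← ENNReal.ofReal_mul (Real.rpow_nonneg hI0 _)]

end Environment

/-! ### Optimization of the blocks and tails of series -/

section Rates

lemma eventually_log_le_mul {ε : ℝ} (hε : 0 < ε) : ∀ᶠ m : ℕ in atTop, Real.log m ≤ ε * m := by
  have h := (Real.isLittleO_log_id_atTop.comp_tendsto
    (tendsto_natCast_atTop_atTop (R := ℝ))).bound hε
  filter_upwards [h, eventually_ge_atTop 1] with m hm hm1
  have hlog : 0 ≤ Real.log m := Real.log_nonneg (by exact_mod_cast hm1)
  simpa [abs_of_nonneg hlog] using hm

lemma eventually_le_log (B : ℝ) : ∀ᶠ m : ℕ in atTop, B ≤ Real.log m :=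
  (Real.tendsto_log_atTop.comp tendsto_natCast_atTop_atTop).eventually_ge_atTop B

/-- Logarithmically many blocks, of length almost linear, inside `m` steps. -/
lemma exists_blocks {ρ β : ℝ} (hρ0 : 0 ≤ ρ) (hρ1 : ρ < 1) (hβ : 0 < β) :
    ∃ c > 0, ∀ N : ℕ, ∀ᶠ m : ℕ in atTop, ∃ q L : ℕ, 1 ≤ q ∧ N ≤ L ∧ 3 * q * L ≤ m ∧
      ρ ^ q ≤ (m : ℝ) ^ (-β) ∧ c * (m / Real.log m) ≤ L := by
  -- Keeps the logarithm finite and nonzero when `ρ = 0`.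
  set ρ' := max ρ (1 / 2) with hρ'
  have hρ'0 : 0 < ρ' := lt_max_of_lt_right (by norm_num)
  have hρ'1 : ρ' < 1 := max_lt hρ1 (by norm_num)
  have hlogρ : Real.log ρ' < 0 := Real.log_neg hρ'0 hρ'1
  -- Chosen so that `ρ' ^ (B * log m) = m ^ (-β)`; the number of blocks is `B * log m` rounded up.
  set B := β / (-Real.log ρ') with hB
  have hB0 : 0 < B := div_pos hβ (by linarith)
  refine ⟨1 / (12 * B), by positivity, fun N => ?_⟩
  filter_upwards [eventually_log_le_mul (ε := 1 / (12 * B)) (by positivity),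
    eventually_log_le_mul (ε := 1 / (12 * B * (N + 1))) (by positivity),
    eventually_le_log (1 / B), eventually_ge_atTop 1] with m h1 h2 h3 hm1
  have hm0 : (0 : ℝ) < m := by exact_mod_cast hm1
  have hlog : 0 < Real.log m := lt_of_lt_of_le (by positivity) h3
  have hBlog : 1 ≤ B * Real.log m := by
    have := mul_le_mul_of_nonneg_left h3 hB0.le
    rwa [mul_one_div_cancel hB0.ne'] at this
  set q := ⌈B * Real.log m⌉₊ with hq
  have hq1 : B * Real.log m ≤ q := Nat.le_ceil _
  have hq2 : (q : ℝ) ≤ 2 * (B * Real.log m) := by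
    have := (Nat.ceil_lt_add_one (by positivity : 0 ≤ B * Real.log m)).le
    linarith
  have hqpos : 0 < q := by
    have : (0 : ℝ) < q := by linarith
    exact_mod_cast this
  have hL : 1 / (12 * B) * (m / Real.log m) ≤ ((m / (3 * q) : ℕ) : ℝ) := by
    have h4 : (m : ℝ) / (3 * q) - 1 ≤ ((m / (3 * q) : ℕ) : ℝ) := by
      have := Nat.lt_floor_add_one ((m : ℝ) / ((3 * q : ℕ) : ℝ))
      rw [Nat.floor_div_eq_div] at this
      push_cast at this
      linarith
    have h5 : (m : ℝ) / (3 * (2 * (B * Real.log m))) ≤ m / (3 * q) := by gcongr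
    have h6 : (m : ℝ) / (3 * (2 * (B * Real.log m))) = 2 * (1 / (12 * B) * (m / Real.log m)) := by
      field_simp; ring
    have h7 : 1 ≤ 1 / (12 * B) * (m / Real.log m) := by
      rw [← mul_div_assoc, one_le_div hlog]; exact h1
    linarith
  -- The factor `3` makes room for `q` blocks of length `2 * L` and an initial waiting time `L`, as
  -- `q ≥ 1`.
  refine ⟨q, m / (3 * q), hqpos, ?_, Nat.mul_div_le m (3 * q), ?_, hL⟩
  · have h8 : (N : ℝ) ≤ 1 / (12 * B) * (m / Real.log m) := by
      rw [← mul_div_assoc, le_div_iff₀ hlog]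
      calc (N : ℝ) * Real.log m ≤ N * (1 / (12 * B * (N + 1)) * m) := by gcongr
        _ = (N / (N + 1)) * (1 / (12 * B) * m) := by field_simp
        _ ≤ 1 * (1 / (12 * B) * m) := by
            gcongr
            rw [div_le_one (by positivity)]; linarith
        _ = _ := one_mul _
    exact_mod_cast h8.trans hL
  · calc ρ ^ q ≤ ρ' ^ q := pow_le_pow_left₀ hρ0 (le_max_left _ _) q
      _ = ρ' ^ (q : ℝ) := (Real.rpow_natCast _ _).symm
      _ ≤ ρ' ^ (B * Real.log m) := Real.rpow_le_rpow_of_exponent_ge hρ'0 hρ'1.le hq1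
      _ = (m : ℝ) ^ (-β) := by
          rw [Real.rpow_def_of_pos hρ'0, Real.rpow_def_of_pos hm0, hB]
          congr 1
          field_simp
          rw [div_self hlogρ.ne]

/-- Rate obtained by optimizing the number and the length of the blocks. -/
theorem exists_blocks_rate {ρ β δ C₀ : ℝ} (hρ0 : 0 ≤ ρ) (hρ1 : ρ < 1) (hβ : 0 < β)
    (hδ : 0 ≤ δ) {e : ℕ → ℝ}
    (he : ∀ᶠ L : ℕ in atTop, e L ≤ C₀ * ((Real.log L) ^ δ * (L : ℝ) ^ (-β))) :
    ∃ C, 0 ≤ C ∧ ∀ᶠ m : ℕ in atTop, ∃ q L : ℕ, 1 ≤ q ∧ 1 ≤ L ∧ 3 * q * L ≤ m ∧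
      ρ ^ q + e L ≤ C * ((Real.log m) ^ (β + δ) * (m : ℝ) ^ (-β)) := by
  obtain ⟨c, hc, hblocks⟩ := exists_blocks hρ0 hρ1 hβ
  obtain ⟨N, hN⟩ := eventually_atTop.1 he
  refine ⟨1 + |C₀| * c ^ (-β), by positivity, ?_⟩
  filter_upwards [hblocks (max N 1), eventually_le_log 1, eventually_ge_atTop 1]
    with m ⟨q, L, hq, hL, hqL, hρq, hcL⟩ hlog hm1
  have hm0 : (0 : ℝ) < m := by exact_mod_cast hm1
  have hL1 : 1 ≤ L := (le_max_right _ _).trans hL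
  have hLm : L ≤ m := by nlinarith
  have hL0 : (1 : ℝ) ≤ L := by exact_mod_cast hL1
  have hx : 0 < c * (m / Real.log m) := by positivity
  have h1 : (L : ℝ) ^ (-β) ≤ c ^ (-β) * ((Real.log m) ^ β * (m : ℝ) ^ (-β)) := by
    refine (Real.rpow_le_rpow_of_nonpos hx hcL (by linarith)).trans_eq ?_
    rw [Real.mul_rpow hc.le (by positivity), Real.div_rpow hm0.le (by linarith),
      Real.rpow_neg (by linarith : 0 ≤ Real.log m), div_inv_eq_mul, mul_comm ((m : ℝ) ^ (-β))]
  have h2 : (Real.log L) ^ δ ≤ (Real.log m) ^ δ :=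
    Real.rpow_le_rpow (Real.log_nonneg hL0)
      (Real.log_le_log (by linarith) (by exact_mod_cast hLm)) hδ
  have h3 : (1 : ℝ) ≤ (Real.log m) ^ (β + δ) := Real.one_le_rpow hlog (by linarith)
  have h4 : e L ≤ |C₀| * c ^ (-β) * ((Real.log m) ^ (β + δ) * (m : ℝ) ^ (-β)) := by
    calc e L ≤ C₀ * ((Real.log L) ^ δ * (L : ℝ) ^ (-β)) := hN L ((le_max_left _ _).trans hL)
      _ ≤ |C₀| * ((Real.log L) ^ δ * (L : ℝ) ^ (-β)) := by
          have := Real.log_nonneg hL0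
          exact mul_le_mul_of_nonneg_right (le_abs_self _) (by positivity)
      _ ≤ |C₀| * ((Real.log m) ^ δ * (c ^ (-β) * ((Real.log m) ^ β * (m : ℝ) ^ (-β)))) := by
          gcongr
      _ = _ := by rw [Real.rpow_add (by linarith)]; ring
  have h5 : ρ ^ q ≤ (Real.log m) ^ (β + δ) * (m : ℝ) ^ (-β) :=
    hρq.trans (le_mul_of_one_le_left (by positivity) h3)
  exact ⟨q, L, hq, hL1, hqL, by linarith⟩

/-- The tail of the series of negative powers. -/
lemma sum_rpow_tail_le {p : ℝ} (hp : 1 < p) {L : ℕ} (hL : 1 ≤ L) (n : ℕ) :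
    ∑ i ∈ Finset.range n, ((L + i : ℕ) : ℝ) ^ (-p) ≤ p / (p - 1) * (L : ℝ) ^ (1 - p) := by
  have hL0 : (1 : ℝ) ≤ L := by exact_mod_cast hL
  have hLp : (L : ℝ) ^ (-p) ≤ (L : ℝ) ^ (1 - p) :=
    Real.rpow_le_rpow_of_exponent_le hL0 (by linarith)
  have hanti : AntitoneOn (fun x : ℝ => x ^ (-p)) (Set.Icc (L : ℝ) (L + (n : ℕ))) := by
    intro x hx y hy hxy
    exact Real.rpow_le_rpow_of_nonpos (by linarith [hx.1]) hxy (by linarith)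
  have h1 := hanti.sum_le_integral
  have h2 : ∫ x in (L : ℝ)..(L + (n : ℕ)), x ^ (-p) =
      ((L : ℝ) ^ (1 - p) - (L + (n : ℕ) : ℝ) ^ (1 - p)) / (p - 1) := by
    rw [integral_rpow (Or.inr ⟨by linarith, by
      rw [Set.uIcc_of_le (by linarith [n.cast_nonneg (α := ℝ)])]
      exact fun h => by linarith [h.1]⟩)]
    rw [show -p + 1 = -(p - 1) by ring, show 1 - p = -(p - 1) by ring, div_neg, ← neg_div, neg_sub]
  have h3 : (0 : ℝ) ≤ (L + (n : ℕ) : ℝ) ^ (1 - p) := by positivity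
  have h4 : ∑ i ∈ Finset.range n, ((L + i : ℕ) : ℝ) ^ (-p) ≤
      (L : ℝ) ^ (-p) + ∑ i ∈ Finset.range n, ((L : ℝ) + ((i + 1 : ℕ) : ℝ)) ^ (-p) := by
    calc _ ≤ ∑ i ∈ Finset.range (n + 1), ((L + i : ℕ) : ℝ) ^ (-p) := by
          rw [Finset.sum_range_succ]
          linarith [Real.rpow_nonneg (Nat.cast_nonneg (α := ℝ) (L + n)) (-p)]
      _ = _ := by
          rw [Finset.sum_range_succ', add_comm]
          push_cast
          simp
  have h5 : ((L : ℝ) ^ (1 - p) - (L + (n : ℕ) : ℝ) ^ (1 - p)) / (p - 1) ≤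
      (L : ℝ) ^ (1 - p) / (p - 1) := by
    gcongr
    linarith
  have h6 : p / (p - 1) * (L : ℝ) ^ (1 - p) = (L : ℝ) ^ (1 - p) + (L : ℝ) ^ (1 - p) / (p - 1) := by
    have : p - 1 ≠ 0 := by linarith
    field_simp; ring
  linarith

/-- A logarithm grows slower than any power: `log l ≤ θ⁻¹ * log L * (l / L) ^ θ`. With `θ = (b - 1)
/ (2 * b)` half of the excess of `b` over `1` pays for replacing `log l` by `log L`, and the
exponent left, `(b + 1) / 2`, is still summable. The tail thus keeps the sharp factor `(log L) ^ b`.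
-/
lemma log_rpow_mul_rpow_le {b : ℝ} (hb : 1 < b) {L l : ℕ} (hL : 3 ≤ L) (hl : L ≤ l) :
    (Real.log l) ^ b * (l : ℝ) ^ (-b) ≤ (2 * b / (b - 1)) ^ b *
      ((Real.log L) ^ b * (L : ℝ) ^ (-((b - 1) / 2))) * (l : ℝ) ^ (-((b + 1) / 2)) := by
  set θ := (b - 1) / (2 * b) with hθ
  have hθ0 : 0 < θ := div_pos (by linarith) (by linarith)
  have hθ1 : θ ≤ 1 := by rw [hθ, div_le_one (by linarith)]; linarith
  have hL3 : (3 : ℝ) ≤ L := by exact_mod_cast hL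
  have hlL : (L : ℝ) ≤ l := by exact_mod_cast hl
  have hL0 : (0 : ℝ) < L := by linarith
  have hl0 : (0 : ℝ) < l := by linarith
  have hlogL : 1 ≤ Real.log L := by
    rw [Real.le_log_iff_exp_le hL0]
    linarith [Real.exp_one_lt_d9]
  have hz : 0 < (l : ℝ) / L := by positivity
  have h1 : Real.log l = Real.log L + Real.log ((l : ℝ) / L) := by
    rw [Real.log_div hl0.ne' hL0.ne']; ring
  have h2 : Real.log ((l : ℝ) / L) ≤ (((l : ℝ) / L) ^ θ - 1) / θ := by
    rw [le_div_iff₀ hθ0, mul_comm, ← Real.log_rpow hz]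
    linarith [Real.add_one_le_exp (Real.log (((l : ℝ) / L) ^ θ)),
      Real.exp_log (Real.rpow_pos_of_pos hz θ)]
  have h3 : Real.log l ≤ θ⁻¹ * Real.log L * ((l : ℝ) / L) ^ θ := by
    have h4 : 1 ≤ ((l : ℝ) / L) ^ θ :=
      Real.one_le_rpow ((one_le_div hL0).2 hlL) hθ0.le
    have h5 : (1 : ℝ) ≤ θ⁻¹ := (one_le_inv₀ hθ0).2 hθ1
    have h6 : Real.log l ≤ Real.log L + (((l : ℝ) / L) ^ θ - 1) * θ⁻¹ := by
      rw [h1]; linarith [h2.trans_eq (div_eq_mul_inv _ _)]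
    nlinarith [mul_nonneg (mul_nonneg (sub_nonneg.2 h4) (by linarith : 0 ≤ θ⁻¹))
      (sub_nonneg.2 hlogL), mul_nonneg (sub_nonneg.2 h5) (by linarith : 0 ≤ Real.log L)]
  have hlog0 : 0 ≤ Real.log l := Real.log_nonneg (by linarith)
  have h7 : (Real.log l) ^ b ≤
      (θ⁻¹) ^ b * (Real.log L) ^ b * ((l : ℝ) ^ ((b - 1) / 2) * (L : ℝ) ^ (-((b - 1) / 2))) := by
    refine (Real.rpow_le_rpow hlog0 h3 (by linarith)).trans_eq ?_
    rw [Real.mul_rpow (by positivity) (by positivity), Real.mul_rpow (by positivity) (by positivity),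
      ← Real.rpow_mul hz.le, Real.div_rpow hl0.le hL0.le, Real.rpow_neg hL0.le, ← div_eq_mul_inv]
    have : θ * b = (b - 1) / 2 := by rw [hθ]; field_simp
    rw [this]
  have h8 : (l : ℝ) ^ (-((b + 1) / 2)) = (l : ℝ) ^ ((b - 1) / 2) * (l : ℝ) ^ (-b) := by
    rw [← Real.rpow_add hl0]; congr 1; ring
  have h9 : θ⁻¹ = 2 * b / (b - 1) := by rw [hθ, inv_div]
  rw [h8, ← h9]
  calc _ ≤ (θ⁻¹) ^ b * (Real.log L) ^ b * ((l : ℝ) ^ ((b - 1) / 2) * (L : ℝ) ^ (-((b - 1) / 2))) *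
        (l : ℝ) ^ (-b) := by gcongr
    _ = _ := by ring

/-- Summability and tails of a sequence of order `(log l / l) ^ b`. -/
lemma summable_and_tail_le {b C : ℝ} (hb : 1 < b) {c : ℕ → ℝ} (hc0 : ∀ l, 0 ≤ c l)
    (hc : ∀ᶠ l : ℕ in atTop, c l ≤ C * ((Real.log l) ^ b * (l : ℝ) ^ (-b))) :
    Summable c ∧ ∃ C', ∀ᶠ L : ℕ in atTop,
      ∑' i, c (L + i) ≤ C' * ((Real.log L) ^ b * (L : ℝ) ^ (-(b - 1))) := by
  obtain ⟨N, hN⟩ := eventually_atTop.1 hc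
  set p := (b + 1) / 2 with hp
  have hp1 : 1 < p := by rw [hp]; linarith
  set D := |C| * (2 * b / (b - 1)) ^ b with hD
  have hb1 : 0 < b - 1 := by linarith
  have hD0 : 0 ≤ D := by positivity
  have hkey : ∀ L, max N 3 ≤ L → ∀ n, ∑ i ∈ Finset.range n, c (L + i) ≤
      D * (p / (p - 1)) * ((Real.log L) ^ b * (L : ℝ) ^ (-(b - 1))) := by
    intro L hL n
    have hL3 : 3 ≤ L := (le_max_right _ _).trans hL
    have hL0 : (0 : ℝ) < L := by exact_mod_cast (by omega : 0 < L)
    have hlogL : 0 ≤ Real.log L := Real.log_nonneg (by exact_mod_cast (by omega : 1 ≤ L))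
    have hterm : ∀ i, c (L + i) ≤ D * ((Real.log L) ^ b * (L : ℝ) ^ (-((b - 1) / 2))) *
        ((L + i : ℕ) : ℝ) ^ (-p) := by
      intro i
      have hlogl : 0 ≤ Real.log ((L + i : ℕ) : ℝ) :=
        Real.log_nonneg (by exact_mod_cast (by omega : 1 ≤ L + i))
      calc c (L + i) ≤ C * ((Real.log ((L + i : ℕ) : ℝ)) ^ b * ((L + i : ℕ) : ℝ) ^ (-b)) :=
            hN _ (by have := (le_max_left N 3).trans hL; omega)
        _ ≤ |C| * ((Real.log ((L + i : ℕ) : ℝ)) ^ b * ((L + i : ℕ) : ℝ) ^ (-b)) := by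
            gcongr
            exact le_abs_self _
        _ ≤ |C| * ((2 * b / (b - 1)) ^ b * ((Real.log L) ^ b * (L : ℝ) ^ (-((b - 1) / 2))) *
              ((L + i : ℕ) : ℝ) ^ (-p)) := by
            exact mul_le_mul_of_nonneg_left
              (log_rpow_mul_rpow_le hb hL3 (Nat.le_add_right L i)) (abs_nonneg _)
        _ = _ := by rw [hD]; ring
    calc _ ≤ ∑ i ∈ Finset.range n, D * ((Real.log L) ^ b * (L : ℝ) ^ (-((b - 1) / 2))) *
          ((L + i : ℕ) : ℝ) ^ (-p) := Finset.sum_le_sum fun i _ => hterm i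
      _ ≤ D * ((Real.log L) ^ b * (L : ℝ) ^ (-((b - 1) / 2))) *
          (p / (p - 1) * (L : ℝ) ^ (1 - p)) := by
          rw [← Finset.mul_sum]
          gcongr
          exact sum_rpow_tail_le hp1 (by omega) n
      _ = D * (p / (p - 1)) * ((Real.log L) ^ b *
          ((L : ℝ) ^ (-((b - 1) / 2)) * (L : ℝ) ^ (1 - p))) := by ring
      _ = _ := by
          rw [← Real.rpow_add hL0]
          congr 3
          rw [hp]; ring
  have hsum : Summable c := by
    rw [← summable_nat_add_iff (max N 3)]
    simp only [add_comm _ (max N 3)]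
    exact summable_of_sum_range_le (fun _ => hc0 _) (hkey _ le_rfl)
  refine ⟨hsum, D * (p / (p - 1)), ?_⟩
  filter_upwards [eventually_ge_atTop (max N 3)] with L hL
  exact Real.tsum_le_of_sum_range_le (fun _ => hc0 _) (hkey L hL)

end Rates

/-! ### Abstract contractive models -/

/-- Standing assumptions on the autoregression with noise law `η` in a stationary mixing
environment with law `π` and mixing rates `α`. -/
structure IsContractiveModel {E : Type*} [MeasurableSpace E] (η : Measure ℝ) (r σ : E → ℝ → ℝ)
    (γ K : E → ℝ) (π : Measure (ℕ → E)) (α : ℕ → ℝ) : Prop where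
  r_meas : Measurable (Function.uncurry r)
  σ_meas : Measurable (Function.uncurry σ)
  γ_nonneg : ∀ y, 0 ≤ γ y
  K_nonneg : ∀ y, 0 ≤ K y
  γ_meas : Measurable γ
  K_meas : Measurable K
  growth : ∀ y x, |r y x| + |σ y x| ≤ γ y * |x| + K y
  moment : ∫⁻ z, ENNReal.ofReal |z| ∂η ≤ 1
  abs_cont : η ≪ volume
  σ_ne : ∀ y x, σ y x ≠ 0
  minor : ∀ R > 0, ∃ (A : Set E) (κ : ℝ), MeasurableSet A ∧ 0 < κ ∧ κ ≤ 1 ∧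
    3 / 4 ≤ (π.map fun y => y 0).real A ∧ ∀ v ∈ A, Minorized η r σ R κ v
  stat : ∀ k, MeasurePreserving (shift k) π π
  γ_le : ∀ᵐ y ∂π, ∀ n, γ (y n) ≤ 1
  mix : MixBound π α

/-- `ζ L` bounds the expected effect, after `L` further steps, of the accumulated drift and of the
starting point. -/
structure IsDriftBound {E : Type*} [MeasurableSpace E] (γ K : E → ℝ) (π : Measure (ℕ → E))
    (ζ : ℕ → ℝ) : Prop where
  nonneg : ∀ L, 0 ≤ ζ L
  accum_le : ∀ L t, ∫⁻ y, ENNReal.ofReal (accum γ K y t * prodCoef γ (shift t y) L) ∂π ≤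
    ENNReal.ofReal (ζ L)
  prodCoef_le : ∀ L, ∫⁻ y, ENNReal.ofReal (prodCoef γ y L) ∂π ≤ ENNReal.ofReal (ζ L)

section Model

variable {E : Type*} [MeasurableSpace E] {r σ : E → ℝ → ℝ} {γ K : E → ℝ} {η : Measure ℝ}
  [IsProbabilityMeasure η] {π : Measure (ℕ → E)} [IsProbabilityMeasure π] {α ζ : ℕ → ℝ}

/-- Mixing of the started chain and loss of memory, with blocks of arbitrary number and length. -/
theorem IsContractiveModel.exists_block_bounds (M : IsContractiveModel η r σ γ K π α)
    (hζ : IsDriftBound γ K π ζ) :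
    ∃ ρ C : ℝ, 0 ≤ ρ ∧ ρ < 1 ∧ 0 ≤ C ∧
      (∀ (x : ℝ) (m j q L : ℕ), 1 ≤ L → L + 2 * L * q ≤ m → ∀ f g : (ℕ → ℝ × E) → ℝ,
        IsUnitFun f → IsUnitFun g → (∀ w, f (freeze j w) = f w) →
        |∫ w, f (jointPath r σ x w) * g (shift (j + m) (jointPath r σ x w)) ∂π.prod (noise η) -
          (∫ w, f (jointPath r σ x w) ∂π.prod (noise η)) *
            ∫ w, g (shift (j + m) (jointPath r σ x w)) ∂π.prod (noise η)| ≤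
          C * (2 + |x|) * (ρ ^ q + (α L + ζ L))) ∧
      (∀ v : ℝ, 0 ≤ v → ∀ n q L : ℕ, 1 ≤ L → 2 * L * q ≤ n → ∃ S : (ℕ → E) → ℝ, IsUnitFun S ∧
        ∫ y, S y ∂π ≤ C * (2 + v) * (ρ ^ q + (α L + ζ L)) ∧
        ∀ g : (ℕ → ℝ × E) → ℝ, IsUnitFun g → ∀ y u, |u| ≤ v →
          |tailMean η r σ g n y u - tailMean η r σ g n y 0| ≤ S y) := by
  -- At `L = 0` the product is `1`, so `ζ 0` bounds the mean accumulated drift at all times. The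
  -- level `R`, and with it `κ`, does not depend on the block length.
  set R : ℝ := 16 * ζ 0 + 1 with hRdef
  have hR : 0 < R := by have := hζ.nonneg 0; positivity
  obtain ⟨A, κ, hAm, hκ, hκ1, hAp, hA⟩ := M.minor R hR
  have hgood : ∀ L, 1 / 2 ≤ π.real (goodSet γ K A R L) := fun L =>
    half_le_measureReal_goodSet M.γ_nonneg M.K_nonneg M.γ_meas M.K_meas M.stat (hζ.nonneg 0)
      (fun t => by simpa using hζ.accum_le 0 t) le_rfl hAm hAp L
  set C' : ℝ := 1 + (κ / 2 + κ / R) / (κ / 2 * (1 / 2)) with hC'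
  have hC'0 : 0 ≤ C' := by positivity
  have hC'1 : 1 ≤ C' := le_add_of_nonneg_right (by positivity)
  have hD : ∀ (x : ℝ) (s q L : ℕ),
      ∫ w, coupErr γ K A R κ L (shift s w.1) |chain r σ w.1 w.2 x s| q ∂π.prod (noise η) ≤
        C' * (2 + |x|) * ((1 - κ / 2 * (1 / 2)) ^ q + (α L + ζ L)) := by
    intro x s q L
    have hα := M.mix.nonneg L
    have hζL := hζ.nonneg L
    have hx := abs_nonneg x
    have hpow : 0 ≤ (1 - κ / 2 * (1 / 2)) ^ q := pow_nonneg (by linarith) q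
    refine (integral_coupErr_le M.r_meas M.σ_meas M.γ_nonneg M.K_nonneg M.γ_meas M.K_meas hAm
      M.growth M.moment hR hκ hκ1 M.stat M.γ_le M.mix hζL (hζ.accum_le L) (hζ.prodCoef_le L)
      (by norm_num) (by norm_num) (hgood L) q).trans ?_
    have h1 : κ / 2 * α L + κ / R * ((2 + |x|) * ζ L) ≤
        (κ / 2 + κ / R) * ((2 + |x|) * (α L + ζ L)) := by
      have h2 : α L ≤ (2 + |x|) * α L := le_mul_of_one_le_left hα (by linarith)
      have h3 : 0 ≤ (2 + |x|) * ζ L := by positivity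
      calc _ ≤ κ / 2 * ((2 + |x|) * α L + (2 + |x|) * ζ L) +
            κ / R * ((2 + |x|) * α L + (2 + |x|) * ζ L) := by
            gcongr
            · linarith
            · exact le_add_of_nonneg_left (by positivity)
        _ = _ := by ring
    calc _ ≤ (1 - κ / 2 * (1 / 2)) ^ q +
          (κ / 2 + κ / R) * ((2 + |x|) * (α L + ζ L)) / (κ / 2 * (1 / 2)) := by gcongr
      _ = 1 * (1 - κ / 2 * (1 / 2)) ^ q + (C' - 1) * ((2 + |x|) * (α L + ζ L)) := by
          rw [hC']; ring
      _ ≤ (C' * (2 + |x|)) * (1 - κ / 2 * (1 / 2)) ^ q + C' * ((2 + |x|) * (α L + ζ L)) := by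
          gcongr
          · nlinarith
          · linarith
      _ = _ := by ring
  refine ⟨1 - κ / 2 * (1 / 2), 1 + 2 * C', by linarith, by linarith, by positivity, ?_, ?_⟩
  · intro x m j q L hL hm f g hf hg hfj
    refine (abs_cov_jointPath_le M.r_meas M.σ_meas M.γ_nonneg M.K_nonneg M.growth M.moment
      M.γ_meas M.K_meas hAm M.abs_cont M.σ_ne hR hκ.le hκ1 hA hL M.stat M.mix hm
      (hD x (j + L) q L) hf hg hfj).trans ?_
    have hα := M.mix.nonneg L
    have hζL := hζ.nonneg L
    have hx := abs_nonneg x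
    have hpow : 0 ≤ (1 - κ / 2 * (1 / 2)) ^ q := pow_nonneg (by linarith) q
    have h1 : α L ≤ (2 + |x|) * ((1 - κ / 2 * (1 / 2)) ^ q + (α L + ζ L)) := by
      have : 0 ≤ (1 - κ / 2 * (1 / 2)) ^ q + (α L + ζ L) := by positivity
      nlinarith
    linarith
  · intro v hv n q L hL hn
    -- The averaged bound at time `s = 0`: the chain still sits at `v`, so the noise integral is
    -- trivial.
    have hS : IsUnitFun fun p : (ℕ → E) × (ℕ → ℝ) => coupErr γ K A R κ L (shift 0 p.1)
        |chain r σ p.1 p.2 v 0| q :=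
      isUnitFun_coupErr M.r_meas M.σ_meas M.γ_nonneg M.K_nonneg M.γ_meas M.K_meas hAm hR hκ.le
        hκ1 0 v q
    simp only [chain, abs_of_nonneg hv, shift_zero] at hS
    refine ⟨fun y => coupErr γ K A R κ L y v q, hS.comp (φ := fun y => (y, fun _ => 0))
      (by fun_prop), ?_, fun g hg y u hu => ?_⟩
    · have h1 := hD v 0 q L
      simp only [chain, abs_of_nonneg hv, shift_zero] at h1
      rw [integral_prod _ (hS.integrable _)] at h1
      simp only [integral_const, probReal_univ, one_smul] at h1
      refine h1.trans ?_
      have hα := M.mix.nonneg L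
      have hζL := hζ.nonneg L
      have hpow : 0 ≤ (1 - κ / 2 * (1 / 2)) ^ q := pow_nonneg (by linarith) q
      gcongr
      linarith
    · exact (abs_tailMean_sub_le M.r_meas M.σ_meas M.γ_nonneg M.K_nonneg M.growth M.moment
        M.abs_cont M.σ_ne hR hκ.le hκ1 hA hL hn hg y u).trans
        (coupErr_mono M.γ_nonneg hR hκ.le hκ1 hu y q)

/-- Mixing rate of the started chain. -/
theorem IsContractiveModel.exists_mixing_rate (M : IsContractiveModel η r σ γ K π α)
    (hζ : IsDriftBound γ K π ζ) {β δ C₀ : ℝ} (hβ : 0 < β) (hδ : 0 ≤ δ)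
    (he : ∀ᶠ L : ℕ in atTop, α L + ζ L ≤ C₀ * ((Real.log L) ^ δ * (L : ℝ) ^ (-β))) (x : ℝ) :
    ∃ C, ∀ᶠ m : ℕ in atTop, ∀ (j : ℕ) (f g : (ℕ → ℝ × E) → ℝ),
      IsUnitFun f → IsUnitFun g → (∀ w, f (freeze j w) = f w) →
      |∫ w, f (jointPath r σ x w) * g (shift (j + m) (jointPath r σ x w)) ∂π.prod (noise η) -
        (∫ w, f (jointPath r σ x w) ∂π.prod (noise η)) *
          ∫ w, g (shift (j + m) (jointPath r σ x w)) ∂π.prod (noise η)| ≤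
        C * ((Real.log m) ^ (β + δ) * (m : ℝ) ^ (-β)) := by
  obtain ⟨ρ, C, hρ0, hρ1, hC, hcov, -⟩ := M.exists_block_bounds hζ
  obtain ⟨C', -, hrate⟩ := exists_blocks_rate hρ0 hρ1 hβ hδ he
  refine ⟨C * (2 + |x|) * C', ?_⟩
  filter_upwards [hrate] with m ⟨q, L, hq, hL, hqL, hle⟩ j f g hf hg hfj
  refine (hcov x m j q L hL ?_ f g hf hg hfj).trans ?_
  · have : L * 1 ≤ L * q := Nat.mul_le_mul_left L hq
    nlinarith
  · rw [mul_assoc (C * (2 + |x|))]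
    exact mul_le_mul_of_nonneg_left hle (by positivity)

/-- Loss of memory of the initial condition, uniformly on bounded sets and in mean over the
environment. -/
theorem IsContractiveModel.eventually_forget (M : IsContractiveModel η r σ γ K π α)
    (hζ : IsDriftBound γ K π ζ) (he : Tendsto (fun L => α L + ζ L) atTop (𝓝 0)) {v : ℝ}
    (hv : 0 ≤ v) {τ : ℝ} (hτ : 0 < τ) :
    ∃ N : ℕ, ∀ n ≥ N, ∃ S : (ℕ → E) → ℝ, IsUnitFun S ∧ ∫ y, S y ∂π ≤ τ ∧
      ∀ g : (ℕ → ℝ × E) → ℝ, IsUnitFun g → ∀ y u, |u| ≤ v →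
        |tailMean η r σ g n y u - tailMean η r σ g n y 0| ≤ S y := by
  obtain ⟨ρ, C, hρ0, hρ1, hC, -, hfor⟩ := M.exists_block_bounds hζ
  -- No rate is needed here, so `L` blocks of length `2 * L` suffice.
  have h1 : Tendsto (fun L : ℕ => C * (2 + v) * (ρ ^ L + (α L + ζ L))) atTop (𝓝 0) := by
    simpa using ((tendsto_pow_atTop_nhds_zero_of_lt_one hρ0 hρ1).add he).const_mul (C * (2 + v))
  obtain ⟨L, hL, hL1⟩ := ((h1.eventually_le_const hτ).and (eventually_ge_atTop 1)).exists
  refine ⟨2 * L * L, fun n hn => ?_⟩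
  obtain ⟨S, hS, hSi, hSb⟩ := hfor v hv n L L hL1 hn
  exact ⟨S, hS, hSi.trans hL, hSb⟩

end Model

/-! ### Strong mixing coefficients and covariance inequalities -/

section Dependence

variable {Ω : Type*} {m m₁ m₂ : MeasurableSpace Ω} [mΩ : MeasurableSpace Ω] {P : Measure Ω}
  [IsProbabilityMeasure P]

lemma abs_measureReal_inter_sub_le_one (G H : Set Ω) :
    |P.real (G ∩ H) - P.real G * P.real H| ≤ 1 := by
  have h1 : P.real (G ∩ H) ≤ 1 := measureReal_le_one
  have h2 : P.real G * P.real H ≤ 1 :=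
    mul_le_one₀ measureReal_le_one measureReal_nonneg measureReal_le_one
  have h3 : 0 ≤ P.real G * P.real H := mul_nonneg measureReal_nonneg measureReal_nonneg
  have h4 : 0 ≤ P.real (G ∩ H) := measureReal_nonneg
  rw [abs_le]
  constructor <;> linarith

lemma le_alphaDep {G H : Set Ω} (hG : MeasurableSet[m₁] G)
    (hH : MeasurableSet[m₂] H) :
    |P.real (G ∩ H) - P.real G * P.real H| ≤ alphaDep P m₁ m₂ := by
  refine le_csSup ⟨1, ?_⟩ ⟨G, H, hG, hH, rfl⟩
  rintro _ ⟨G, H, -, -, rfl⟩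
  exact abs_measureReal_inter_sub_le_one G H

omit [IsProbabilityMeasure P] in
lemma alphaDep_le {c : ℝ}
    (h : ∀ G H, MeasurableSet[m₁] G → MeasurableSet[m₂] H →
      |P.real (G ∩ H) - P.real G * P.real H| ≤ c) : alphaDep P m₁ m₂ ≤ c := by
  refine csSup_le ⟨_, ∅, ∅, @MeasurableSet.empty _ m₁, @MeasurableSet.empty _ m₂, rfl⟩ ?_
  rintro _ ⟨G, H, hG, hH, rfl⟩
  exact h G H hG hH

lemma alphaDep_nonneg : 0 ≤ alphaDep P m₁ m₂ :=
  (abs_nonneg _).trans (le_alphaDep (P := P) (G := ∅) (H := ∅) (@MeasurableSet.empty _ m₁)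
    (@MeasurableSet.empty _ m₂))

section Index

variable {I S : Type*} [Preorder I] [AddMonoidWithOne I] [MeasurableSpace S] {W : I → Ω → S}

lemma alphaDep_le_alphaMix (j : I) (n : ℕ) :
    alphaDep P (pastSigma W j) (futureSigma W (j + (n : I))) ≤ alphaMix P W n := by
  refine le_ciSup (f := fun j : I => alphaDep P (pastSigma W j) (futureSigma W (j + (n : I))))
    ⟨1, ?_⟩ j
  rintro _ ⟨j, rfl⟩
  exact alphaDep_le fun G H _ _ => abs_measureReal_inter_sub_le_one G H

lemma alphaMix_nonneg (n : ℕ) : 0 ≤ alphaMix P W n :=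
  alphaDep_nonneg.trans (alphaDep_le_alphaMix 0 n)

omit [IsProbabilityMeasure P] in
lemma alphaMix_le {n : ℕ} {c : ℝ}
    (h : ∀ (j : I) (G H : Set Ω), MeasurableSet[pastSigma W j] G →
      MeasurableSet[futureSigma W (j + (n : I))] H →
      |P.real (G ∩ H) - P.real G * P.real H| ≤ c) : alphaMix P W n ≤ c :=
  ciSup_le fun j => alphaDep_le (h j)

end Index

/-- Bounds on the integrals of `Z` over the sets of a sub-`σ`-algebra extend to functions. -/
lemma abs_integral_mul_le (hm : m ≤ mΩ) {Z : Ω → ℝ} (hZ : Integrable Z P)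
    {c : ℝ} (hc : ∀ G, MeasurableSet[m] G → |∫ ω in G, Z ω ∂P| ≤ c) {f : Ω → ℝ}
    (hfm : Measurable[m] f) (hf0 : ∀ ω, 0 ≤ f ω) (hf1 : ∀ ω, f ω ≤ 1) :
    |∫ ω, f ω * Z ω ∂P| ≤ c := by
  have hf : IsUnitFun f := ⟨hfm.mono hm le_rfl, hf0, hf1⟩
  have key : ∀ Z : Ω → ℝ, Integrable Z P → (∀ G, MeasurableSet[m] G → |∫ ω in G, Z ω ∂P| ≤ c) →
      ∫ ω, f ω * Z ω ∂P ≤ c := by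
    intro Z hZ hc
    have hfZ : Integrable (f * Z) P :=
      hZ.bdd_mul hf.measurable.aestronglyMeasurable (c := 1) (ae_of_all _ fun ω => by
        rw [Real.norm_eq_abs, abs_of_nonneg (hf0 ω)]; exact hf1 ω)
    -- Among `m`-measurable functions with values in `[0, 1]`, the indicator of this set maximizes
    -- the integral against `Z`.
    set U := {ω | 0 < (P[Z|m]) ω} with hU
    have hUm : MeasurableSet[m] U :=
      measurableSet_lt measurable_const stronglyMeasurable_condExp.measurable
    have h1 := condExp_mul_of_stronglyMeasurable_left (μ := P) (m := m) hfm.stronglyMeasurable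
      hfZ hZ
    calc ∫ ω, f ω * Z ω ∂P = ∫ ω, (P[f * Z|m]) ω ∂P := (integral_condExp hm).symm
      _ = ∫ ω, f ω * (P[Z|m]) ω ∂P := integral_congr_ae h1
      _ ≤ ∫ ω, U.indicator (P[Z|m]) ω ∂P := by
          refine integral_mono_ae (integrable_condExp.congr h1)
            (integrable_condExp.indicator (hm _ hUm)) (ae_of_all _ fun ω => ?_)
          by_cases hω : ω ∈ U
          · rw [Set.indicator_of_mem hω]
            exact mul_le_of_le_one_left (le_of_lt hω) (hf1 ω)
          · rw [Set.indicator_of_notMem hω]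
            exact mul_nonpos_of_nonneg_of_nonpos (hf0 ω) (not_lt.1 hω)
      _ = ∫ ω in U, Z ω ∂P := by
          rw [integral_indicator (hm _ hUm), setIntegral_condExp hm hZ hUm]
      _ ≤ c := (le_abs_self _).trans (hc U hUm)
  rw [abs_le]
  refine ⟨?_, key Z hZ hc⟩
  have h2 := key (fun ω => -Z ω) hZ.neg fun G hG => by
    rw [integral_neg, abs_neg]; exact hc G hG
  simp only [mul_neg, integral_neg] at h2
  linarith

/-- Covariance inequality for functions with values in `[0, 1]`. -/
lemma abs_cov_le_alphaDep (h₁ : m₁ ≤ mΩ) (h₂ : m₂ ≤ mΩ) {f g : Ω → ℝ}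
    (hf : Measurable[m₁] f) (hf0 : ∀ ω, 0 ≤ f ω) (hf1 : ∀ ω, f ω ≤ 1)
    (hg : Measurable[m₂] g) (hg0 : ∀ ω, 0 ≤ g ω) (hg1 : ∀ ω, g ω ≤ 1) :
    |∫ ω, f ω * g ω ∂P - (∫ ω, f ω ∂P) * ∫ ω, g ω ∂P| ≤ alphaDep P m₁ m₂ := by
  have hfu : IsUnitFun f := ⟨hf.mono h₁ le_rfl, hf0, hf1⟩
  have hgu : IsUnitFun g := ⟨hg.mono h₂ le_rfl, hg0, hg1⟩
  have hfi := hfu.integrable P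
  -- Sets are replaced by functions one variable at a time: first `f` against a fixed set `H`, then
  -- `g`.
  have hstep : ∀ H, MeasurableSet[m₂] H → |∫ ω in H, (f ω - ∫ ω, f ω ∂P) ∂P| ≤
      alphaDep P m₁ m₂ := by
    intro H hH
    have hHu : IsUnitFun (H.indicator fun _ => (1 : ℝ)) := IsUnitFun.indicator_one (h₂ _ hH)
    have hHi := hHu.integrable P
    have hHint : ∫ ω, H.indicator (fun _ => (1 : ℝ)) ω ∂P = P.real H :=
      integral_indicator_one (h₂ _ hH)
    have h3 := abs_integral_mul_le (P := P) h₁ (Z := fun ω => H.indicator (fun _ => (1 : ℝ)) ω -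
      P.real H) (hHi.sub (integrable_const _)) (c := alphaDep P m₁ m₂) (fun G hG => by
        rw [integral_sub hHi.integrableOn (integrable_const _),
          setIntegral_indicator (h₂ _ hH)]
        simp only [setIntegral_const, smul_eq_mul, mul_one]
        exact le_alphaDep hG hH) hf hf0 hf1
    have h4 : ∫ ω in H, (f ω - ∫ ω, f ω ∂P) ∂P =
        ∫ ω, f ω * (H.indicator (fun _ => (1 : ℝ)) ω - P.real H) ∂P := by
      have h5 : ∀ ω, f ω * (H.indicator (fun _ => (1 : ℝ)) ω - P.real H) =
          H.indicator f ω - f ω * P.real H := by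
        intro ω
        by_cases hω : ω ∈ H <;> simp [hω]
        ring
      simp only [h5]
      rw [integral_sub (hfi.indicator (h₂ _ hH)) (hfi.mul_const _), integral_mul_const,
        integral_indicator (h₂ _ hH), integral_sub hfi.integrableOn (integrable_const _)]
      simp only [setIntegral_const, smul_eq_mul]
      ring
    rw [h4]; exact h3
  have h6 := abs_integral_mul_le (P := P) h₂ (Z := fun ω => f ω - ∫ ω, f ω ∂P)
    (hfi.sub (integrable_const _)) hstep hg hg0 hg1
  have h7 : ∫ ω, g ω * (f ω - ∫ ω, f ω ∂P) ∂P =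
      ∫ ω, f ω * g ω ∂P - (∫ ω, f ω ∂P) * ∫ ω, g ω ∂P := by
    have h8 : ∀ ω, g ω * (f ω - ∫ ω, f ω ∂P) = f ω * g ω - (∫ ω, f ω ∂P) * g ω := fun ω => by ring
    simp only [h8]
    rw [integral_sub ((hfu.mul hgu).integrable P) ((hgu.integrable P).const_mul _),
      integral_const_mul]
  rwa [h7] at h6

end Dependence

/-! ### Past and future events as events of frozen and shifted paths -/

section SigmaAlgebras

variable {Ω S : Type*} [mΩ : MeasurableSpace Ω] [MeasurableSpace S]

omit mΩ in
lemma measurable_pastSigma {I : Type*} [Preorder I] (W : I → Ω → S) {k j : I} (h : k ≤ j) :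
    Measurable[pastSigma W j] (W k) :=
  Measurable.of_comap_le (le_iSup₂_of_le k h le_rfl)

omit mΩ in
lemma measurable_futureSigma {I : Type*} [Preorder I] (W : I → Ω → S) {k j : I} (h : j ≤ k) :
    Measurable[futureSigma W j] (W k) :=
  Measurable.of_comap_le (le_iSup₂_of_le k h le_rfl)

lemma pastSigma_le {I : Type*} [Preorder I] {W : I → Ω → S} (hW : ∀ k, Measurable (W k)) (j : I) :
    pastSigma W j ≤ mΩ :=
  iSup₂_le fun k _ => (hW k).comap_le

lemma futureSigma_le {I : Type*} [Preorder I] {W : I → Ω → S} (hW : ∀ k, Measurable (W k)) (j : I) :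
    futureSigma W j ≤ mΩ :=
  iSup₂_le fun k _ => (hW k).comap_le

omit mΩ in
/-- Events of the past are events of the frozen path. -/
lemma exists_freeze_of_pastSigma {W : ℕ → Ω → S} {j : ℕ} {G : Set Ω}
    (hG : MeasurableSet[pastSigma W j] G) :
    ∃ B : Set (ℕ → S), MeasurableSet B ∧ G = {ω | freeze j (fun n => W n ω) ∈ B} := by
  have hle : pastSigma W j ≤
      MeasurableSpace.comap (fun ω => freeze j fun n => W n ω) inferInstance := by
    refine iSup₂_le fun k hk => ?_
    have : W k = (fun y : ℕ → S => y k) ∘ fun ω => freeze j fun n => W n ω := by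
      funext ω; simp [freeze, hk]
    rw [this, ← MeasurableSpace.comap_comp]
    exact MeasurableSpace.comap_mono (measurable_pi_apply k).comap_le
  obtain ⟨B, hB, rfl⟩ := hle G hG
  exact ⟨B, hB, rfl⟩

omit mΩ in
/-- Events of the future are events of the shifted path. -/
lemma exists_shift_of_futureSigma {W : ℕ → Ω → S} {j : ℕ} {H : Set Ω}
    (hH : MeasurableSet[futureSigma W j] H) :
    ∃ B : Set (ℕ → S), MeasurableSet B ∧ H = {ω | shift j (fun n => W n ω) ∈ B} := by
  have hle : futureSigma W j ≤
      MeasurableSpace.comap (fun ω => shift j fun n => W n ω) inferInstance := by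
    refine iSup₂_le fun k hk => ?_
    have : W k = (fun y : ℕ → S => y (k - j)) ∘ fun ω => shift j fun n => W n ω := by
      funext ω; simp [shift, hk]
    rw [this, ← MeasurableSpace.comap_comp]
    exact MeasurableSpace.comap_mono (measurable_pi_apply _).comap_le
  obtain ⟨B, hB, rfl⟩ := hle H hH
  exact ⟨B, hB, rfl⟩

omit mΩ [MeasurableSpace S] in
lemma freeze_freeze (j : ℕ) (y : ℕ → S) : freeze j (freeze j y) = freeze j y := by
  funext n; simp [freeze]

end SigmaAlgebras

/-! ### Forward paths of a stationary process -/

section Stationary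

variable {Ω S : Type*} [MeasurableSpace Ω] [MeasurableSpace S] {P : Measure Ω}
  [IsProbabilityMeasure P] {Y : ℤ → Ω → S}

lemma measurable_forwardPath (hY : ∀ t, Measurable (Y t)) (s : ℤ) :
    Measurable fun ω (n : ℕ) => Y (s + n) ω :=
  measurable_pi_lambda _ fun n => hY (s + n)

omit [IsProbabilityMeasure P] in
lemma IsStrictlyStationary.map_forwardPath (h : IsStrictlyStationary P Y) (s : ℤ) :
    P.map (fun ω (n : ℕ) => Y (s + n) ω) = P.map fun ω (n : ℕ) => Y n ω := by
  have hm : Measurable fun (y : ℤ → S) (n : ℕ) => y n :=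
    measurable_pi_lambda _ fun n => measurable_pi_apply _
  have h1 := ((h s).comp hm).map_eq
  simpa only [Function.comp_def, add_comm] using h1

omit [IsProbabilityMeasure P] in
lemma IsStrictlyStationary.measurePreserving_shift (h : IsStrictlyStationary P Y)
    (hY : ∀ t, Measurable (Y t)) (k : ℕ) :
    MeasurePreserving (shift k) (P.map fun ω (n : ℕ) => Y n ω)
      (P.map fun ω (n : ℕ) => Y n ω) := by
  refine ⟨measurable_shift k, ?_⟩
  have hm : Measurable fun ω (n : ℕ) => Y n ω := measurable_pi_lambda _ fun n => hY n
  rw [Measure.map_map (measurable_shift k) hm, ← h.map_forwardPath k]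
  congr 1

/-- Strong mixing rates bound covariances along the forward path. -/
lemma mixBound_alphaMix (h : IsStrictlyStationary P Y) (hY : ∀ t, Measurable (Y t)) :
    MixBound (P.map fun ω (n : ℕ) => Y n ω) (alphaMix P Y) := by
  intro n j f g hf hg hfj
  set π := P.map fun ω (n : ℕ) => Y n ω with hπ
  have hm : Measurable fun ω (n : ℕ) => Y n ω := measurable_pi_lambda _ fun n => hY n
  have hstat : MeasurePreserving (shift (j + n)) π π := h.measurePreserving_shift hY (j + n)
  have hg' : ∫ y, g y ∂π = ∫ y, g (shift (j + n) y) ∂π := by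
    conv_lhs => rw [← hstat.map_eq]
    exact integral_map (measurable_shift _).aemeasurable hg.measurable.aestronglyMeasurable
  have hmap : ∀ F : (ℕ → S) → ℝ, Measurable F → ∫ y, F y ∂π = ∫ ω, F (fun n => Y n ω) ∂P :=
    fun F hF => integral_map hm.aemeasurable hF.aestronglyMeasurable
  have hgs : Measurable fun y => g (shift (j + n) y) := hg.measurable.comp (measurable_shift _)
  have hfg : Measurable fun y => f y * g (shift (j + n) y) := hf.measurable.mul hgs
  rw [hg', hmap f hf.measurable, hmap _ hgs, hmap _ hfg]
  refine (abs_cov_le_alphaDep (pastSigma_le hY (j : ℤ)) (futureSigma_le hY ((j : ℤ) + (n : ℤ))) ?_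
    (fun _ => hf.nonneg _) (fun _ => hf.le_one _) ?_ (fun _ => hg.nonneg _)
    (fun _ => hg.le_one _)).trans (alphaDep_le_alphaMix (j : ℤ) n)
  · have h1 : (fun ω => f fun n => Y n ω) = f ∘ fun ω => freeze j fun n => Y n ω := by
      funext ω; exact (hfj _).symm
    rw [h1]
    exact @Measurable.comp Ω (ℕ → S) ℝ (pastSigma Y (j : ℤ)) _ _ _ _ hf.measurable
      (@measurable_pi_lambda Ω ℕ (fun _ => S) (pastSigma Y (j : ℤ)) _ _ fun k =>
        measurable_pastSigma Y (by exact_mod_cast min_le_right k j))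
  · exact @Measurable.comp Ω (ℕ → S) ℝ (futureSigma Y ((j : ℤ) + (n : ℤ))) _ _ _ _ hg.measurable
      (@measurable_pi_lambda Ω ℕ (fun _ => S) (futureSigma Y ((j : ℤ) + (n : ℤ))) _ _ fun k =>
        measurable_futureSigma Y (by push_cast; omega))

end Stationary

/-! ### Joint laws with fresh innovations -/

section Noise

variable {Ω : Type*} [MeasurableSpace Ω] {P : Measure Ω} [IsProbabilityMeasure P]

/-- A random element together with a sequence of fresh i.i.d. innovations. -/
lemma map_prod_noise {T : Type*} [MeasurableSpace T] {Z : Ω → T} (hZ : Measurable Z)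
    {e : ℕ → Ω → ℝ} (he : ∀ n, Measurable (e n)) {η : Measure ℝ} [IsProbabilityMeasure η]
    (h : ∀ (U : Set T) (t : ℕ → Set ℝ), MeasurableSet U → (∀ i, MeasurableSet (t i)) → ∀ n,
      P {ω | Z ω ∈ U ∧ ∀ i < n, e i ω ∈ t i} = P (Z ⁻¹' U) * ∏ i ∈ Finset.range n, η (t i)) :
    P.map (fun ω => (Z ω, fun n => e n ω)) = (P.map Z).prod (noise η) := by
  have hem : Measurable fun ω n => e n ω := measurable_pi_lambda _ he
  symm
  have hZp : IsProbabilityMeasure (P.map Z) := Measure.isProbabilityMeasure_map hZ.aemeasurable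
  refine Measure.prod_eq fun U V hU hV => ?_
  rw [Measure.map_apply (hZ.prodMk hem) (hU.prod hV), Measure.map_apply hZ hU]
  have hres : (P.restrict (Z ⁻¹' U)).map (fun ω n => e n ω) = P (Z ⁻¹' U) • noise η := by
    by_cases h0 : P (Z ⁻¹' U) = 0
    · rw [h0, zero_smul, Measure.restrict_eq_zero.2 h0, Measure.map_zero]
    have htop : P (Z ⁻¹' U) ≠ ⊤ := measure_ne_top _ _
    -- Conditionally on `Z ∈ U`, the innovations have the product law, by uniqueness of the infinite
    -- product on finite cylinders.
    have hnoise : (P (Z ⁻¹' U))⁻¹ • (P.restrict (Z ⁻¹' U)).map (fun ω n => e n ω) = noise η := by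
      refine Measure.eq_infinitePi _ fun s t ht => ?_
      classical
      obtain ⟨n, hn⟩ := s.exists_nat_subset_range
      -- Unconstrained coordinates receive the whole line, so that the cylinder is indexed by an
      -- initial segment as in the hypothesis.
      set t' : ℕ → Set ℝ := fun i => if i ∈ s then t i else Set.univ with ht'
      have hset : (fun ω n => e n ω) ⁻¹' (Set.pi s t) ∩ Z ⁻¹' U =
          {ω | Z ω ∈ U ∧ ∀ i < n, e i ω ∈ t' i} := by
        ext ω
        simp only [Set.mem_inter_iff, Set.mem_preimage, Set.mem_pi, Finset.mem_coe, ht']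
        constructor
        · rintro ⟨h1, h2⟩
          refine ⟨h2, fun i _ => ?_⟩
          split_ifs with hi
          · exact h1 i hi
          · trivial
        · rintro ⟨h1, h2⟩
          refine ⟨fun i hi => ?_, h1⟩
          simpa [hi] using h2 i (Finset.mem_range.1 (hn hi))
      have hprod : ∏ i ∈ Finset.range n, η (t' i) = ∏ i ∈ s, η (t i) := by
        rw [← Finset.prod_subset hn fun i _ hi => by simp [ht', hi]]
        exact Finset.prod_congr rfl fun i hi => by simp [ht', hi]
      have hpi : MeasurableSet (Set.pi (s : Set ℕ) t) := .pi s.countable_toSet fun i _ => ht i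
      rw [Measure.smul_apply, Measure.map_apply hem hpi, Measure.restrict_apply (hem hpi), hset,
        h U t' hU (fun i => by
          simp only [ht']
          split_ifs
          · exact ht i
          · exact .univ) n, hprod, smul_eq_mul, ← mul_assoc, ENNReal.inv_mul_cancel h0 htop,
        one_mul]
    rw [← hnoise, smul_smul, ENNReal.mul_inv_cancel h0 htop, one_smul]
  have h2 : (fun ω => (Z ω, fun n => e n ω)) ⁻¹' U ×ˢ V = (fun ω n => e n ω) ⁻¹' V ∩ Z ⁻¹' U := by
    ext ω; simp [and_comm]
  rw [h2, ← Measure.restrict_apply (hem hV), ← Measure.map_apply hem hV, hres, Measure.smul_apply,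
    smul_eq_mul]

omit [IsProbabilityMeasure P] in
/-- The law of the innovations after a given time. -/
lemma map_forward_noise {ε : ℤ → Ω → ℝ} (hε : ∀ t, Measurable (ε t)) (hεindep : iIndepFun ε P)
    (hεident : ∀ t, IdentDistrib (ε t) (ε 0) P P) (s : ℤ) :
    P.map (fun ω (n : ℕ) => ε (s + n) ω) = noise (P.map (ε 0)) := by
  have hinj : Function.Injective fun n : ℕ => s + (n : ℤ) := fun a b hab => by simpa using hab
  have h1 := (hεindep.precomp hinj).map_fun_eq_infinitePi_map fun n => hε _
  simpa only [Function.comp_def, (hεident _).map_eq] using h1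

end Noise

/-! ### From covariances of path functionals to events -/

section Cylinders

variable {Ω S : Type*} [MeasurableSpace Ω] [MeasurableSpace S] {P : Measure Ω}

/-- Covariance bounds for functionals of the path give bounds for past and future events. -/
lemma abs_measureReal_inter_sub_le_of_cov {V : ℕ → Ω → S} (hV : ∀ n, Measurable (V n)) {j m : ℕ}
    {c : ℝ} (hc : ∀ f g : (ℕ → S) → ℝ, IsUnitFun f → IsUnitFun g → (∀ w, f (freeze j w) = f w) →
      |∫ ω, f (fun n => V n ω) * g (shift (j + m) fun n => V n ω) ∂P -
        (∫ ω, f (fun n => V n ω) ∂P) * ∫ ω, g (shift (j + m) fun n => V n ω) ∂P| ≤ c)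
    {G H : Set Ω} (hG : MeasurableSet[pastSigma V j] G)
    (hH : MeasurableSet[futureSigma V (j + m)] H) :
    |P.real (G ∩ H) - P.real G * P.real H| ≤ c := by
  have hVm : Measurable fun ω n => V n ω := measurable_pi_lambda _ hV
  have hGm : MeasurableSet G := pastSigma_le hV j G hG
  have hHm : MeasurableSet H := futureSigma_le hV (j + m) H hH
  obtain ⟨B, hB, rfl⟩ := exists_freeze_of_pastSigma hG
  obtain ⟨B', hB', rfl⟩ := exists_shift_of_futureSigma hH
  have hBf : MeasurableSet (freeze j ⁻¹' B) := hB.preimage (measurable_freeze j)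
  have key := hc _ _ (IsUnitFun.indicator_one hBf) (IsUnitFun.indicator_one hB') fun w => by
    change B.indicator (fun _ => (1 : ℝ)) (freeze j (freeze j w)) =
      B.indicator (fun _ => (1 : ℝ)) (freeze j w)
    rw [freeze_freeze]
  have e1 : ∀ ω, (freeze j ⁻¹' B).indicator (fun _ => (1 : ℝ)) (fun n => V n ω) =
      {ω | (freeze j fun n => V n ω) ∈ B}.indicator 1 ω := fun ω => rfl
  have e2 : ∀ ω, B'.indicator (fun _ => (1 : ℝ)) (shift (j + m) fun n => V n ω) =
      {ω | (shift (j + m) fun n => V n ω) ∈ B'}.indicator 1 ω := fun ω => rfl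
  have e3 : ∀ ω, {ω | (freeze j fun n => V n ω) ∈ B}.indicator (1 : Ω → ℝ) ω *
      {ω | (shift (j + m) fun n => V n ω) ∈ B'}.indicator (1 : Ω → ℝ) ω =
      ({ω | (freeze j fun n => V n ω) ∈ B} ∩
        {ω | (shift (j + m) fun n => V n ω) ∈ B'}).indicator (1 : Ω → ℝ) ω := fun ω => by
    rw [Set.inter_indicator_one]; rfl
  simp only [e1, e2] at key
  simp only [e3] at key
  rwa [integral_indicator_one (hGm.inter hHm), integral_indicator_one hGm,
    integral_indicator_one hHm] at key

end Cylinders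

/-! ### Transfer to started solutions -/

section Started

variable {Ω E : Type*} [MeasurableSpace Ω] [MeasurableSpace E] {P : Measure Ω}
  [IsProbabilityMeasure P] {Y : ℤ → Ω → E} {ε : ℤ → Ω → ℝ} {r σ : E → ℝ → ℝ}

/-- The environment and the innovations from time `0` on have the canonical law. -/
lemma map_environment_noise (hY : ∀ t, Measurable (Y t)) (hε : ∀ t, Measurable (ε t))
    (hεindep : iIndepFun ε P) (hεident : ∀ t, IdentDistrib (ε t) (ε 0) P P)
    (hεY : IndepFun (fun ω (t : ℤ) => ε t ω) (fun ω (t : ℤ) => Y t ω) P) :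
    P.map (fun ω => ((fun n : ℕ => Y n ω), fun n : ℕ => ε (1 + n) ω)) =
      (P.map fun ω (n : ℕ) => Y n ω).prod (noise (P.map (ε 0))) := by
  have h1 : IndepFun (fun ω (n : ℕ) => Y n ω) (fun ω (n : ℕ) => ε (1 + n) ω) P :=
    hεY.symm.comp (φ := fun (y : ℤ → E) (n : ℕ) => y n)
      (ψ := fun (e : ℤ → ℝ) (n : ℕ) => e (1 + n))
      (measurable_pi_lambda _ fun n => measurable_pi_apply _)
      (measurable_pi_lambda _ fun n => measurable_pi_apply _)
  have h2 : Measurable fun ω (n : ℕ) => Y n ω := measurable_pi_lambda _ fun n => hY n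
  rw [(indepFun_iff_map_prod_eq_prod_map_map h2.aemeasurable
    (measurable_forwardPath hε 1).aemeasurable).1 h1,
    map_forward_noise hε hεindep hεident]

-- Step `n` of the canonical recursion uses the innovation at time `n + 1`, hence the noise path `ε
-- (1 + n)`.
omit [MeasurableSpace Ω] [MeasurableSpace E] in
lemma IsStartedSolution.eq_jointPath {x : ℝ} {X : ℕ → Ω → ℝ} (hX : IsStartedSolution r σ Y ε x X)
    (ω : Ω) : (fun n : ℕ => (X n ω, Y n ω)) =
      jointPath r σ x ((fun n : ℕ => Y n ω), fun n : ℕ => ε (1 + n) ω) := by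
  funext n
  have : X n ω = chain r σ (fun n : ℕ => Y n ω) (fun n : ℕ => ε (1 + n) ω) x n := by
    induction n with
    | zero => exact hX.init ω
    | succ n ih =>
      rw [hX.step, ih, add_comm (n : ℤ) 1]
      rfl
  simp only [jointPath, this]

/-- Bounds on canonical covariances give bounds on the strong mixing coefficients of a started
solution. -/
theorem alphaMix_started_le (hr : Measurable (Function.uncurry r))
    (hσ : Measurable (Function.uncurry σ)) (hY : ∀ t, Measurable (Y t))
    (hε : ∀ t, Measurable (ε t))
    (hεindep : iIndepFun ε P) (hεident : ∀ t, IdentDistrib (ε t) (ε 0) P P)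
    (hεY : IndepFun (fun ω (t : ℤ) => ε t ω) (fun ω (t : ℤ) => Y t ω) P) {x : ℝ} {X : ℕ → Ω → ℝ}
    (hX : IsStartedSolution r σ Y ε x X) {m : ℕ} {c : ℝ}
    (hc : ∀ (j : ℕ) (f g : (ℕ → ℝ × E) → ℝ), IsUnitFun f → IsUnitFun g →
      (∀ w, f (freeze j w) = f w) →
      |∫ w, f (jointPath r σ x w) * g (shift (j + m) (jointPath r σ x w))
          ∂(P.map fun ω (n : ℕ) => Y n ω).prod (noise (P.map (ε 0))) -
        (∫ w, f (jointPath r σ x w) ∂(P.map fun ω (n : ℕ) => Y n ω).prod (noise (P.map (ε 0)))) *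
          ∫ w, g (shift (j + m) (jointPath r σ x w))
            ∂(P.map fun ω (n : ℕ) => Y n ω).prod (noise (P.map (ε 0)))| ≤ c) :
    alphaMix P (fun (t : ℕ) ω => (X t ω, Y t ω)) m ≤ c := by
  have hYm : Measurable fun ω (n : ℕ) => Y n ω := measurable_pi_lambda _ fun n => hY n
  have hΨ := hYm.prodMk (measurable_forwardPath hε 1)
  have hjp : Measurable (jointPath r σ x) :=
    (measurable_jointPath hr hσ).comp measurable_prodMk_left
  have hV : ∀ t : ℕ, Measurable fun ω => (X t ω, Y t ω) := fun t => by
    have h1 : (fun ω => (X t ω, Y t ω)) = fun ω =>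
        jointPath r σ x ((fun n : ℕ => Y n ω), fun n : ℕ => ε (1 + n) ω) t := by
      funext ω; rw [← hX.eq_jointPath ω]
    rw [h1]
    exact (measurable_pi_apply t).comp (hjp.comp hΨ)
  refine alphaMix_le fun j G H hG hH => abs_measureReal_inter_sub_le_of_cov hV ?_ hG hH
  intro f g hf hg hfj
  have key := hc j f g hf hg hfj
  have hfm : Measurable fun w => f (jointPath r σ x w) := hf.measurable.comp hjp
  have hgm : Measurable fun w => g (shift (j + m) (jointPath r σ x w)) :=
    hg.measurable.comp ((measurable_shift _).comp hjp)
  have hfgm : Measurable fun w => f (jointPath r σ x w) * g (shift (j + m) (jointPath r σ x w)) :=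
    hfm.mul hgm
  rw [← map_environment_noise hY hε hεindep hεident hεY,
    integral_map hΨ.aemeasurable hfm.aestronglyMeasurable,
    integral_map hΨ.aemeasurable hgm.aestronglyMeasurable,
    integral_map hΨ.aemeasurable hfgm.aestronglyMeasurable] at key
  simpa only [hX.eq_jointPath, Nat.cast_id] using key

end Started

/-! ### Reduction of the two-sided past to finite windows -/

section TwoSided

variable {Ω S : Type*} [mΩ : MeasurableSpace Ω] [MeasurableSpace S] {P : Measure Ω}
  [IsProbabilityMeasure P]

/-- Events of the infinite past are approximated by events of the finite past. -/
lemma exists_finite_past_approx {W : ℤ → Ω → S} (hW : ∀ t, Measurable (W t)) {j : ℤ} {G : Set Ω}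
    (hG : MeasurableSet[pastSigma W j] G) {τ : ℝ} (hτ : 0 < τ) :
    ∃ (l : ℕ) (A : Set Ω), MeasurableSet[pastSigma (fun n : ℕ => W (j - l + n)) l] A ∧
      P.real (symmDiff G A) ≤ τ := by
  set ml : ℕ → MeasurableSpace Ω := fun l => pastSigma (fun n : ℕ => W (j - l + n)) l with hml
  have hmono : Monotone ml := by
    intro l l' hl
    refine iSup₂_le fun k hk => ?_
    have h1 : (fun n : ℕ => W (j - l + n)) k = (fun n : ℕ => W (j - l' + n)) (k + (l' - l)) := by
      simp only; congr 1; omega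
    rw [h1]
    exact (measurable_pastSigma (fun n : ℕ => W (j - l' + n)) (by omega)).comap_le
  have hle : pastSigma W j ≤ ⨆ l, ml l := by
    refine iSup₂_le fun k hk => ?_
    have h1 : W k = (fun n : ℕ => W (j - (j - k).toNat + n)) 0 := by
      simp only; congr 1; omega
    rw [h1]
    exact ((measurable_pastSigma (fun n : ℕ => W (j - (j - k).toNat + n))
      (Nat.zero_le (j - k).toNat)).comap_le).trans (le_iSup ml (j - k).toNat)
  have hmle : ∀ l, ml l ≤ mΩ := fun l => pastSigma_le (fun n => hW _) l
  have hsup : ⨆ l, ml l ≤ mΩ := iSup_le hmle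
  -- The windows `[j - l, j]` increase with `l`, so the union of their σ-algebras is an algebra
  -- generating the past, and is therefore dense in it for the measure of symmetric differences.
  have halg : IsSetAlgebra (⋃ l, {t | MeasurableSet[ml l] t}) := by
    refine ⟨Set.mem_iUnion.2 ⟨0, @MeasurableSet.empty _ (ml 0)⟩, ?_, ?_⟩
    · intro s hs
      obtain ⟨l, hl⟩ := Set.mem_iUnion.1 hs
      exact Set.mem_iUnion.2 ⟨l, @MeasurableSet.compl _ _ (ml l) hl⟩
    · intro s t hs ht
      obtain ⟨l, hl⟩ := Set.mem_iUnion.1 hs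
      obtain ⟨l', hl'⟩ := Set.mem_iUnion.1 ht
      exact Set.mem_iUnion.2 ⟨max l l', @MeasurableSet.union _ (ml (max l l')) _ _
        (hmono (le_max_left l l') s hl) (hmono (le_max_right l l') t hl')⟩
  have hdense := @Measure.MeasureDense.of_generateFrom_isSetAlgebra_finite Ω (⨆ l, ml l)
    (P.trim hsup) (⋃ l, {t | MeasurableSet[ml l] t}) _ halg
    (MeasurableSpace.generateFrom_iUnion_measurableSet ml).symm
  obtain ⟨A, hA, hGA⟩ := @Measure.MeasureDense.approx _ (⨆ l, ml l) _ _ hdense G (hle G hG) (measure_ne_top _ _) τ hτ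
  obtain ⟨l, hl⟩ := Set.mem_iUnion.1 hA
  refine ⟨l, A, hl, ?_⟩
  have hGA' : MeasurableSet[⨆ l, ml l] (symmDiff G A) :=
    @MeasurableSet.symmDiff _ (⨆ l, ml l) _ _ (hle G hG) (le_iSup ml l A hl)
  rw [trim_measurableSet_eq hsup hGA'] at hGA
  exact ENNReal.toReal_le_of_le_ofReal hτ.le hGA.le

/-- Two-sided mixing coefficients from covariance bounds along all forward paths. -/
theorem alphaMix_le_of_cov {W : ℤ → Ω → S} (hW : ∀ t, Measurable (W t)) {m : ℕ} {c : ℝ}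
    (hc : ∀ (i : ℤ) (j : ℕ) (f g : (ℕ → S) → ℝ), IsUnitFun f → IsUnitFun g →
      (∀ w, f (freeze j w) = f w) →
      |∫ ω, f (fun n : ℕ => W (i + n) ω) * g (shift (j + m) fun n : ℕ => W (i + n) ω) ∂P -
        (∫ ω, f (fun n : ℕ => W (i + n) ω) ∂P) *
          ∫ ω, g (shift (j + m) fun n : ℕ => W (i + n) ω) ∂P| ≤ c) :
    alphaMix P W m ≤ c := by
  refine alphaMix_le fun j G H hG hH => le_of_forall_pos_le_add fun τ hτ => ?_
  obtain ⟨l, A, hA, hGA⟩ := exists_finite_past_approx (P := P) hW hG (half_pos hτ)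
  have hfut : futureSigma W (j + (m : ℤ)) ≤ futureSigma (fun n : ℕ => W (j - l + n)) (l + m) := by
    refine iSup₂_le fun k hk => ?_
    have h1 : W k = (fun n : ℕ => W (j - l + n)) (k - (j - l)).toNat := by
      simp only; congr 1; omega
    rw [h1]
    exact (measurable_futureSigma (fun n : ℕ => W (j - l + n)) (by omega)).comap_le
  have h1 := abs_measureReal_inter_sub_le_of_cov (P := P) (V := fun n : ℕ => W (j - l + n))
    (fun n => hW _) (hc (j - l) l) hA (hfut H hH)
  have hGm : MeasurableSet G := pastSigma_le hW j G hG
  have hHm : MeasurableSet H := futureSigma_le hW _ H hH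
  have hAm : MeasurableSet A := pastSigma_le (fun n => hW _) l A hA
  have h2 := (abs_measureReal_sub_le_measureReal_symmDiff (μ := P) hGm.nullMeasurableSet
    hAm.nullMeasurableSet).trans hGA
  have h3 : |P.real (G ∩ H) - P.real (A ∩ H)| ≤ τ / 2 := by
    refine (abs_measureReal_sub_le_measureReal_symmDiff (hGm.inter hHm).nullMeasurableSet
      (hAm.inter hHm).nullMeasurableSet).trans
      (le_trans (measureReal_mono ?_) hGA)
    rw [← Set.inter_symmDiff_distrib_right]
    exact Set.inter_subset_left
  have h4 : |P.real G * P.real H - P.real A * P.real H| ≤ τ / 2 := by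
    rw [← sub_mul, abs_mul, abs_of_nonneg (measureReal_nonneg (μ := P) (s := H))]
    exact (mul_le_of_le_one_right (abs_nonneg _) measureReal_le_one).trans h2
  rw [abs_le] at *
  constructor <;> linarith [h1.1, h1.2, h3.1, h3.2, h4.1, h4.2]

end TwoSided

/-! ### Transfer to stationary solutions -/

section StationarySolution

variable {Ω E : Type*} [MeasurableSpace Ω] [MeasurableSpace E] {P : Measure Ω}
  [IsProbabilityMeasure P] {Y : ℤ → Ω → E} {ε : ℤ → Ω → ℝ} {r σ : E → ℝ → ℝ}

/-- The innovations are written through the recursion as functions of the chain and the environment.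
The σ-algebra on `Ω` is left free because the lemma is applied to that of the past of `X` and the
whole environment. -/
lemma measurableSet_innovations {Ω E : Type*} [MeasurableSpace Ω] [MeasurableSpace E]
    {r σ : E → ℝ → ℝ} (hr : Measurable (Function.uncurry r))
    (hσ : Measurable (Function.uncurry σ)) {y : ℕ → Ω → E} {x : ℕ → Ω → ℝ} {n : ℕ}
    (hy : ∀ k, Measurable (y k)) (hx : ∀ k ≤ n, Measurable (x k)) {U : Set ((ℕ → E) × ℝ)}
    (hU : MeasurableSet U) {t : ℕ → Set ℝ} (ht : ∀ i, MeasurableSet (t i)) :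
    MeasurableSet {ω | ((fun k => y k ω), x 0 ω) ∈ U ∧
      ∀ i < n, (x (i + 1) ω - r (y i ω) (x i ω)) / σ (y i ω) (x i ω) ∈ t i} := by
  have h1 : MeasurableSet {ω | ((fun k => y k ω), x 0 ω) ∈ U} :=
    ((measurable_pi_lambda _ hy).prodMk (hx 0 (Nat.zero_le n))) hU
  have h2 : MeasurableSet (⋂ i, ⋂ (_ : i < n),
      {ω | (x (i + 1) ω - r (y i ω) (x i ω)) / σ (y i ω) (x i ω) ∈ t i}) := by
    refine MeasurableSet.iInter fun i => MeasurableSet.iInter fun hi => ?_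
    have h3 := (hy i).prodMk (hx i hi.le)
    exact (((hx (i + 1) hi).sub (hr.comp h3)).div (hσ.comp h3)) (ht i)
  convert h1.inter h2 using 1
  ext ω
  simp

/-- The innovations after time `0` are independent of the environment and of the present. -/
lemma IsStationarySolution.map_noise {X : ℤ → Ω → ℝ} (hX : IsStationarySolution P r σ Y ε X)
    (hr : Measurable (Function.uncurry r)) (hσ : Measurable (Function.uncurry σ))
    (hσ0 : ∀ y x, σ y x ≠ 0) (hY : ∀ t, Measurable (Y t)) (hε : ∀ t, Measurable (ε t))
    (hεident : ∀ t, IdentDistrib (ε t) (ε 0) P P) :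
    P.map (fun ω => (((fun n : ℕ => Y n ω), X 0 ω), fun n : ℕ => ε (1 + n) ω)) =
      (P.map fun ω => ((fun n : ℕ => Y n ω), X 0 ω)).prod (noise (P.map (ε 0))) := by
  have hYm : Measurable fun ω (n : ℕ) => Y n ω := measurable_pi_lambda _ fun n => hY n
  have := Measure.isProbabilityMeasure_map (μ := P) (hε 0).aemeasurable
  refine map_prod_noise (hYm.prodMk (hX.measurable 0)) (fun n => hε _) fun U t hU ht n => ?_
  set 𝓕 : ℕ → MeasurableSpace Ω := fun n =>
    pastSigma X (n : ℤ) ⊔ ⨆ k : ℤ, MeasurableSpace.comap (Y k) inferInstance with h𝓕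
  -- The independence hypothesis involves `X` and `Y`, not earlier innovations. As `σ` does not
  -- vanish, those are recovered almost surely from the recursion, and the event becomes measurable
  -- before the next innovation arrives.
  set D : ℕ → Set Ω := fun n => {ω | ((fun k : ℕ => Y k ω), X (0 : ℕ) ω) ∈ U ∧
      ∀ i < n, (X (i + 1 : ℕ) ω - r (Y i ω) (X i ω)) / σ (Y i ω) (X i ω) ∈ t i} with hD
  have hDm : ∀ n, MeasurableSet[𝓕 n] (D n) := by
    intro n
    refine @measurableSet_innovations Ω E (𝓕 n) _ r σ hr hσ (fun k : ℕ => Y k)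
      (fun k : ℕ => X k) n (fun k => ?_) (fun k hk => ?_) U hU t ht
    · exact Measurable.of_comap_le (le_sup_of_le_right (le_iSup_of_le (k : ℤ) le_rfl))
    · exact Measurable.of_comap_le (le_sup_of_le_left
        (measurable_pastSigma X (by exact_mod_cast hk)).comap_le)
  have hae : ∀ᵐ ω ∂P, ∀ i : ℕ,
      (X (i + 1 : ℕ) ω - r (Y i ω) (X i ω)) / σ (Y i ω) (X i ω) = ε (1 + i) ω := by
    rw [ae_all_iff]
    intro i
    filter_upwards [hX.step i] with ω hω
    rw [Nat.cast_add_one, hω, add_comm (1 : ℤ), add_sub_cancel_left, mul_div_cancel_right₀ _ (hσ0 _ _)]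
  have hCD : ∀ n, P {ω | ((fun n : ℕ => Y n ω), X 0 ω) ∈ U ∧ ∀ i < n, ε (1 + i) ω ∈ t i} =
      P (D n) := by
    intro n
    refine measure_congr ?_
    filter_upwards [hae] with ω hω
    refine propext ?_
    change (_ ∧ ∀ i < n, _) ↔ (_ ∧ ∀ i < n, _)
    simp only [hω, Nat.cast_zero]
  rw [hCD]
  induction n with
  | zero =>
    simp [hD]
    rfl
  | succ n ih =>
    have hstep : P (D (n + 1)) = P (ε (n + 1) ⁻¹' t n ∩ D n) := by
      refine measure_congr ?_
      filter_upwards [hae] with ω hω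
      refine propext ?_
      change (_ ∧ ∀ i < n + 1, _) ↔ (_ ∧ _ ∧ ∀ i < n, _)
      simp only [hω, Nat.forall_lt_succ_right, Set.mem_preimage, add_comm (1 : ℤ)]
      tauto
    rw [hstep, (Indep_iff _ _ P).1 (hX.indep n) _ _ ⟨t n, ht n, rfl⟩ (hDm n), ih,
      Finset.prod_range_succ, ← (hεident (n + 1)).map_eq, Measure.map_apply (hε _) (ht n)]
    ring

end StationarySolution

section StationarySolution

variable {Ω E : Type*} [MeasurableSpace Ω] [MeasurableSpace E] {P : Measure Ω}
  [IsProbabilityMeasure P] {Y : ℤ → Ω → E} {ε : ℤ → Ω → ℝ} {r σ : E → ℝ → ℝ} {X : ℤ → Ω → ℝ}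

omit [IsProbabilityMeasure P] in
lemma IsStationarySolution.ae_eq_jointPath (hX : IsStationarySolution P r σ Y ε X) :
    ∀ᵐ ω ∂P, (fun n : ℕ => (X n ω, Y n ω)) =
      jointPath r σ (X 0 ω) ((fun n : ℕ => Y n ω), fun n : ℕ => ε (1 + n) ω) := by
  have h1 : ∀ᵐ ω ∂P, ∀ t : ℤ,
      X (t + 1) ω = r (Y t ω) (X t ω) + ε (t + 1) ω * σ (Y t ω) (X t ω) := ae_all_iff.2 hX.step
  filter_upwards [h1] with ω hω
  funext n
  have : X n ω = chain r σ (fun n : ℕ => Y n ω) (fun n : ℕ => ε (1 + n) ω) (X 0 ω) n := by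
    induction n with
    | zero => rfl
    | succ n ih =>
      rw [Nat.cast_add_one, hω, ih, add_comm (n : ℤ) 1]
      rfl
  simp only [jointPath, this]

/-- A stationary solution has the law of the solution started at `0`, up to the loss of memory. -/
lemma IsStationarySolution.abs_integral_sub_le (hX : IsStationarySolution P r σ Y ε X)
    (hr : Measurable (Function.uncurry r)) (hσ : Measurable (Function.uncurry σ))
    (hσ0 : ∀ y x, σ y x ≠ 0) (hY : ∀ t, Measurable (Y t)) (hε : ∀ t, Measurable (ε t))
    (hεident : ∀ t, IdentDistrib (ε t) (ε 0) P P) {v τ : ℝ} {N : ℕ} {S : (ℕ → E) → ℝ}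
    (hS : IsUnitFun S) (hSτ : ∫ y, S y ∂(P.map fun ω (n : ℕ) => Y n ω) ≤ τ)
    (hSb : ∀ g : (ℕ → ℝ × E) → ℝ, IsUnitFun g → ∀ y u, |u| ≤ v →
      |tailMean (P.map (ε 0)) r σ g N y u - tailMean (P.map (ε 0)) r σ g N y 0| ≤ S y)
    (hv : P.real {ω | v < |X 0 ω|} ≤ τ) {F : (ℕ → ℝ × E) → ℝ} (hF : IsUnitFun F) :
    |∫ ω, F (shift N fun n : ℕ => (X n ω, Y n ω)) ∂P -
      ∫ w, F (shift N (jointPath r σ 0 w))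
        ∂(P.map fun ω (n : ℕ) => Y n ω).prod (noise (P.map (ε 0)))| ≤ 2 * τ := by
  have hYm : Measurable fun ω (n : ℕ) => Y n ω := measurable_pi_lambda _ fun n => hY n
  have := Measure.isProbabilityMeasure_map (μ := P) (hε 0).aemeasurable
  have := Measure.isProbabilityMeasure_map (μ := P) hYm.aemeasurable
  have hZ : Measurable fun ω => ((fun n : ℕ => Y n ω), X 0 ω) := hYm.prodMk (hX.measurable 0)
  have := Measure.isProbabilityMeasure_map (μ := P) hZ.aemeasurable
  have hΨ := hZ.prodMk (measurable_forwardPath hε 1)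
  have h1 : Measurable fun p : ((ℕ → E) × ℝ) × (ℕ → ℝ) => (p.1.2, p.1.1, p.2) := by fun_prop
  have hFj : IsUnitFun fun p : ((ℕ → E) × ℝ) × (ℕ → ℝ) =>
      F (shift N (jointPath r σ p.1.2 (p.1.1, p.2))) :=
    hF.comp ((measurable_shift N).comp ((measurable_jointPath hr hσ).comp h1))
  have hT := hF.tailMean (η := P.map (ε 0)) hr hσ N
  have hTX : IsUnitFun fun ω =>
      tailMean (P.map (ε 0)) r σ F N (fun n : ℕ => Y n ω) (X 0 ω) := hT.comp hZ
  have hT0 : IsUnitFun fun y => tailMean (P.map (ε 0)) r σ F N y 0 :=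
    hT.comp (φ := fun y => (y, (0 : ℝ))) (by fun_prop)
  have e1 : ∫ ω, F (shift N fun n : ℕ => (X n ω, Y n ω)) ∂P =
      ∫ ω, tailMean (P.map (ε 0)) r σ F N (fun n : ℕ => Y n ω) (X 0 ω) ∂P := by
    calc ∫ ω, F (shift N fun n : ℕ => (X n ω, Y n ω)) ∂P
        = ∫ ω, F (shift N (jointPath r σ (X 0 ω)
            ((fun n : ℕ => Y n ω), fun n : ℕ => ε (1 + n) ω))) ∂P := by
          refine integral_congr_ae ?_
          filter_upwards [hX.ae_eq_jointPath] with ω hω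
          rw [hω]
      _ = ∫ p, F (shift N (jointPath r σ p.1.2 (p.1.1, p.2)))
            ∂P.map (fun ω => (((fun n : ℕ => Y n ω), X 0 ω), fun n : ℕ => ε (1 + n) ω)) :=
          (integral_map hΨ.aemeasurable hFj.measurable.aestronglyMeasurable).symm
      _ = ∫ p, tailMean (P.map (ε 0)) r σ F N p.1 p.2
            ∂P.map fun ω => ((fun n : ℕ => Y n ω), X 0 ω) := by
          rw [hX.map_noise hr hσ hσ0 hY hε hεident, integral_prod _ (hFj.integrable _)]
          rfl
      _ = _ := integral_map hZ.aemeasurable hT.measurable.aestronglyMeasurable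
  have e2 : ∫ w, F (shift N (jointPath r σ 0 w))
        ∂(P.map fun ω (n : ℕ) => Y n ω).prod (noise (P.map (ε 0))) =
      ∫ ω, tailMean (P.map (ε 0)) r σ F N (fun n : ℕ => Y n ω) 0 ∂P := by
    rw [integral_prod _ ((hF.jointPath hr hσ 0 N).integrable _)]
    exact integral_map hYm.aemeasurable hT0.measurable.aestronglyMeasurable
  have hset : MeasurableSet {ω | v < |X 0 ω|} :=
    measurableSet_lt measurable_const (hX.measurable 0).norm
  have hSY : IsUnitFun fun ω => S fun n : ℕ => Y n ω := hS.comp hYm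
  have hind : IsUnitFun ({ω | v < |X 0 ω|}.indicator fun _ => (1 : ℝ)) :=
    IsUnitFun.indicator_one hset
  have hTY : IsUnitFun fun ω => tailMean (P.map (ε 0)) r σ F N (fun n : ℕ => Y n ω) 0 :=
    hT0.comp hYm
  rw [e1, e2, ← integral_sub (hTX.integrable P) (hTY.integrable P)]
  calc |∫ ω, (tailMean (P.map (ε 0)) r σ F N (fun n : ℕ => Y n ω) (X 0 ω) -
        tailMean (P.map (ε 0)) r σ F N (fun n : ℕ => Y n ω) 0) ∂P|
      ≤ ∫ ω, |tailMean (P.map (ε 0)) r σ F N (fun n : ℕ => Y n ω) (X 0 ω) -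
        tailMean (P.map (ε 0)) r σ F N (fun n : ℕ => Y n ω) 0| ∂P := abs_integral_le_integral_abs
    _ ≤ ∫ ω, (S (fun n : ℕ => Y n ω) +
          {ω | v < |X 0 ω|}.indicator (fun _ => (1 : ℝ)) ω) ∂P := by
        refine integral_mono ((hTX.integrable P).sub (hTY.integrable P)).abs
          ((hSY.integrable P).add (hind.integrable P)) fun ω => ?_
        by_cases hω : v < |X 0 ω|
        · rw [Set.indicator_of_mem (by exact hω)]
          exact (hT.abs_sub_le_one ((fun n : ℕ => Y n ω), X 0 ω) ((fun n : ℕ => Y n ω), 0)).trans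
            (le_add_of_nonneg_left (hS.nonneg _))
        · rw [Set.indicator_of_notMem (by exact hω), add_zero]
          exact hSb F hF _ _ (not_lt.1 hω)
    _ = ∫ y, S y ∂(P.map fun ω (n : ℕ) => Y n ω) + P.real {ω | v < |X 0 ω|} := by
        rw [integral_add (hSY.integrable P) (hind.integrable P),
          integral_map hYm.aemeasurable hS.measurable.aestronglyMeasurable]
        congr 1
        exact integral_indicator_one hset
    _ ≤ 2 * τ := by linarith

omit [IsProbabilityMeasure P] in
lemma exists_abs_tail_le [IsFiniteMeasure P] {Z : Ω → ℝ} (hZ : Measurable Z) {τ : ℝ}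
    (hτ : 0 < τ) : ∃ v : ℝ, 0 ≤ v ∧ P.real {ω | v < |Z ω|} ≤ τ := by
  have h1 : Tendsto (fun n : ℕ => P {ω | (n : ℝ) < |Z ω|}) atTop
      (𝓝 (P (⋂ n : ℕ, {ω | (n : ℝ) < |Z ω|}))) := by
    refine tendsto_measure_iInter_atTop
      (fun n => (measurableSet_lt measurable_const hZ.norm).nullMeasurableSet) ?_
      ⟨0, measure_ne_top _ _⟩
    intro n n' hn ω hω
    exact lt_of_le_of_lt (Nat.cast_le.2 hn : (n : ℝ) ≤ n') hω
  have h2 : ⋂ n : ℕ, {ω | (n : ℝ) < |Z ω|} = ∅ := by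
    ext ω
    simp only [Set.mem_iInter, Set.mem_ofPred_eq, Set.mem_empty_iff_false, iff_false, not_forall,
      not_lt]
    exact exists_nat_ge |Z ω|
  rw [h2, measure_empty] at h1
  obtain ⟨n, hn⟩ := (h1.eventually_le_const (ENNReal.ofReal_pos.2 hτ)).exists
  exact ⟨n, n.cast_nonneg, ENNReal.toReal_le_of_le_ofReal hτ.le hn⟩

/-- Bounds on canonical covariances and loss of memory give bounds on the strong mixing
coefficients of a stationary solution. -/
theorem IsStationarySolution.alphaMix_le (hX : IsStationarySolution P r σ Y ε X)
    (hr : Measurable (Function.uncurry r)) (hσ : Measurable (Function.uncurry σ))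
    (hσ0 : ∀ y x, σ y x ≠ 0) (hY : ∀ t, Measurable (Y t)) (hε : ∀ t, Measurable (ε t))
    (hεident : ∀ t, IdentDistrib (ε t) (ε 0) P P)
    (hforget : ∀ v : ℝ, 0 ≤ v → ∀ τ : ℝ, 0 < τ → ∃ (N : ℕ) (S : (ℕ → E) → ℝ), IsUnitFun S ∧
      ∫ y, S y ∂(P.map fun ω (n : ℕ) => Y n ω) ≤ τ ∧
      ∀ g : (ℕ → ℝ × E) → ℝ, IsUnitFun g → ∀ y u, |u| ≤ v →
        |tailMean (P.map (ε 0)) r σ g N y u - tailMean (P.map (ε 0)) r σ g N y 0| ≤ S y)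
    {m : ℕ} {c : ℝ}
    (hc : ∀ (j : ℕ) (f g : (ℕ → ℝ × E) → ℝ), IsUnitFun f → IsUnitFun g →
      (∀ w, f (freeze j w) = f w) →
      |∫ w, f (jointPath r σ 0 w) * g (shift (j + m) (jointPath r σ 0 w))
          ∂(P.map fun ω (n : ℕ) => Y n ω).prod (noise (P.map (ε 0))) -
        (∫ w, f (jointPath r σ 0 w) ∂(P.map fun ω (n : ℕ) => Y n ω).prod (noise (P.map (ε 0)))) *
          ∫ w, g (shift (j + m) (jointPath r σ 0 w))
            ∂(P.map fun ω (n : ℕ) => Y n ω).prod (noise (P.map (ε 0)))| ≤ c) :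
    alphaMix P (fun (t : ℤ) ω => (X t ω, Y t ω)) m ≤ c := by
  have hW : ∀ t : ℤ, Measurable fun ω => (X t ω, Y t ω) := fun t => (hX.measurable t).prodMk (hY t)
  refine alphaMix_le_of_cov hW fun i j f g hf hg hfj => le_of_forall_pos_le_add fun τ hτ => ?_
  -- Each passage to the started chain costs `2 * (τ / 6)`: once for the mean of the product and
  -- twice for the product of the means, hence `τ` in total.
  obtain ⟨v, hv, hvτ⟩ := exists_abs_tail_le (P := P) (hX.measurable 0)
    (show 0 < τ / 6 by positivity)
  obtain ⟨N, S, hS, hSτ, hSb⟩ := hforget v hv (τ / 6) (by positivity)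
  have hlaw : ∀ F : (ℕ → ℝ × E) → ℝ, IsUnitFun F →
      |∫ ω, F (fun n : ℕ => (X (i + n) ω, Y (i + n) ω)) ∂P -
        ∫ w, F (shift N (jointPath r σ 0 w))
          ∂(P.map fun ω (n : ℕ) => Y n ω).prod (noise (P.map (ε 0)))| ≤ 2 * (τ / 6) := by
    intro F hF
    have h1 : ∀ s : ℤ, ∫ ω, F (fun n : ℕ => (X (s + n) ω, Y (s + n) ω)) ∂P =
        ∫ w, F w ∂P.map fun ω (n : ℕ) => (X n ω, Y n ω) := by
      intro s
      rw [← hX.stationary.map_forwardPath s]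
      exact (integral_map (measurable_forwardPath hW s).aemeasurable
        hF.measurable.aestronglyMeasurable).symm
    -- By stationarity the window starting at `i` has the law of the one starting at `N`, by which
    -- time the initial value is nearly forgotten.
    rw [h1 i, ← h1 N]
    have h2 := hX.abs_integral_sub_le hr hσ hσ0 hY hε hεident hS hSτ hSb hvτ hF
    have h3 : ∀ ω, (shift N fun n : ℕ => (X n ω, Y n ω)) =
        fun n : ℕ => (X (N + n) ω, Y (N + n) ω) := fun ω => by
      funext n; simp only [shift, Nat.cast_add]
    simpa only [h3] using h2
  have hN : ∀ w : ℕ → ℝ × E, shift (j + m) (shift N w) = shift (N + j + m) w := by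
    intro w; rw [shift_shift]; congr 1; ring
  have hgs : IsUnitFun fun w => g (shift (j + m) w) := hg.comp (measurable_shift _)
  -- The delay `N` moves the present to `N + j`; the bound `c` is uniform in the present, so nothing
  -- is lost however large `N` is.
  have hcan := hc (N + j) (fun w => f (shift N w)) g (hf.comp (measurable_shift N)) hg fun w => by
    rw [← hfj (shift N w), ← hfj (shift N (freeze (N + j) w))]
    congr 1
    funext n
    simp only [freeze, shift]
    congr 1
    omega
  have h1 := hlaw _ hf
  have h2 := hlaw _ hgs
  have h3 := hlaw _ (hf.mul hgs)
  simp only [hN] at h2 h3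
  set μ := (P.map fun ω (n : ℕ) => Y n ω).prod (noise (P.map (ε 0)))
  have hYm : Measurable fun ω (n : ℕ) => Y n ω := measurable_pi_lambda _ fun n => hY n
  have := Measure.isProbabilityMeasure_map (μ := P) (hε 0).aemeasurable
  have := Measure.isProbabilityMeasure_map (μ := P) hYm.aemeasurable
  have b1 := (hf.comp (measurable_forwardPath hW i)).integral_nonneg P
  have b2 := (hf.comp (measurable_forwardPath hW i)).integral_le_one P
  have b3 := (hg.jointPath hr hσ 0 (N + j + m)).integral_nonneg μ
  have b4 := (hg.jointPath hr hσ 0 (N + j + m)).integral_le_one μ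
  set A := ∫ ω, f (fun n : ℕ => (X (i + n) ω, Y (i + n) ω)) ∂P
  set B := ∫ ω, g (shift (j + m) fun n : ℕ => (X (i + n) ω, Y (i + n) ω)) ∂P
  set A' := ∫ w, f (shift N (jointPath r σ 0 w)) ∂μ
  set B' := ∫ w, g (shift (N + j + m) (jointPath r σ 0 w)) ∂μ
  have h4 : |A * B - A' * B'| ≤ 4 * (τ / 6) := by
    calc |A * B - A' * B'| = |A * (B - B') + B' * (A - A')| := by ring_nf
      _ ≤ |A * (B - B')| + |B' * (A - A')| := abs_add_le _ _
      _ = A * |B - B'| + B' * |A - A'| := by rw [abs_mul, abs_mul, abs_of_nonneg b1, abs_of_nonneg b3]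
      _ ≤ 1 * (2 * (τ / 6)) + 1 * (2 * (τ / 6)) := by gcongr
      _ = _ := by ring
  rw [abs_le] at *
  constructor <;> linarith [hcan.1, hcan.2, h3.1, h3.2, h4.1, h4.2]

end StationarySolution

/-! ### Drift bounds under the two sets of hypotheses -/

section Drift

variable {E : Type*} [MeasurableSpace E] {γ K : E → ℝ} {π : Measure (ℕ → E)}
  [IsProbabilityMeasure π]

omit [IsProbabilityMeasure π] in
/-- Drift bound from bounds on the expected drift contracted along the environment. -/
lemma isDriftBound_tsum_add (hγ : ∀ y, 0 ≤ γ y) (hK : ∀ y, 0 ≤ K y) (hγm : Measurable γ)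
    (hKm : Measurable K) (hstat : ∀ k, MeasurePreserving (shift k) π π) {c p : ℕ → ℝ}
    (hc0 : ∀ l, 0 ≤ c l) (hcs : Summable c) (hp0 : ∀ l, 0 ≤ p l)
    (hc : ∀ l, ∫⁻ y, ENNReal.ofReal (K (y 0) * prodCoef γ (shift 1 y) l) ∂π ≤ ENNReal.ofReal (c l))
    (hp : ∀ l, ∫⁻ y, ENNReal.ofReal (prodCoef γ y l) ∂π ≤ ENNReal.ofReal (p l)) :
    IsDriftBound γ K π fun L => ∑' i, c (L + i) + p L where
  nonneg L := add_nonneg (tsum_nonneg fun _ => hc0 _) (hp0 L)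
  accum_le L t := (lintegral_accum_mul_prodCoef_le hγ hK hγm hKm hstat hc0 hcs hc t L).trans
    (ENNReal.ofReal_le_ofReal (le_add_of_nonneg_right (hp0 L)))
  prodCoef_le L := (hp L).trans
    (ENNReal.ofReal_le_ofReal (le_add_of_nonneg_left (tsum_nonneg fun _ => hc0 _)))

omit [MeasurableSpace E] in
lemma prodCoef_le_pow (hγ : ∀ y, 0 ≤ γ y) {ρ : ℝ} {y : ℕ → E} (h : ∀ n, γ (y n) ≤ ρ) (l : ℕ) :
    prodCoef γ y l ≤ ρ ^ l := by
  unfold prodCoef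
  refine (Finset.prod_le_prod (fun i _ => hγ _) fun i _ => h i).trans ?_
  simp

lemma lintegral_prodCoef_le_pow (hγ : ∀ y, 0 ≤ γ y) {ρ : ℝ}
    (hγρ : ∀ᵐ y ∂π, ∀ n, γ (y n) ≤ ρ) (l : ℕ) :
    ∫⁻ y, ENNReal.ofReal (prodCoef γ y l) ∂π ≤ ENNReal.ofReal (ρ ^ l) := by
  calc ∫⁻ y, ENNReal.ofReal (prodCoef γ y l) ∂π ≤ ∫⁻ _, ENNReal.ofReal (ρ ^ l) ∂π := by
        refine lintegral_mono_ae ?_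
        filter_upwards [hγρ] with y hy
        exact ENNReal.ofReal_le_ofReal (prodCoef_le_pow hγ hy l)
    _ = _ := by simp

lemma eventually_pow_le_rpow {ρ : ℝ} (hρ0 : 0 ≤ ρ) (hρ1 : ρ < 1) (a : ℝ) :
    ∀ᶠ L : ℕ in atTop, ρ ^ L ≤ (L : ℝ) ^ (-a) := by
  obtain ⟨k, hk⟩ := exists_nat_ge a
  have h1 := tendsto_pow_const_mul_const_pow_of_abs_lt_one k
    (by rwa [abs_of_nonneg hρ0] : |ρ| < 1)
  filter_upwards [h1.eventually_le_const zero_lt_one, eventually_ge_atTop 1] with L hL hL1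
  have hL1' : (1 : ℝ) ≤ L := by exact_mod_cast hL1
  have hL0 : (0 : ℝ) < L := by linarith
  rw [Real.rpow_neg hL0.le, ← one_div, le_div_iff₀ (Real.rpow_pos_of_pos hL0 a), mul_comm]
  refine le_trans (mul_le_mul_of_nonneg_right ?_ (pow_nonneg hρ0 L)) hL
  rw [← Real.rpow_natCast]
  exact Real.rpow_le_rpow_of_exponent_le hL1' hk

/-- Drift bound of geometric decay under a uniform contraction. -/
lemma exists_isDriftBound_of_le (hγ : ∀ y, 0 ≤ γ y) (hK : ∀ y, 0 ≤ K y) (hγm : Measurable γ)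
    (hKm : Measurable K) (hstat : ∀ k, MeasurePreserving (shift k) π π) {ρ : ℝ} (hρ0 : 0 ≤ ρ)
    (hρ1 : ρ < 1) (hγρ : ∀ᵐ y ∂π, ∀ n, γ (y n) ≤ ρ) (hKi : Integrable (fun y => K (y 0)) π)
    (a : ℝ) :
    ∃ (ζ : ℕ → ℝ) (C : ℝ), IsDriftBound γ K π ζ ∧
      ∀ᶠ L : ℕ in atTop, ζ L ≤ C * (L : ℝ) ^ (-a) := by
  set κ := ∫ y, K (y 0) ∂π with hκ
  have hκ0 : 0 ≤ κ := integral_nonneg fun y => hK _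
  have hsum : Summable fun l : ℕ => κ * ρ ^ l := (summable_geometric_of_lt_one hρ0 hρ1).mul_left κ
  refine ⟨_, κ / (1 - ρ) + 1, isDriftBound_tsum_add hγ hK hγm hKm hstat (c := fun l => κ * ρ ^ l)
    (p := fun l => ρ ^ l) (fun l => by positivity) hsum (fun l => by positivity) (fun l => ?_)
    (lintegral_prodCoef_le_pow hγ hγρ), ?_⟩
  · calc ∫⁻ y, ENNReal.ofReal (K (y 0) * prodCoef γ (shift 1 y) l) ∂π
        ≤ ∫⁻ y, ENNReal.ofReal (K (y 0)) * ENNReal.ofReal (ρ ^ l) ∂π := by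
          refine lintegral_mono_ae ?_
          filter_upwards [hγρ] with y hy
          rw [← ENNReal.ofReal_mul (hK _)]
          exact ENNReal.ofReal_le_ofReal (mul_le_mul_of_nonneg_left
            (prodCoef_le_pow hγ (fun n => hy _) l) (hK _))
      _ = ENNReal.ofReal (κ * ρ ^ l) := by
          rw [lintegral_mul_const' _ _ ENNReal.ofReal_ne_top,
            ← ofReal_integral_eq_lintegral_ofReal hKi (ae_of_all _ fun y => hK _),
            ENNReal.ofReal_mul hκ0]
  · filter_upwards [eventually_pow_le_rpow hρ0 hρ1 a] with L hL
    have h1 : ∑' i : ℕ, κ * ρ ^ (L + i) = κ / (1 - ρ) * ρ ^ L := by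
      simp only [pow_add, ← mul_assoc]
      rw [tsum_mul_left, tsum_geometric_of_lt_one hρ0 hρ1]
      ring
    have h2 : 0 ≤ κ / (1 - ρ) := div_nonneg hκ0 (by linarith)
    simp only [h1]
    calc κ / (1 - ρ) * ρ ^ L + ρ ^ L = (κ / (1 - ρ) + 1) * ρ ^ L := by ring
      _ ≤ _ := by gcongr

/-- Since `log L ≤ L`, the surplus factor `(log L) ^ (a - b)` is absorbed by the surplus power. The
environment terms are thus dominated by the drift tail. -/
lemma log_rpow_mul_rpow_neg_le {a b : ℝ} (hba : b ≤ a) {L : ℕ} (hL : 3 ≤ L) :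
    (Real.log L) ^ a * (L : ℝ) ^ (-a) ≤ (Real.log L) ^ b * (L : ℝ) ^ (-(b - 1)) := by
  have hL3 : (3 : ℝ) ≤ L := by exact_mod_cast hL
  have hL0 : (0 : ℝ) < L := by linarith
  have hlog : 1 ≤ Real.log L := by
    rw [Real.le_log_iff_exp_le hL0]
    linarith [Real.exp_one_lt_d9]
  have hlog0 : 0 < Real.log L := by linarith
  have h1 : (Real.log L) ^ (a - b) ≤ (L : ℝ) ^ (a - b) :=
    Real.rpow_le_rpow hlog0.le ((Real.log_le_sub_one_of_pos hL0).trans (by linarith))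
      (by linarith)
  calc (Real.log L) ^ a * (L : ℝ) ^ (-a)
      = (Real.log L) ^ b * ((Real.log L) ^ (a - b) * (L : ℝ) ^ (-a)) := by
        rw [← mul_assoc, ← Real.rpow_add hlog0]; ring_nf
    _ ≤ (Real.log L) ^ b * ((L : ℝ) ^ (a - b) * (L : ℝ) ^ (-a)) := by gcongr
    _ = (Real.log L) ^ b * (L : ℝ) ^ (-b) := by
        rw [← Real.rpow_add hL0]; ring_nf
    _ ≤ (Real.log L) ^ b * (L : ℝ) ^ (-(b - 1)) := by
        gcongr
        · linarith
        · linarith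

lemma rpow_neg_le_log_rpow_mul {a : ℝ} (ha : 0 ≤ a) {L : ℕ} (hL : 3 ≤ L) :
    (L : ℝ) ^ (-a) ≤ (Real.log L) ^ a * (L : ℝ) ^ (-a) := by
  have hL3 : (3 : ℝ) ≤ L := by exact_mod_cast hL
  have hlog : 1 ≤ Real.log L := by
    rw [Real.le_log_iff_exp_le (by linarith)]
    linarith [Real.exp_one_lt_d9]
  exact le_mul_of_one_le_left (by positivity) (Real.one_le_rpow hlog ha)

/-- Drift bound of polynomial decay when the environment contracts with positive probability. -/
lemma exists_isDriftBound_of_integral_lt (hγ : ∀ y, 0 ≤ γ y) (hK : ∀ y, 0 ≤ K y)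
    (hγm : Measurable γ) (hKm : Measurable K) (hstat : ∀ k, MeasurePreserving (shift k) π π)
    {α : ℕ → ℝ} (hmix : MixBound π α) (hγ1 : ∀ᵐ y ∂π, ∀ n, γ (y n) ≤ 1)
    (hρ : ∫ y, min 1 (γ (y 0)) ∂π < 1) {a k b C₀ : ℝ} (ha : 0 < a) (hk : 1 < k)
    (hb : b = a * (k - 1) / k) (hb1 : 1 < b) (hKk : Integrable (fun y => K (y 0) ^ k) π)
    (hα : ∀ᶠ L : ℕ in atTop, α L ≤ C₀ * (L : ℝ) ^ (-a)) :
    ∃ (ζ : ℕ → ℝ) (C : ℝ), IsDriftBound γ K π ζ ∧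
      ∀ᶠ L : ℕ in atTop, α L + ζ L ≤ C * ((Real.log L) ^ b * (L : ℝ) ^ (-(b - 1))) := by
  set ρ := ∫ y, min 1 (γ (y 0)) ∂π with hρdef
  have hρ0 : 0 ≤ ρ := integral_nonneg fun y => le_min zero_le_one (hγ _)
  have hk0 : 0 < k := by linarith
  have hba : b ≤ a := by
    rw [hb, mul_div_assoc]
    exact mul_le_of_le_one_right ha.le ((div_le_one hk0).2 (by linarith))
  set p : ℕ → ℝ := fun l => (∫⁻ y, ENNReal.ofReal (prodCoef γ y l) ∂π).toReal with hp
  have hp0 : ∀ l, 0 ≤ p l := fun l => ENNReal.toReal_nonneg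
  have hple : ∀ l, ∫⁻ y, ENNReal.ofReal (prodCoef γ y l) ∂π ≤ ENNReal.ofReal (p l) := fun l =>
    (ENNReal.ofReal_toReal (ne_top_of_le_ne_top ENNReal.ofReal_ne_top
      (lintegral_prodCoef_le_pow hγ hγ1 l))).ge
  -- The block optimization is used a first time, now with the spacing of the retained factors as
  -- block length.
  obtain ⟨C₁, hC₁, hrate⟩ := exists_blocks_rate (e := fun L => α L / (1 - ρ)) hρ0 hρ ha le_rfl
    (C₀ := C₀ / (1 - ρ)) (by
      filter_upwards [hα] with L hL
      rw [Real.rpow_zero, one_mul, div_mul_eq_mul_div]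
      exact div_le_div_of_nonneg_right hL (by linarith))
  have hprate : ∀ᶠ l : ℕ in atTop, p l ≤ C₁ * ((Real.log l) ^ a * (l : ℝ) ^ (-a)) := by
    filter_upwards [hrate] with l ⟨q, g, hq, hg, hqg, hle⟩
    have h1 := lintegral_prodCoef_le hγ hγm hmix hγ1 le_rfl hρ hg
      (show q * g ≤ l by nlinarith)
    rw [add_zero] at hle
    refine le_trans ?_ hle
    exact ENNReal.toReal_le_of_le_ofReal
      (add_nonneg (pow_nonneg hρ0 _) (div_nonneg (hmix.nonneg g) (by linarith))) h1
  set κ := (∫ y, K (y 0) ^ k ∂π) ^ (1 / k) with hκ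
  have hκ0 : 0 ≤ κ := Real.rpow_nonneg (integral_nonneg fun y => Real.rpow_nonneg (hK _) _) _
  set c : ℕ → ℝ := fun l => κ * p l ^ ((k - 1) / k) with hc
  have hc0 : ∀ l, 0 ≤ c l := fun l => mul_nonneg hκ0 (Real.rpow_nonneg (hp0 l) _)
  have hkk : 0 ≤ (k - 1) / k := div_nonneg (by linarith) hk0.le
  have hab : a * ((k - 1) / k) = b := by rw [hb, mul_div_assoc]
  -- Hölder's exponent `(k - 1) / k` turns the rate `a` of the product into `b`, for the logarithm
  -- and the power alike.
  have hcrate : ∀ᶠ l : ℕ in atTop,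
      c l ≤ κ * C₁ ^ ((k - 1) / k) * ((Real.log l) ^ b * (l : ℝ) ^ (-b)) := by
    filter_upwards [hprate] with l hl
    have hlog : 0 ≤ Real.log l := Real.log_natCast_nonneg l
    have hl0 : (0 : ℝ) ≤ l := l.cast_nonneg
    rw [mul_assoc]
    refine mul_le_mul_of_nonneg_left ?_ hκ0
    refine (Real.rpow_le_rpow (hp0 l) hl hkk).trans_eq ?_
    rw [Real.mul_rpow hC₁ (by positivity), Real.mul_rpow (by positivity) (by positivity),
      ← Real.rpow_mul hlog, ← Real.rpow_mul hl0, neg_mul, hab]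
  obtain ⟨hcs, C₂, hC₂⟩ := summable_and_tail_le hb1 hc0 hcrate
  refine ⟨_, |C₀| + (C₂ + C₁), isDriftBound_tsum_add hγ hK hγm hKm hstat hc0 hcs hp0 (fun l =>
    lintegral_mul_prodCoef_le hγ hK hγm hKm hstat hγ1 hk hKk (hp0 l) (hple l)) hple, ?_⟩
  filter_upwards [hα, hC₂, hprate, eventually_ge_atTop 3] with L h1 h2 h3 hL
  have h4 := log_rpow_mul_rpow_neg_le hba hL
  have h5 := (rpow_neg_le_log_rpow_mul ha.le hL).trans h4
  have h6 : C₀ * (L : ℝ) ^ (-a) ≤ |C₀| * ((Real.log L) ^ b * (L : ℝ) ^ (-(b - 1))) :=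
    (mul_le_mul_of_nonneg_right (le_abs_self C₀) (by positivity)).trans
      (mul_le_mul_of_nonneg_left h5 (abs_nonneg _))
  have h7 := mul_le_mul_of_nonneg_left h4 hC₁
  rw [add_mul, add_mul]
  linarith

end Drift

/-! ### Mixing rates of contractive models -/

section Rates

variable {Ω E : Type*} [MeasurableSpace Ω] [MeasurableSpace E] {P : Measure Ω}
  [IsProbabilityMeasure P] {Y : ℤ → Ω → E} {ε : ℤ → Ω → ℝ} {r σ : E → ℝ → ℝ} {γ K : E → ℝ}

lemma tendsto_log_rpow_mul_rpow_neg (δ : ℝ) {β : ℝ} (hβ : 0 < β) :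
    Tendsto (fun m : ℕ => (Real.log m) ^ δ * (m : ℝ) ^ (-β)) atTop (𝓝 0) := by
  have h1 := (isLittleO_log_rpow_rpow_atTop δ hβ).tendsto_div_nhds_zero.comp
    (tendsto_natCast_atTop_atTop (R := ℝ))
  refine h1.congr fun m => ?_
  simp only [Function.comp_apply]
  rw [Real.rpow_neg m.cast_nonneg, div_eq_mul_inv]

/-- Eventual upper bounds on mixing coefficients give both mixing and its rate. -/
lemma isAlphaMixing_and_isBigO {I S : Type*} [Preorder I] [AddMonoidWithOne I] [MeasurableSpace S]
    {W : I → Ω → S} {C δ β : ℝ} (hβ : 0 < β)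
    (h : ∀ᶠ m : ℕ in atTop, alphaMix P W m ≤ C * ((Real.log m) ^ δ * (m : ℝ) ^ (-β))) :
    IsAlphaMixing P W ∧
      alphaMix P W =O[atTop] fun m : ℕ => (Real.log m) ^ δ * (m : ℝ) ^ (-β) := by
  have h1 : alphaMix P W =O[atTop] fun m : ℕ => (Real.log m) ^ δ * (m : ℝ) ^ (-β) := by
    refine IsBigO.of_bound C ?_
    filter_upwards [h] with m hm
    have hlog : 0 ≤ Real.log m := Real.log_natCast_nonneg m
    rw [Real.norm_of_nonneg (alphaMix_nonneg m), Real.norm_of_nonneg (by positivity)]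
    exact hm
  exact ⟨h1.trans_tendsto (tendsto_log_rpow_mul_rpow_neg δ hβ), h1⟩

/-- Mixing of started and stationary solutions of a contractive model. -/
theorem IsContractiveModel.mixing
    (M : IsContractiveModel (P.map (ε 0)) r σ γ K (P.map fun ω (n : ℕ) => Y n ω) (alphaMix P Y))
    (hY : ∀ t, Measurable (Y t)) (hε : ∀ t, Measurable (ε t)) (hεindep : iIndepFun ε P)
    (hεident : ∀ t, IdentDistrib (ε t) (ε 0) P P)
    (hεY : IndepFun (fun ω (t : ℤ) => ε t ω) (fun ω (t : ℤ) => Y t ω) P) {ζ : ℕ → ℝ}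
    (hζ : IsDriftBound γ K (P.map fun ω (n : ℕ) => Y n ω) ζ) {β δ C₀ : ℝ} (hβ : 0 < β)
    (hδ : 0 ≤ δ)
    (he : ∀ᶠ L : ℕ in atTop, alphaMix P Y L + ζ L ≤ C₀ * ((Real.log L) ^ δ * (L : ℝ) ^ (-β))) :
    (∀ (x : ℝ) (X : ℕ → Ω → ℝ), IsStartedSolution r σ Y ε x X →
      IsAlphaMixing P (fun (t : ℕ) ω => (X t ω, Y t ω)) ∧
      alphaMix P (fun (t : ℕ) ω => (X t ω, Y t ω)) =O[atTop]
        fun m : ℕ => (Real.log m) ^ (β + δ) * (m : ℝ) ^ (-β)) ∧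
    (∀ X : ℤ → Ω → ℝ, IsStationarySolution P r σ Y ε X →
      IsAlphaMixing P (fun (t : ℤ) ω => (X t ω, Y t ω)) ∧
      alphaMix P (fun (t : ℤ) ω => (X t ω, Y t ω)) =O[atTop]
        fun m : ℕ => (Real.log m) ^ (β + δ) * (m : ℝ) ^ (-β)) := by
  have hYm : Measurable fun ω (n : ℕ) => Y n ω := measurable_pi_lambda _ fun n => hY n
  have := Measure.isProbabilityMeasure_map (μ := P) (hε 0).aemeasurable
  have := Measure.isProbabilityMeasure_map (μ := P) hYm.aemeasurable
  constructor
  · intro x X hX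
    obtain ⟨C, hC⟩ := M.exists_mixing_rate hζ hβ hδ he x
    refine isAlphaMixing_and_isBigO (C := C) hβ ?_
    filter_upwards [hC] with m hm
    exact alphaMix_started_le M.r_meas M.σ_meas hY hε hεindep hεident hεY hX hm
  · intro X hX
    obtain ⟨C, hC⟩ := M.exists_mixing_rate hζ hβ hδ he 0
    have he0 : Tendsto (fun L => alphaMix P Y L + ζ L) atTop (𝓝 0) := by
      refine tendsto_of_tendsto_of_tendsto_of_le_of_le' tendsto_const_nhds ?_
        (Eventually.of_forall fun L => add_nonneg (alphaMix_nonneg L) (hζ.nonneg L)) he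
      simpa using (tendsto_log_rpow_mul_rpow_neg δ hβ).const_mul C₀
    refine isAlphaMixing_and_isBigO (C := C) hβ ?_
    filter_upwards [hC] with m hm
    refine hX.alphaMix_le M.r_meas M.σ_meas M.σ_ne hY hε hεident (fun v hv τ hτ => ?_) hm
    obtain ⟨N, hN⟩ := M.eventually_forget hζ he0 hv hτ
    obtain ⟨S, hS⟩ := hN N le_rfl
    exact ⟨N, S, hS⟩

end Rates

/-! ### Verification of the model hypotheses and conclusion -/

lemma ae_forall_coordinate_le {E : Type*} [MeasurableSpace E] {π : Measure (ℕ → E)}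
    (hstat : ∀ k, MeasurePreserving (shift k) π π) {γ : E → ℝ} {c : ℝ}
    (h : ∀ᵐ y ∂π, γ (y 0) ≤ c) : ∀ᵐ y ∂π, ∀ n, γ (y n) ≤ c :=
  ae_all_iff.2 fun n => (hstat n).quasiMeasurePreserving.ae h

/-- A variable of second moment one has first absolute moment at most one. -/
lemma lintegral_abs_le_one {Ω : Type*} [MeasurableSpace Ω] {P : Measure Ω} [IsProbabilityMeasure P]
    {Z : Ω → ℝ} (hZ : Measurable Z) (h : ∫ ω, (Z ω) ^ 2 ∂P = 1) :
    ∫⁻ z, ENNReal.ofReal |z| ∂P.map Z ≤ 1 := by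
  -- The integral of a non-integrable function is `0` by convention, so the value `1` forces
  -- integrability.
  have hi : Integrable (fun ω => (Z ω) ^ 2) P := by
    by_contra hn
    rw [integral_undef hn] at h
    exact zero_ne_one h
  rw [lintegral_map (by fun_prop) hZ]
  calc ∫⁻ ω, ENNReal.ofReal |Z ω| ∂P ≤ ∫⁻ ω, ENNReal.ofReal ((1 + Z ω ^ 2) / 2) ∂P := by
        refine lintegral_mono fun ω => ENNReal.ofReal_le_ofReal ?_
        nlinarith [sq_nonneg (|Z ω| - 1), sq_abs (Z ω)]
    _ = ENNReal.ofReal (∫ ω, (1 + Z ω ^ 2) / 2 ∂P) :=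
        (ofReal_integral_eq_lintegral_ofReal (((integrable_const 1).add hi).div_const 2)
          (ae_of_all _ fun ω => 
            div_nonneg (add_nonneg zero_le_one (sq_nonneg (Z ω))) zero_le_two)).symm
    _ = 1 := by
        rw [integral_div, integral_add (integrable_const 1) hi, h]
        simp

/-- The nonnegative function `1 - min 1 γ` is positive on a set of positive mass. Truncation keeps
the integrand bounded without an almost sure bound on `γ`. -/
lemma integral_min_one_lt_one {E : Type*} [MeasurableSpace E] {π : Measure E}
    [IsProbabilityMeasure π] {γ : E → ℝ} (hγ : ∀ y, 0 ≤ γ y) (hγm : Measurable γ)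
    (h : 0 < π {y | γ y < 1}) : ∫ y, min 1 (γ y) ∂π < 1 := by
  have hu : IsUnitFun fun y => min 1 (γ y) := ⟨measurable_const.min hγm,
    fun y => le_min zero_le_one (hγ y), fun y => min_le_left _ _⟩
  have h1 : 0 < ∫ y, (1 - min 1 (γ y)) ∂π := by
    rw [integral_pos_iff_support_of_nonneg hu.one_sub.nonneg (hu.one_sub.integrable π)]
    refine h.trans_le (measure_mono fun y hy => ?_)
    rw [Function.mem_support, min_eq_right (le_of_lt hy)]
    exact (sub_pos.2 hy).ne'
  rw [integral_sub (integrable_const 1) (hu.integrable π)] at h1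
  simpa using h1

theorem mainTheorem9 {Ω : Type*} [MeasurableSpace Ω] (P : Measure Ω) [IsProbabilityMeasure P]
    {d : ℕ}
    -- the environment, a stationary process with power decay of the mixing rates
    (Y : ℤ → Ω → EuclideanSpace ℝ (Fin d)) (hY : ∀ t, Measurable (Y t))
    (hYstat : IsStrictlyStationary P Y)
    (a : ℝ) (ha : 0 < a)
    (hYmix : alphaMix P Y =O[atTop] fun m : ℕ => (m : ℝ) ^ (-a))
    -- the noise: i.i.d., independent of the environment, centred with unit variance
    (ε : ℤ → Ω → ℝ) (hε : ∀ t, Measurable (ε t))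
    (hεindep : iIndepFun ε P) (hεident : ∀ t, IdentDistrib (ε t) (ε 0) P P)
    (hεY : IndepFun (fun ω (t : ℤ) => ε t ω) (fun ω (t : ℤ) => Y t ω) P)
    (hεmean : ∫ ω, ε 0 ω ∂P = 0) (hεvar : ∫ ω, (ε 0 ω) ^ 2 ∂P = 1)
    -- the density of the noise, bounded below on compact intervals
    (f : ℝ → ℝ) (hf : Measurable f) (hf0 : ∀ z, 0 ≤ f z)
    (hfε : P.map (ε 0) = volume.withDensity (fun z => ENNReal.ofReal (f z)))
    (hfpos : ∀ u v : ℝ, ∃ δ > 0, ∀ z ∈ Set.Icc u v, δ ≤ f z)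
    -- the location and scale functions and their linear growth bounds
    (r σ : EuclideanSpace ℝ (Fin d) → ℝ → ℝ)
    (hr : Measurable (Function.uncurry r)) (hσ : Measurable (Function.uncurry σ))
    (hσ0 : ∀ y x, 0 ≤ σ y x)
    (ra rb sc sd : EuclideanSpace ℝ (Fin d) → ℝ)
    (hra : Measurable ra) (hrb : Measurable rb) (hsc : Measurable sc) (hsd : Measurable sd)
    (hra0 : ∀ y, 0 ≤ ra y) (hrb0 : ∀ y, 0 ≤ rb y)
    (hsc0 : ∀ y, 0 ≤ sc y) (hsd0 : ∀ y, 0 ≤ sd y)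
    (hrbound : ∀ y x, |r y x| ≤ ra y * |x| + rb y)
    (hσbound : ∀ y x, |σ y x| ≤ sc y * |x| + sd y)
    (hσpos : ∀ R > 0, ∀ y, ∃ δ > 0, ∀ x, |x| ≤ R → δ ≤ σ y x)
    -- the drift coefficients
    (γ K : EuclideanSpace ℝ (Fin d) → ℝ)
    (hγ : ∀ y, γ y = ra y + sc y) (hK : ∀ y, K y = rb y + sd y) :
    -- first part
    (∀ γp : ℝ, 0 < γp → γp < 1 → (∀ᵐ ω ∂P, γ (Y 0 ω) ≤ γp) →
      Integrable (fun ω => K (Y 0 ω)) P →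
        (∀ (x : ℝ) (X : ℕ → Ω → ℝ), IsStartedSolution r σ Y ε x X →
          IsAlphaMixing P (fun (t : ℕ) ω => (X t ω, Y t ω)) ∧
          alphaMix P (fun (t : ℕ) ω => (X t ω, Y t ω)) =O[atTop]
            fun m : ℕ => (Real.log m) ^ a * (m : ℝ) ^ (-a)) ∧
        (∀ X : ℤ → Ω → ℝ, IsStationarySolution P r σ Y ε X →
          IsAlphaMixing P (fun (t : ℤ) ω => (X t ω, Y t ω)) ∧
          alphaMix P (fun (t : ℤ) ω => (X t ω, Y t ω)) =O[atTop]
            fun m : ℕ => (Real.log m) ^ a * (m : ℝ) ^ (-a))) ∧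
    -- second part
    (∀ k b : ℝ, 1 < k → b = a * (k - 1) / k → 1 < b →
      (∀ᵐ ω ∂P, γ (Y 0 ω) ∈ Set.Icc (0 : ℝ) 1) → 0 < P {ω | γ (Y 0 ω) < 1} →
      Integrable (fun ω => (K (Y 0 ω)) ^ k) P →
        (∀ (x : ℝ) (X : ℕ → Ω → ℝ), IsStartedSolution r σ Y ε x X →
          IsAlphaMixing P (fun (t : ℕ) ω => (X t ω, Y t ω)) ∧
          alphaMix P (fun (t : ℕ) ω => (X t ω, Y t ω)) =O[atTop]
            fun m : ℕ => (Real.log m) ^ (2 * b - 1) * (m : ℝ) ^ (-b + 1)) ∧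
        (∀ X : ℤ → Ω → ℝ, IsStationarySolution P r σ Y ε X →
          IsAlphaMixing P (fun (t : ℤ) ω => (X t ω, Y t ω)) ∧
          alphaMix P (fun (t : ℤ) ω => (X t ω, Y t ω)) =O[atTop]
            fun m : ℕ => (Real.log m) ^ (2 * b - 1) * (m : ℝ) ^ (-b + 1))) := by
  have hγm : Measurable γ := by
    have : γ = fun y => ra y + sc y := funext hγ
    rw [this]; exact hra.add hsc
  have hKm : Measurable K := by
    have : K = fun y => rb y + sd y := funext hK
    rw [this]; exact hrb.add hsd
  have hγ0 : ∀ y, 0 ≤ γ y := fun y => by rw [hγ]; exact add_nonneg (hra0 y) (hsc0 y)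
  have hK0 : ∀ y, 0 ≤ K y := fun y => by rw [hK]; exact add_nonneg (hrb0 y) (hsd0 y)
  have hgrow : ∀ y x, |r y x| + |σ y x| ≤ γ y * |x| + K y := fun y x => by
    rw [hγ, hK]; linarith [hrbound y x, hσbound y x]
  have hYm : Measurable fun ω (n : ℕ) => Y n ω := measurable_pi_lambda _ fun n => hY n
  set π := P.map fun ω (n : ℕ) => Y n ω with hπ
  have hη := Measure.isProbabilityMeasure_map (μ := P) (hε 0).aemeasurable
  have hπp : IsProbabilityMeasure π := Measure.isProbabilityMeasure_map hYm.aemeasurable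
  have hstat : ∀ k, MeasurePreserving (shift k) π π := hYstat.measurePreserving_shift hY
  have hmix : MixBound π (alphaMix P Y) := mixBound_alphaMix hYstat hY
  have hγle : ∀ c : ℝ, (∀ᵐ ω ∂P, γ (Y 0 ω) ≤ c) → ∀ᵐ y ∂π, ∀ n, γ (y n) ≤ c := fun c hc =>
    ae_forall_coordinate_le hstat ((ae_map_iff hYm.aemeasurable
      (measurableSet_le (hγm.comp (measurable_pi_apply 0)) measurable_const)).2 hc)
  have hint : ∀ F : EuclideanSpace ℝ (Fin d) → ℝ, Measurable F →
      Integrable (fun ω => F (Y 0 ω)) P → Integrable (fun y => F (y 0)) π := fun F hF hFi =>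
    (integrable_map_measure (hF.comp (measurable_pi_apply 0)).aestronglyMeasurable
      hYm.aemeasurable).2 hFi
  have model : (∀ᵐ y ∂π, ∀ n, γ (y n) ≤ 1) →
      IsContractiveModel (P.map (ε 0)) r σ γ K π (alphaMix P Y) := fun h1 =>
    { r_meas := hr
      σ_meas := hσ
      γ_nonneg := hγ0
      K_nonneg := hK0
      γ_meas := hγm
      K_meas := hKm
      growth := hgrow
      moment := lintegral_abs_le_one (hε 0) hεvar
      abs_cont := by rw [hfε]; exact withDensity_absolutelyContinuous _ _
      σ_ne := fun y x => by
        obtain ⟨δ, hδ, h⟩ := hσpos (|x| + 1) (by positivity) y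
        exact (hδ.trans_le (h x (by linarith))).ne'
      minor := fun R hR => by
        have := Measure.isProbabilityMeasure_map (μ := π)
          (measurable_pi_apply (X := fun _ : ℕ => EuclideanSpace ℝ (Fin d)) 0).aemeasurable
        rw [hfε] at hη ⊢
        exact exists_minorized hf hf0 hfpos hσ hγm hKm hgrow hσpos _ hR
      stat := hstat
      γ_le := h1
      mix := hmix }
  obtain ⟨C₀, hC₀⟩ := hYmix.bound
  have hα : ∀ᶠ L : ℕ in atTop, alphaMix P Y L ≤ C₀ * (L : ℝ) ^ (-a) := by
    filter_upwards [hC₀] with L hL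
    rwa [Real.norm_of_nonneg (alphaMix_nonneg L),
      Real.norm_of_nonneg (Real.rpow_nonneg L.cast_nonneg _)] at hL
  constructor
  · intro γp hγp0 hγp1 hγp hKi
    obtain ⟨ζ, C, hζ, hC⟩ := exists_isDriftBound_of_le hγ0 hK0 hγm hKm hstat hγp0.le hγp1
      (hγle γp hγp) (hint K hKm hKi) a
    have key := (model (hγle 1 (hγp.mono fun ω h => h.trans hγp1.le))).mixing hY hε hεindep
      hεident hεY hζ ha le_rfl (C₀ := C₀ + C) (by
        filter_upwards [hα, hC] with L h1 h2
        rw [Real.rpow_zero, one_mul, add_mul]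
        exact add_le_add h1 h2)
    simpa only [add_zero] using key
  · intro k b hk hb hb1 hγ1 hγpos hKk
    have h1 := hγle 1 (hγ1.mono fun ω h => h.2)
    have hρ : ∫ y, min 1 (γ (y 0)) ∂π < 1 := by
      refine integral_min_one_lt_one (γ := fun y : ℕ → EuclideanSpace ℝ (Fin d) => γ (y 0))
        (fun y => hγ0 _) (hγm.comp (measurable_pi_apply 0)) ?_
      have hset : MeasurableSet {y : ℕ → EuclideanSpace ℝ (Fin d) | γ (y 0) < 1} :=
        measurableSet_lt (hγm.comp (measurable_pi_apply 0)) measurable_const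
      rwa [hπ, Measure.map_apply hYm hset]
    obtain ⟨ζ, C, hζ, hC⟩ := exists_isDriftBound_of_integral_lt hγ0 hK0 hγm hKm hstat hmix h1 hρ
      ha hk hb hb1 (hint (fun y => K y ^ k) (hKm.pow_const k) hKk) hα
    -- Here `β = b - 1` and `δ = b`, so the logarithm has exponent `2 * b - 1`; the condition `1 <
    -- b` is exactly `0 < β`.
    have key := (model h1).mixing hY hε hεindep hεident hεY hζ (sub_pos.2 hb1) (by linarith) hC
    have e1 : b - 1 + b = 2 * b - 1 := by ring
    have e2 : -(b - 1) = -b + 1 := by ring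
    simpa only [e1, e2] using key
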